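/- Consider the I/O model in which blocks have $B$ bits, the internal memory has $M$ bits, and the cost of an algorithm is the number of blocks it reads and writes; computation in internal memory is free. Let $\lg=\log_2$. Let $\Sigma=\{a_1<\dots<a_\sigma\}$ be a finite ordered alphabet, let $B\ge\lg n$, and let $b=\Theta(B/\lg n)$ with $b\ge 2$. For $\mathbf x=x_1\dots x_n\in\Sigma^n$, let $H_0=\sum_{a\in\Sigma}\frac{n_a}{n}\lg\frac{n}{n_a}$ be its $0$th order entropy, where $n_a$ is the number of occurrences of $a$. The range query $[a_l,a_r]$ asks for the set $I=\{i : a_l\le x_i\le a_r\}$ in compressed form, namely as the run-length encoding with Elias gamma codes of the bitmap of $I$ or, if $|I|>n/2$, of the bitmap of its complement, together with one bit telling which; this output takes $O(1+\lg\binom{n}{z})$ bits, where $z=|I|$. Theorem. Every string $\mathbf x\in\Sigma^n$ can be stored in $O(nH_0+n+\sigma\lg^2 n)$ bits, with an absolute constant, in such a way that the following holds for every constant $\delta>0$. If $M\ge B(\sigma\lg n)^{\delta}$ and $n$ is sufficiently large (depending on $\delta$ and on the constants in $b=\Theta(B/\lg n)$), then every range query is answered, its output included, in $$O\!\left(\frac{k\lg(n/k)}{B}+\log_b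 n+\lg\lg n\right)\text{ I/Os},\qquad k=\min(z,n-z),$$ where $k\lg(n/k)$ is read as $0$ if $k=0$ and the constant depends only on $\delta$ and on the constants in $b=\Theta(B/\lg n)$. In particular, the bound is $O(z\lg(n/z)/B+\log_b n+\lg\lg n)$ for $z\le n/2$. -/

import Mathlib

namespace SecondaryIndex

/-- Binary logarithm. -/
noncomputable def lg (y : ℝ) : ℝ := Real.logb 2 y

/-! ### Strings, range queries, entropy -/

/-- The answer `I_{[l;r]}(x)` to an alphabet range query: the positions of `x` that hold a
character of the range `[l, r]`. -/
def rangeAnswer {n σ : ℕ} (x : Fin n → Fin σ) (l r : Fin σ) : Finset (Fin n) :=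
  Finset.univ.filter fun i => l ≤ x i ∧ x i ≤ r

/-- Number of occurrences of the character `a` in `x`. -/
def occ {n σ : ℕ} (x : Fin n → Fin σ) (a : Fin σ) : ℕ :=
  (Finset.univ.filter fun i => x i = a).card

/-- The `0`th order entropy `H₀ = ∑ₐ (nₐ / n) lg (n / nₐ)`; absent characters contribute `0`. -/
noncomputable def entropy0 {n σ : ℕ} (x : Fin n → Fin σ) : ℝ :=
  ∑ a : Fin σ, ((occ x a : ℝ) / n) * lg ((n : ℝ) / occ x a)

/-! ### Compressed bitmaps -/

/-- The bitmap (characteristic bit string) of a set of positions. -/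
def bitmap {n : ℕ} (S : Finset (Fin n)) : List Bool :=
  List.ofFn fun i : Fin n => decide (i ∈ S)

/-- The Elias gamma code of `m ≥ 1`: `⌊lg m⌋` zeros, then the binary digits of `m`, the most
significant one (which is `1`) first. -/
def eliasGamma (m : ℕ) : List Bool :=
  List.replicate (Nat.log 2 m) false ++ (Nat.bits m).reverse

/-- The lengths of the runs of `0`s that precede the successive `1`s of a bit string; the first
argument is the number of `0`s already seen since the last `1`. -/
def zeroRuns : ℕ → List Bool → List ℕ
  | _, [] => []
  | k, false :: t => zeroRuns (k + 1) t
  | k, true :: t => k :: zeroRuns 0 t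

/-- Run-length encoding of a bitmap with gamma codes. -/
def runLength (s : List Bool) : List Bool :=
  (zeroRuns 0 s).flatMap fun k => eliasGamma (k + 1)

/-- The compressed representation of a set of positions: the run-length encoding of its bitmap or,
if the set has more than `n / 2` elements, of the bitmap of its complement, after one bit that tells
which of the two is given. -/
def compress {n : ℕ} (S : Finset (Fin n)) : List Bool :=
  if 2 * S.card ≤ n then false :: runLength (bitmap S) else true :: runLength (bitmap Sᶜ)

/-! ### The I/O model, with block size `B` and internal memory size `M` measured in bits -/

/-- A disk: an unbounded array of bits. Block `a` consists of the bits `a * B, …, a * B + B - 1`. -/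
abbrev Disk := ℕ → Bool

/-- Contents of one block. -/
abbrev Block (B : ℕ) := Fin B → Bool

/-- Contents of the internal memory. -/
abbrev Mem (M : ℕ) := Fin M → Bool

/-- The disk that holds the bit string `s` (followed by zeros). -/
def diskOf (s : List Bool) : Disk := fun p => s.getD p false

/-- Contents of block `a` of a disk. -/
def readBlock {B : ℕ} (D : Disk) (a : ℕ) : Block B := fun i => D (a * B + i)

/-- The disk after block `a` has been overwritten by `v`. -/
def writeBlock {B : ℕ} (D : Disk) (a : ℕ) (v : Block B) : Disk := fun p =>
  if h : a * B ≤ p ∧ p < a * B + B then v ⟨p - a * B, by omega⟩ else D p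

/-- What an algorithm does next: transfer one block between memory and a disk (and then continue
with new memory contents), or stop and declare the first `len` bits of the working disk to be its
output. There is a disk with the stored data structure, which is only read, and a working disk. -/
inductive Instr (B M : ℕ) where
  | readIndex (a : ℕ) (next : Block B → Mem M)
  | readWork (a : ℕ) (next : Block B → Mem M)
  | writeWork (a : ℕ) (v : Block B) (next : Mem M)
  | halt (len : ℕ)

/-- A query algorithm over the alphabet `Fin σ`. All it remembers from one I/O to the next are the
`M` bits of internal memory; these initially hold the query. Internal computation is free. -/
structure QueryAlg (B M σ : ℕ) where
  init : Fin σ → Fin σ → Mem M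
  step : Mem M → Instr B M

/-- `A.Runs D m W t out`: with the data structure `D` on disk, started with memory contents `m` and
working disk `W`, the algorithm stops after exactly `t` I/Os (block reads and writes), with
output `out`. -/
inductive QueryAlg.Runs {B M σ : ℕ} (A : QueryAlg B M σ) (D : Disk) :
    Mem M → Disk → ℕ → List Bool → Prop
  | halt {m : Mem M} {W : Disk} {len : ℕ} (h : A.step m = Instr.halt len) :
      Runs A D m W 0 ((List.range len).map W)
  | readIndex {m : Mem M} {W : Disk} {a : ℕ} {next : Block B → Mem M} {t : ℕ} {out : List Bool}
      (h : A.step m = Instr.readIndex a next) (hr : Runs A D (next (readBlock D a)) W t out) :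
      Runs A D m W (t + 1) out
  | readWork {m : Mem M} {W : Disk} {a : ℕ} {next : Block B → Mem M} {t : ℕ} {out : List Bool}
      (h : A.step m = Instr.readWork a next) (hr : Runs A D (next (readBlock W a)) W t out) :
      Runs A D m W (t + 1) out
  | writeWork {m : Mem M} {W : Disk} {a : ℕ} {v : Block B} {next : Mem M} {t : ℕ}
      {out : List Bool} (h : A.step m = Instr.writeWork a v next)
      (hr : Runs A D next (writeBlock W a v) t out) :
      Runs A D m W (t + 1) out

end SecondaryIndex

open SecondaryIndex

/-!
The stored structure is a hierarchy of partitions of the alphabet. Let `below c` be the number of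
positions that hold a character smaller than `c`. On level `j` the numbers `0, …, n` are cut into
`2 ^ (2 ^ j - 1)` buckets of equal length; a character at which the bucket of `below` changes is a
block of its own, and the other characters are joined to blocks as long as the bucket stays the same
(`IsBoundary`, `piece`). About `lg lg n` levels suffice: then the buckets are singletons. For each
level and each block that was not a single character on the level above, the set of positions is
stored by the gamma codes of its gaps; a flag in front of each code marks the first gap of a block.
The length `wt` of this code is monotone and subadditive in the set, and a set of `m` positions has
weight `O(m lg (n / m) + m)` (`wt_le`).

*Space.* A position whose character occurs `m` times appears on level `j + 1` only if
`m * 2 ^ (2 ^ j - 1) ≤ n`, since its character is a block on level `j` otherwise. It costs about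
`2 ^ (j + 1)` bits there, and these costs form a geometric progression dominated by its last term
`O(lg (n / m) + 1)`; the sum over all positions is `O(n H₀ + n)` (`sum_wt_le`). A table with a
constant number of entries of `O(lg n)` bits for each character and each level, which gives the
positions of the neighbouring boundaries in the stream, takes `O(σ lg n lg lg n)` bits (`encode`).

*Amount of data.* The range of a query, or the two ranges of the complement of its answer, is the
disjoint union of two groups of consecutive blocks per level and range, namely those that fit
between the boundaries of this level but not between those of the level above
(`mem_segments_iff_of_lt`). The group on level `j + 1` lies in a single bucket of level `j`, so it
has at most `n / 2 ^ (2 ^ j - 1)` positions. If `2 ^ i` is about `lg (n / k)`, the levels up to `i`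
cost `O(2 ^ j)` bits per position, and above `i` the number of positions shrinks so fast that the
sum is again `O(k lg (n / k))` bits altogether (`sum_segmentWt_le`).

*Sorting.* The blocks of a group are consecutive in the stream. They are read in windows of `64`
blocks of the disk and written to cells of the working disk. A new sorted run begins only at a flag
or at a new group, so the number of runs is `O(σ lg lg n)` (`Written`). The runs are merged in
`d = ⌈2 / δ⌉` passes with fan-out `F`, about `(σ lg n) ^ (δ / 2)`, which needs memory for `O(F)`
disk blocks. A cell holds an arbitrary set of bounded weight in an injective binary encoding. By the
properties of `wt`, merging does not increase the total weight, and the pool of positions that are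
in memory stays small (`exec_merge`). A last scan writes the gamma codes of the gaps of the sorted
run, which are the run-length encoding of the bitmap. The cost is `O(k lg (n / k) / B)` block
transfers and a constant number for each of the `O(lg lg n)` groups; the term `log_b n` is not
needed, because the table is addressed directly.

*Memory.* An algorithm is written as a tree of block transfers (`Prog`). What has to be remembered
between two transfers is the residual program alone, so `M` bits suffice if there are at most
`2 ^ M` residual programs (`Fits`, `exists_queryAlg`).
-/

set_option autoImplicit false

namespace SecondaryIndex

/-! ### Gap codes and the weight of a set of positions -/

/-- One more than the largest element of `S` below `p`, and `0` if there is none. -/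
def lastBelow (S : Finset ℕ) (p : ℕ) : ℕ := (S.filter (· < p)).sup (· + 1)

/-- The distance from `p` to the previous element of `S`, where `-1` counts as an element. -/
def gap (S : Finset ℕ) (p : ℕ) : ℕ := p + 1 - lastBelow S p

/-- The length of a self-delimiting code for `S`: each gap `g` takes its gamma code and one more
bit, that is `2 * Nat.size g` bits. Unlike the length of the plain gamma codes, this is monotone
and subadditive in `S`. -/
def wt (S : Finset ℕ) : ℕ := ∑ p ∈ S, 2 * Nat.size (gap S p)

theorem lastBelow_le (S : Finset ℕ) (p : ℕ) : lastBelow S p ≤ p := by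
  refine Finset.sup_le fun q hq => ?_
  have := (Finset.mem_filter.1 hq).2
  omega

theorem lt_lastBelow {S : Finset ℕ} {p q : ℕ} (hq : q ∈ S) (h : q < p) : q < lastBelow S p :=
  Finset.le_sup (f := (· + 1)) (Finset.mem_filter.2 ⟨hq, h⟩)

theorem lastBelow_mono {S T : Finset ℕ} (h : S ⊆ T) (p : ℕ) : lastBelow S p ≤ lastBelow T p :=
  Finset.sup_mono (Finset.filter_subset_filter _ h)

theorem lastBelow_congr {S T : Finset ℕ} {p : ℕ} (h : ∀ q < p, q ∈ S ↔ q ∈ T) :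
    lastBelow S p = lastBelow T p := by
  unfold lastBelow
  congr 1
  ext q
  simp only [Finset.mem_filter]
  constructor
  · rintro ⟨a, b⟩
    exact ⟨(h q b).1 a, b⟩
  · rintro ⟨a, b⟩
    exact ⟨(h q b).2 a, b⟩

theorem gap_pos (S : Finset ℕ) (p : ℕ) : 0 < gap S p := by
  have := lastBelow_le S p
  unfold gap
  omega

theorem gap_le (S : Finset ℕ) (p : ℕ) : gap S p ≤ p + 1 := Nat.sub_le _ _

theorem gap_anti {S T : Finset ℕ} (h : S ⊆ T) (p : ℕ) : gap T p ≤ gap S p :=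
  Nat.sub_le_sub_left (lastBelow_mono h p) _

theorem gap_congr {S T : Finset ℕ} {p : ℕ} (h : ∀ q < p, q ∈ S ↔ q ∈ T) : gap S p = gap T p := by
  unfold gap
  rw [lastBelow_congr h]

theorem gap_le_of_mem {S : Finset ℕ} {p q : ℕ} (hq : q ∈ S) (h : q < p) : gap S p ≤ p - q := by
  have := lt_lastBelow hq h
  unfold gap
  omega

@[simp] theorem wt_empty : wt ∅ = 0 := rfl

theorem wt_union_le (S T : Finset ℕ) : wt (S ∪ T) ≤ wt S + wt T := by
  calc wt (S ∪ T) ≤ ∑ p ∈ S, 2 * Nat.size (gap (S ∪ T) p) +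
        ∑ p ∈ T, 2 * Nat.size (gap (S ∪ T) p) := by
        unfold wt
        rw [← Finset.sum_union_inter]
        exact Nat.le_add_right _ _
    _ ≤ wt S + wt T := by
        refine add_le_add (Finset.sum_le_sum fun p _ => ?_) (Finset.sum_le_sum fun p _ => ?_)
        · have := Nat.size_le_size (gap_anti (Finset.subset_union_left (s₁ := S) (s₂ := T)) p)
          omega
        · have := Nat.size_le_size (gap_anti (Finset.subset_union_right (s₁ := S) (s₂ := T)) p)
          omega

theorem wt_biUnion_le {ι : Type*} [DecidableEq ι] (I : Finset ι) (f : ι → Finset ℕ) :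
    wt (I.biUnion f) ≤ ∑ i ∈ I, wt (f i) := by
  induction I using Finset.induction_on with
  | empty => simp
  | insert a I ha ih =>
    rw [Finset.biUnion_insert, Finset.sum_insert ha]
    exact (wt_union_le _ _).trans (by omega)

theorem size_add_le {a b : ℕ} (ha : 0 < a) (hb : 0 < b) :
    Nat.size (a + b) ≤ Nat.size a + Nat.size b := by
  rw [Nat.size_le, pow_add]
  have h1 := Nat.lt_size_self a
  have h2 := Nat.lt_size_self b
  nlinarith

theorem wt_le_wt_insert (S : Finset ℕ) (q : ℕ) : wt S ≤ wt (insert q S) := by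
  classical
  by_cases hq : q ∈ S
  · rw [Finset.insert_eq_of_mem hq]
  unfold wt
  rw [Finset.sum_insert hq]
  by_cases hs : (S.filter (q < ·)).Nonempty
  -- Only the successor of `q` has a different gap, and that one is split in two.
  · set m := (S.filter (q < ·)).min' hs with hm
    have hmem := Finset.mem_filter.1 (Finset.min'_mem _ hs)
    rw [← hm] at hmem
    have hmin : ∀ p ∈ S, q < p → m ≤ p := fun p hp h =>
      Finset.min'_le _ _ (Finset.mem_filter.2 ⟨hp, h⟩)
    rw [← Finset.add_sum_erase _ _ hmem.1, ← Finset.add_sum_erase S _ hmem.1, ← add_assoc]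
    refine add_le_add ?_ (Finset.sum_le_sum fun p hp => ?_)
    · have h1 : lastBelow S m = lastBelow (insert q S) q := by
        unfold lastBelow
        congr 1
        ext p
        simp only [Finset.mem_filter, Finset.mem_insert]
        constructor
        · rintro ⟨a, b⟩
          refine ⟨Or.inr a, ?_⟩
          by_contra hc
          rcases Nat.lt_or_ge q p with h | h
          · exact absurd (hmin p a h) (by omega)
          · exact hq (by rwa [show q = p by omega])
        · rintro ⟨a | a, b⟩
          · omega
          · exact ⟨a, by omega⟩
      have h2 : lastBelow (insert q S) m = q + 1 := by
        apply le_antisymm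
        · refine Finset.sup_le fun p hp => ?_
          simp only [Finset.mem_filter, Finset.mem_insert] at hp
          rcases hp with ⟨rfl | hp, h⟩
          · exact le_rfl
          · by_contra hc
            exact absurd (hmin p hp (by omega)) (by omega)
        · exact lt_lastBelow (Finset.mem_insert_self _ _) hmem.2
      have h3 : gap S m = gap (insert q S) q + gap (insert q S) m := by
        have := lastBelow_le (insert q S) q
        unfold gap
        rw [h1, h2]
        omega
      have := size_add_le (gap_pos (insert q S) q) (gap_pos (insert q S) m)
      rw [h3]
      omega
    · have hp' := Finset.mem_erase.1 hp
      suffices h : gap S p = gap (insert q S) p by rw [h]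
      unfold gap
      congr 1
      apply le_antisymm (lastBelow_mono (Finset.subset_insert _ _) _)
      refine Finset.sup_le fun r hr => ?_
      simp only [Finset.mem_filter, Finset.mem_insert] at hr
      rcases hr with ⟨rfl | hr, h⟩
      · have h1 := hmin p hp'.2 h
        have := lt_lastBelow hmem.1 (show m < p by omega)
        omega
      · exact lt_lastBelow hr h
  · rw [Finset.not_nonempty_iff_eq_empty, Finset.filter_eq_empty_iff] at hs
    refine le_add_left (Finset.sum_le_sum fun p hp => ?_)
    have hpq := hs hp
    rw [gap_congr (T := insert q S)]
    intro r hr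
    simp only [Finset.mem_insert]
    constructor
    · exact Or.inr
    · rintro (rfl | h)
      · omega
      · exact h

theorem wt_mono {S T : Finset ℕ} (h : S ⊆ T) : wt S ≤ wt T := by
  classical
  have : ∀ U : Finset ℕ, wt S ≤ wt (U ∪ S) := by
    intro U
    induction U using Finset.induction_on with
    | empty => simp
    | insert a U _ ih =>
      rw [Finset.insert_union]
      exact ih.trans (wt_le_wt_insert _ _)
  simpa [Finset.union_eq_left.2 h] using this T

theorem wt_insert_le {S : Finset ℕ} {p q : ℕ} (hqp : q ≤ p) (hq : q = 0 ∨ q - 1 ∈ S) :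
    wt (insert p S) ≤ wt S + 2 * Nat.size (p + 1 - q) := by
  classical
  by_cases hp : p ∈ S
  · rw [Finset.insert_eq_of_mem hp]
    omega
  have h1 : gap (insert p S) p ≤ p + 1 - q := by
    rcases Nat.eq_zero_or_pos q with rfl | h0
    · exact gap_le _ _
    · rcases hq with h | h
      · omega
      · exact (gap_le_of_mem (Finset.mem_insert_of_mem h) (by omega)).trans (by omega)
  unfold wt
  rw [Finset.sum_insert hp, add_comm]
  refine add_le_add (Finset.sum_le_sum fun r _ => ?_) ?_
  · have := Nat.size_le_size (gap_anti (Finset.subset_insert p S) r)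
    omega
  · have := Nat.size_le_size h1
    omega

/-- If `S` precedes `T`, then the code of `S ∪ T` is not much shorter than those of `S` and `T`
together: only the first gap of `T` differs. -/
theorem wt_add_wt_le {n : ℕ} {S T : Finset ℕ} (hST : ∀ a ∈ S, ∀ b ∈ T, a < b)
    (hT : ∀ b ∈ T, b < n) : wt S + wt T ≤ wt (S ∪ T) + 2 * Nat.size n := by
  classical
  rcases T.eq_empty_or_nonempty with rfl | hne
  · simp
  have hdis : Disjoint S T := Finset.disjoint_left.2 fun a ha hb => (hST a ha a hb).false
  have hmem := Finset.min'_mem T hne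
  unfold wt
  rw [Finset.sum_union hdis, add_assoc]
  refine add_le_add (Finset.sum_le_sum fun p hp => ?_) ?_
  · rw [gap_congr (T := S ∪ T)]
    intro q hq
    rw [Finset.mem_union]
    exact ⟨Or.inl, fun h => h.resolve_right fun h' => by have := hST p hp q h'; omega⟩
  · rw [← Finset.add_sum_erase T _ hmem, ← Finset.add_sum_erase T _ hmem]
    have h1 := Nat.size_le_size ((gap_le T (T.min' hne)).trans (hT _ hmem))
    have h2 : ∑ p ∈ T.erase (T.min' hne), 2 * Nat.size (gap T p)
        ≤ ∑ p ∈ T.erase (T.min' hne), 2 * Nat.size (gap (S ∪ T) p) := by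
      refine Finset.sum_le_sum fun p hp => ?_
      have hp' := Finset.mem_erase.1 hp
      have hlt : T.min' hne < p := lt_of_le_of_ne (Finset.min'_le _ _ hp'.2) (Ne.symm hp'.1)
      have h3 : lastBelow (S ∪ T) p ≤ lastBelow T p := by
        refine Finset.sup_le fun q hq => ?_
        rw [Finset.mem_filter, Finset.mem_union] at hq
        rcases hq with ⟨h | h, hqp⟩
        · have := hST q h _ hmem
          have := lt_lastBelow hmem hlt
          omega
        · exact lt_lastBelow h hqp
      have := Nat.size_le_size (show gap T p ≤ gap (S ∪ T) p from Nat.sub_le_sub_left h3 _)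
      omega
    omega

theorem sum_gap (S : Finset ℕ) : ∑ p ∈ S, gap S p = S.sup (· + 1) := by
  classical
  induction S using Finset.induction_on_max with
  | empty => simp
  | insert m S hm ih =>
    have hmS : m ∉ S := fun h => (hm m h).false
    rw [Finset.sum_insert hmS, Finset.sup_insert]
    have h1 : ∑ p ∈ S, gap (insert m S) p = ∑ p ∈ S, gap S p := by
      refine Finset.sum_congr rfl fun p hp => gap_congr fun q hq => ?_
      have := hm p hp
      rw [Finset.mem_insert]
      exact ⟨fun h => h.resolve_left (by omega), Or.inr⟩
    have h2 : lastBelow (insert m S) m = S.sup (· + 1) := by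
      unfold lastBelow
      congr 1
      ext q
      rw [Finset.mem_filter, Finset.mem_insert]
      exact ⟨fun h => h.1.resolve_left (by omega), fun h => ⟨Or.inr h, hm q h⟩⟩
    have h3 := lastBelow_le (insert m S) m
    rw [h1, ih, gap, h2]
    rw [h2] at h3
    rw [sup_eq_left.2 (by omega)]
    omega

theorem size_le_self (g : ℕ) : Nat.size g ≤ g := Nat.size_le.2 g.lt_two_pow_self

theorem size_le_add_div (g s : ℕ) : Nat.size g ≤ s + g / 2 ^ s := by
  calc Nat.size g ≤ s + Nat.size (g / 2 ^ s) := by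
        rw [Nat.size_le, pow_add, mul_comm]
        exact (Nat.div_lt_iff_lt_mul (by positivity)).1 (Nat.lt_size_self _)
    _ ≤ s + g / 2 ^ s := by
        have := size_le_self (g / 2 ^ s)
        omega

/-- The gaps sum to at most `n`, so `wt S` is at most `2 |S| s + 2 n / 2 ^ s` for every `s`; this
replaces the concavity of the logarithm. -/
theorem wt_le {n : ℕ} {S : Finset ℕ} (hS : ∀ p ∈ S, p < n) (s : ℕ) :
    wt S ≤ 2 * (S.card * s + n / 2 ^ s) := by
  have h1 : ∑ p ∈ S, gap S p ≤ n := by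
    rw [sum_gap]
    exact Finset.sup_le fun p hp => hS p hp
  have h2 : ∑ p ∈ S, gap S p / 2 ^ s ≤ n / 2 ^ s := by
    rw [Nat.le_div_iff_mul_le (by positivity), Finset.sum_mul]
    exact (Finset.sum_le_sum fun p _ => Nat.div_mul_le_self _ _).trans h1
  calc wt S ≤ ∑ p ∈ S, 2 * (s + gap S p / 2 ^ s) :=
        Finset.sum_le_sum fun p _ => Nat.mul_le_mul_left _ (size_le_add_div _ _)
    _ = 2 * (S.card * s + ∑ p ∈ S, gap S p / 2 ^ s) := by
        rw [← Finset.mul_sum, Finset.sum_add_distrib, Finset.sum_const, smul_eq_mul]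
    _ ≤ _ := by omega

theorem wt_le_card_mul {n : ℕ} {S : Finset ℕ} (hS : ∀ p ∈ S, p < n) :
    wt S ≤ S.card * (2 * Nat.size n) := by
  refine (Finset.sum_le_card_nsmul S _ (2 * Nat.size n) fun p hp => ?_).trans (by simp)
  have := Nat.size_le_size ((gap_le S p).trans (hS p hp))
  omega

end SecondaryIndex

namespace SecondaryIndex

/-! ### Lists of gaps, tokens, and their codes -/

/-- The differences between successive elements of a list of positions, the first one taken to the
position `c - 1`. -/
def gapsFrom : ℕ → List ℕ → List ℕ
  | _, [] => []
  | c, p :: l => (p + 1 - c) :: gapsFrom (p + 1) l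

/-- One more than the last element of a list of positions, and `c` for the empty list. -/
def endFrom : ℕ → List ℕ → ℕ
  | c, [] => c
  | _, p :: l => endFrom (p + 1) l

theorem gapsFrom_append (c : ℕ) (l m : List ℕ) :
    gapsFrom c (l ++ m) = gapsFrom c l ++ gapsFrom (endFrom c l) m := by
  induction l generalizing c with
  | nil => rfl
  | cons p l ih => simp [gapsFrom, endFrom, ih]

theorem endFrom_append (c : ℕ) (l m : List ℕ) :
    endFrom c (l ++ m) = endFrom (endFrom c l) m := by
  induction l generalizing c with
  | nil => rfl
  | cons p l ih => simp [endFrom, ih]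

theorem sort_insert_max {m : ℕ} {S : Finset ℕ} (hm : ∀ x ∈ S, x < m) :
    (insert m S).sort = S.sort ++ [m] := by
  apply (Finset.sortedLT_sort _).eq_of_mem_iff
  · rw [List.sortedLT_iff_pairwise, List.pairwise_append]
    refine ⟨List.sortedLT_iff_pairwise.1 (Finset.sortedLT_sort S), List.pairwise_singleton _ _, ?_⟩
    simpa using hm
  · intro a
    simp [or_comm]

theorem endFrom_sort (S : Finset ℕ) : endFrom 0 S.sort = S.sup (· + 1) := by
  induction S using Finset.induction_on_max with
  | empty => simp [endFrom]
  | insert m S hm ih =>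
    rw [sort_insert_max hm, endFrom_append, Finset.sup_insert]
    have : S.sup (· + 1) ≤ m + 1 := Finset.sup_le fun p hp => by have := hm p hp; omega
    simp [endFrom, this]

theorem gapsFrom_sort (S : Finset ℕ) : gapsFrom 0 S.sort = S.sort.map (gap S) := by
  induction S using Finset.induction_on_max with
  | empty => simp [gapsFrom]
  | insert m S hm ih =>
    rw [sort_insert_max hm, gapsFrom_append, ih, List.map_append]
    congr 1
    · refine List.map_congr_left fun p hp => gap_congr fun q hq => ?_
      have := hm p ((Finset.mem_sort _).1 hp)
      rw [Finset.mem_insert]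
      exact ⟨Or.inr, fun h => h.resolve_left (by omega)⟩
    · rw [endFrom_sort]
      simp only [gapsFrom, List.map_cons, List.map_nil, gap, lastBelow]
      congr 3
      ext q
      rw [Finset.mem_filter, Finset.mem_insert]
      exact ⟨fun h => ⟨Or.inr h, hm q h⟩, fun h => h.1.resolve_left (by omega)⟩

theorem sum_gapsFrom_sort (S : Finset ℕ) :
    ((gapsFrom 0 S.sort).map fun g => 2 * Nat.size g).sum = wt S := by
  rw [gapsFrom_sort, List.map_map, ← List.sum_toFinset _ (Finset.sort_nodup _ _),
    Finset.sort_toFinset]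
  rfl

theorem size_eq_log {g : ℕ} (hg : 0 < g) : Nat.size g = Nat.log 2 g + 1 := by
  apply le_antisymm
  · exact Nat.size_le.2 (Nat.lt_pow_succ_log_self (by norm_num) g)
  · exact Nat.lt_size.2 (Nat.pow_log_le_self 2 hg.ne')

theorem length_eliasGamma {g : ℕ} (hg : 0 < g) :
    (eliasGamma g).length + 1 = 2 * Nat.size g := by
  simp only [eliasGamma, List.length_append, List.length_replicate, List.length_reverse,
    Nat.size_eq_bits_len]
  have := size_eq_log hg
  omega

theorem length_eliasGamma_le (g : ℕ) : (eliasGamma g).length ≤ 2 * Nat.size g := by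
  rcases Nat.eq_zero_or_pos g with rfl | hg
  · simp [eliasGamma]
  · have := length_eliasGamma hg
    omega

theorem bits_reverse_eq_cons {g : ℕ} (hg : 0 < g) : ∃ t, (Nat.bits g).reverse = true :: t := by
  induction g using Nat.strong_induction_on with
  | _ g ih =>
    rcases Nat.even_or_odd' g with ⟨m, rfl | rfl⟩
    · obtain ⟨t, ht⟩ := ih m (by omega) (by omega)
      rw [Nat.bit0_bits _ (by omega), List.reverse_cons, ht]
      exact ⟨_, rfl⟩
    · rw [Nat.bit1_bits, List.reverse_cons]
      rcases Nat.eq_zero_or_pos m with rfl | hm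
      · exact ⟨[], by simp⟩
      · obtain ⟨t, ht⟩ := ih m (by omega) (by omega)
        rw [ht]
        exact ⟨_, rfl⟩

theorem replicate_false_append_inj {a b : ℕ} {u v : List Bool}
    (h : List.replicate a false ++ true :: u = List.replicate b false ++ true :: v) :
    a = b ∧ u = v := by
  induction a generalizing b with
  | zero =>
    cases b with
    | zero => simpa using h
    | succ b => simp [List.replicate_succ] at h
  | succ a ih =>
    cases b with
    | zero => simp [List.replicate_succ] at h
    | succ b =>
      simp only [List.replicate_succ, List.cons_append, List.cons.injEq, true_and] at h
      have := ih h
      exact ⟨by rw [this.1], this.2⟩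

theorem bits_inj {a b : ℕ} (h : Nat.bits a = Nat.bits b) : a = b := by
  apply Nat.digits_inj_iff (b := 2).1
  rw [Nat.digits_two_eq_bits, Nat.digits_two_eq_bits, h]

/-- The gamma code is prefix free. -/
theorem eliasGamma_append_inj {a b : ℕ} {u v : List Bool} (ha : 0 < a) (hb : 0 < b)
    (h : eliasGamma a ++ u = eliasGamma b ++ v) : a = b := by
  obtain ⟨s, hs⟩ := bits_reverse_eq_cons ha
  obtain ⟨t, ht⟩ := bits_reverse_eq_cons hb
  have h1 : s.length = Nat.log 2 a := by
    have := congrArg List.length hs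
    rw [List.length_reverse, Nat.size_eq_bits_len, size_eq_log ha, List.length_cons] at this
    omega
  have h2 : t.length = Nat.log 2 b := by
    have := congrArg List.length ht
    rw [List.length_reverse, Nat.size_eq_bits_len, size_eq_log hb, List.length_cons] at this
    omega
  simp only [eliasGamma, hs, ht, List.append_assoc, List.cons_append] at h
  obtain ⟨h3, h4⟩ := replicate_false_append_inj h
  have h5 := (List.append_inj h4 (by omega)).1
  rw [← h5, ← hs] at ht
  exact (bits_inj (List.reverse_injective ht)).symm

/-- A token: a gap, with a flag that tells whether it is the first one of its set. -/
abbrev Tok := Bool × ℕ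

/-- The code of a token. -/
def tokCode (t : Tok) : List Bool := t.1 :: eliasGamma t.2

/-- The code of a list of tokens. -/
def toksCode (l : List Tok) : List Bool := l.flatMap tokCode

@[simp] theorem toksCode_nil : toksCode [] = [] := rfl

@[simp] theorem toksCode_cons (t : Tok) (l : List Tok) :
    toksCode (t :: l) = tokCode t ++ toksCode l := rfl

theorem toksCode_append (l m : List Tok) : toksCode (l ++ m) = toksCode l ++ toksCode m := by
  simp [toksCode]

theorem length_tokCode {t : Tok} (ht : 0 < t.2) : (tokCode t).length = 2 * Nat.size t.2 := by
  rw [tokCode, List.length_cons, length_eliasGamma ht]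

theorem length_toksCode {l : List Tok} (hl : ∀ t ∈ l, 0 < t.2) :
    (toksCode l).length = (l.map fun t => 2 * Nat.size t.2).sum := by
  induction l with
  | nil => rfl
  | cons t l ih =>
    rw [List.forall_mem_cons] at hl
    simp [length_tokCode hl.1, ih hl.2]

theorem tokCode_prefix_inj {s t : Tok} {w : List Bool} (hs : 0 < s.2) (ht : 0 < t.2)
    (h1 : tokCode s <+: w) (h2 : tokCode t <+: w) : s = t := by
  obtain ⟨u, hu⟩ := h1
  obtain ⟨v, hv⟩ := h2
  rw [← hv] at hu
  simp only [tokCode, List.cons_append, List.cons.injEq] at hu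
  exact Prod.ext hu.1 (eliasGamma_append_inj hs ht hu.2)

open Classical in
/-- The tokens, at most `fuel` many, that can be read off the front of a bit string. -/
noncomputable def parse : ℕ → List Bool → List Tok
  | 0, _ => []
  | fuel + 1, w =>
    if h : ∃ t : Tok, 0 < t.2 ∧ tokCode t <+: w then
      h.choose :: parse fuel (w.drop (tokCode h.choose).length)
    else []

theorem parse_eq_cons {t : Tok} (ht : 0 < t.2) (fuel : ℕ) (w : List Bool) :
    parse (fuel + 1) (tokCode t ++ w) = t :: parse fuel w := by
  have h : ∃ s : Tok, 0 < s.2 ∧ tokCode s <+: tokCode t ++ w := ⟨t, ht, List.prefix_append _ _⟩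
  have h1 : h.choose = t :=
    tokCode_prefix_inj h.choose_spec.1 ht h.choose_spec.2 (List.prefix_append _ _)
  rw [parse, dif_pos h, h1, List.drop_left]

/-- Parsing the first `m` bits of a code yields a prefix of the tokens, which lacks at most those
that do not fit. -/
theorem parse_take {l : List Tok} (hl : ∀ t ∈ l, 0 < t.2) (m fuel : ℕ) (hm : m ≤ fuel) :
    ∃ l₁ l₂, l = l₁ ++ l₂ ∧ parse fuel ((toksCode l).take m) = l₁ ∧ (toksCode l₁).length ≤ m ∧
      (l₂ = [] ∨ ∃ t ∈ l₂, m < (toksCode l₁).length + (tokCode t).length) := by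
  induction l generalizing m fuel with
  | nil =>
    refine ⟨[], [], rfl, ?_, by simp, Or.inl rfl⟩
    cases fuel with
    | zero => rfl
    | succ fuel =>
      rw [parse, dif_neg]
      rintro ⟨t, _, h⟩
      simp [tokCode] at h
  | cons t l ih =>
    rw [List.forall_mem_cons] at hl
    by_cases hlen : (tokCode t).length ≤ m
    · have hpos : 0 < (tokCode t).length := by simp [tokCode]
      obtain ⟨fuel, rfl⟩ : ∃ f, fuel = f + 1 := ⟨fuel - 1, by omega⟩
      obtain ⟨l₁, l₂, h1, h2, h3, h4⟩ := ih hl.2 (m - (tokCode t).length) fuel (by omega)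
      refine ⟨t :: l₁, l₂, by rw [h1, List.cons_append], ?_, ?_, h4.imp id ?_⟩
      · rw [toksCode_cons, List.take_append, List.take_of_length_le hlen, parse_eq_cons hl.1, h2]
      · rw [toksCode_cons, List.length_append]
        omega
      · rintro ⟨s, hs, h⟩
        refine ⟨s, hs, ?_⟩
        rw [toksCode_cons, List.length_append]
        omega
    · refine ⟨[], t :: l, rfl, ?_, by simp, Or.inr ⟨t, List.mem_cons_self, by simpa using hlen⟩⟩
      cases fuel with
      | zero => rfl
      | succ fuel =>
        rw [parse, dif_neg]
        rintro ⟨s, hs, h⟩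
        have h5 : s = t := tokCode_prefix_inj hs hl.1 (h.trans (List.take_prefix _ _))
          (List.prefix_append _ _)
        subst h5
        have := h.length_le
        rw [List.length_take] at this
        omega

theorem toksCode_injOn {l m : List Tok} (hl : ∀ t ∈ l, 0 < t.2) (hm : ∀ t ∈ m, 0 < t.2)
    (h : toksCode l = toksCode m) : l = m := by
  induction l generalizing m with
  | nil =>
    cases m with
    | nil => rfl
    | cons t m => simp [tokCode] at h
  | cons s l ih =>
    cases m with
    | nil => simp [tokCode] at h
    | cons t m =>
      rw [List.forall_mem_cons] at hl hm
      rw [toksCode_cons, toksCode_cons] at h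
      have hst := tokCode_prefix_inj hl.1 hm.1 (List.prefix_append _ (toksCode l))
        (h ▸ List.prefix_append _ _)
      subst hst
      rw [ih hl.2 hm.2 (List.append_cancel_left h)]

/-- The positions that a list of tokens stands for, if `c` is one more than the position that
precedes them. -/
def dec : ℕ → List Tok → List ℕ
  | _, [] => []
  | c, t :: l => ((if t.1 then 0 else c) + t.2 - 1) :: dec ((if t.1 then 0 else c) + t.2) l

/-- One more than the last of these positions. -/
def decEnd : ℕ → List Tok → ℕ
  | c, [] => c
  | c, t :: l => decEnd ((if t.1 then 0 else c) + t.2) l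

theorem dec_append (c : ℕ) (l m : List Tok) : dec c (l ++ m) = dec c l ++ dec (decEnd c l) m := by
  induction l generalizing c with
  | nil => rfl
  | cons t l ih => simp [dec, decEnd, ih]

theorem decEnd_append (c : ℕ) (l m : List Tok) :
    decEnd c (l ++ m) = decEnd (decEnd c l) m := by
  induction l generalizing c with
  | nil => rfl
  | cons t l ih => simp [decEnd, ih]

theorem length_dec (c : ℕ) (l : List Tok) : (dec c l).length = l.length := by
  induction l generalizing c with
  | nil => rfl
  | cons t l ih => simp [dec, ih]

/-- The tokens of a list of positions; the first one gets the flag `b`. -/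
def toksFrom : Bool → ℕ → List ℕ → List Tok
  | _, _, [] => []
  | b, c, p :: l => (b, p + 1 - c) :: toksFrom false (p + 1) l

/-- The tokens of a set. -/
def toks (S : Finset ℕ) : List Tok := toksFrom true 0 S.sort

theorem map_snd_toksFrom (b : Bool) (c : ℕ) (l : List ℕ) :
    (toksFrom b c l).map Prod.snd = gapsFrom c l := by
  induction l generalizing b c with
  | nil => rfl
  | cons p l ih => simp [toksFrom, gapsFrom, ih]

theorem toks_pos (S : Finset ℕ) : ∀ t ∈ toks S, 0 < t.2 := by
  intro t ht
  have h : t.2 ∈ (toks S).map Prod.snd := List.mem_map_of_mem ht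
  rw [toks, map_snd_toksFrom, gapsFrom_sort] at h
  obtain ⟨p, _, hp⟩ := List.mem_map.1 h
  rw [← hp]
  exact gap_pos _ _

theorem toks_le {n : ℕ} {S : Finset ℕ} (hS : ∀ p ∈ S, p < n) : ∀ t ∈ toks S, t.2 ≤ n := by
  intro t ht
  have h : t.2 ∈ (toks S).map Prod.snd := List.mem_map_of_mem ht
  rw [toks, map_snd_toksFrom, gapsFrom_sort] at h
  obtain ⟨p, hp, hpt⟩ := List.mem_map.1 h
  rw [← hpt]
  exact (gap_le _ _).trans (hS p ((Finset.mem_sort _).1 hp))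

theorem length_toksCode_toks (S : Finset ℕ) : (toksCode (toks S)).length = wt S := by
  rw [length_toksCode (toks_pos S), ← sum_gapsFrom_sort, ← map_snd_toksFrom true, List.map_map]
  rfl

theorem length_toks (S : Finset ℕ) : (toks S).length = S.card := by
  rw [← List.length_map (f := Prod.snd), toks, map_snd_toksFrom, gapsFrom_sort, List.length_map,
    Finset.length_sort]

theorem dec_toksFrom_false {c : ℕ} {l : List ℕ} (hl : l.Pairwise (· < ·)) (hc : ∀ p ∈ l, c ≤ p) :
    dec c (toksFrom false c l) = l := by
  induction l generalizing c with
  | nil => rfl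
  | cons p l ih =>
    rw [List.pairwise_cons] at hl
    rw [List.forall_mem_cons] at hc
    have h1 : c + (p + 1 - c) = p + 1 := by omega
    simp only [toksFrom, dec, Bool.false_eq_true, if_false, h1, Nat.add_sub_cancel]
    rw [ih hl.2 fun q hq => hl.1 q hq]

theorem dec_toks (c : ℕ) (S : Finset ℕ) : dec c (toks S) = S.sort := by
  have h := List.sortedLT_iff_pairwise.1 (Finset.sortedLT_sort S)
  rw [toks]
  cases hs : S.sort with
  | nil => rfl
  | cons p l =>
    rw [hs, List.pairwise_cons] at h
    simp only [toksFrom, dec, if_true, Nat.sub_zero, Nat.zero_add, Nat.add_sub_cancel]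
    rw [dec_toksFrom_false h.2 fun q hq => h.1 q hq]

theorem mem_dec_flatMap_toks (Ss : List (Finset ℕ)) (c p : ℕ) :
    p ∈ dec c (Ss.flatMap toks) ↔ ∃ S ∈ Ss, p ∈ S := by
  induction Ss generalizing c with
  | nil => simp [dec]
  | cons S Ss ih => simp [dec_append, dec_toks, ih]

/-- The number of flags set in a list of tokens. -/
def flags (l : List Tok) : ℕ := l.countP fun t => t.1

theorem flags_append (l m : List Tok) : flags (l ++ m) = flags l + flags m := List.countP_append

theorem flags_toksFrom_false (c : ℕ) (l : List ℕ) : flags (toksFrom false c l) = 0 := by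
  induction l generalizing c with
  | nil => rfl
  | cons p l ih => simpa [toksFrom, flags] using ih (p + 1)

theorem flags_toks_le (S : Finset ℕ) : flags (toks S) ≤ 1 := by
  rw [toks]
  cases S.sort with
  | nil => simp [toksFrom, flags]
  | cons p l =>
    have := flags_toksFrom_false (p + 1) l
    simp only [flags] at this
    simp [toksFrom, flags, this]

theorem flags_flatMap_toks_le (Ss : List (Finset ℕ)) : flags (Ss.flatMap toks) ≤ Ss.length := by
  induction Ss with
  | nil => simp [flags]
  | cons S Ss ih =>
    have := flags_toks_le S
    rw [List.flatMap_cons, flags_append, List.length_cons]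
    omega

theorem length_toksCode_flatMap_toks (Ss : List (Finset ℕ)) :
    (toksCode (Ss.flatMap toks)).length = (Ss.map wt).sum := by
  induction Ss with
  | nil => rfl
  | cons S Ss ih =>
    rw [List.flatMap_cons, toksCode_append, List.length_append, ih, length_toksCode_toks]
    simp

/-- The set of positions that a window of tokens stands for has, up to its first gap, a code no
longer than the window. -/
theorem wt_dec_le {n : ℕ} {l : List Tok} (hl : ∀ t ∈ l, 0 < t.2) (c : ℕ)
    (hn : ∀ p ∈ dec c l, p < n) :
    wt (dec c l).toFinset ≤ (toksCode l).length + 2 * Nat.size n := by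
  have key : ∀ (l : List Tok) (U : Finset ℕ) (c : ℕ), (∀ t ∈ l, 0 < t.2) →
      (c = 0 ∨ c - 1 ∈ U) → wt (U ∪ (dec c l).toFinset) ≤ wt U + (toksCode l).length := by
    intro l
    induction l with
    | nil => intro U c _ _; simp [dec]
    | cons t l ih =>
      intro U c hl hc
      rw [List.forall_mem_cons] at hl
      set b := if t.1 then 0 else c with hb
      have hbc : b = 0 ∨ b - 1 ∈ U := by
        rw [hb]
        split_ifs
        · exact Or.inl rfl
        · exact hc
      have h1 := wt_insert_le (S := U) (p := b + t.2 - 1) (q := b) (by omega) hbc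
      have h2 := ih (insert (b + t.2 - 1) U) (b + t.2) hl.2 (Or.inr (Finset.mem_insert_self _ _))
      have h3 : U ∪ (dec c (t :: l)).toFinset
          = insert (b + t.2 - 1) U ∪ (dec (b + t.2) l).toFinset := by
        simp only [dec, ← hb, List.toFinset_cons]
        rw [Finset.union_insert, Finset.insert_union]
      rw [h3, toksCode_cons, List.length_append, length_tokCode hl.1]
      rw [show b + t.2 - 1 + 1 - b = t.2 by omega] at h1
      omega
  cases l with
  | nil => simp [dec]
  | cons t l =>
    rw [List.forall_mem_cons] at hl
    set b := if t.1 then 0 else c with hb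
    have h1 := key l {b + t.2 - 1} (b + t.2) hl.2 (Or.inr (by simp))
    have h2 : (dec c (t :: l)).toFinset = {b + t.2 - 1} ∪ (dec (b + t.2) l).toFinset := by
      simp only [dec, ← hb, List.toFinset_cons]
      rfl
    have h3 : wt {b + t.2 - 1} ≤ 1 * (2 * Nat.size n) := by
      refine wt_le_card_mul (S := {b + t.2 - 1}) fun p hp => hn p ?_
      rw [Finset.mem_singleton] at hp
      simp [dec, ← hb, hp]
    rw [h2, toksCode_cons, List.length_append]
    omega

theorem le_of_mem_dec {l : List Tok} (hl : ∀ t ∈ l, 0 < t.2) (hf : flags l = 0) (c : ℕ) :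
    c ≤ decEnd c l ∧ ∀ p ∈ dec c l, c ≤ p ∧ p < decEnd c l := by
  induction l generalizing c with
  | nil => simp [dec, decEnd]
  | cons t l ih =>
    rw [List.forall_mem_cons] at hl
    have h1 : t.1 = false := by
      by_contra h
      simp [flags, h] at hf
    have h2 : flags l = 0 := by
      simpa [flags, h1] using hf
    obtain ⟨h3, h4⟩ := ih hl.2 h2 (c + t.2)
    simp only [dec, decEnd, h1, Bool.false_eq_true, if_false, List.forall_mem_cons]
    exact ⟨by omega, by omega, fun p hp => by have := h4 p hp; omega⟩

/-- In a window whose flags, but for the first token's, are unset, the positions precede the end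
of the window. -/
theorem lt_decEnd_of_mem_dec {l : List Tok} (hl : ∀ t ∈ l, 0 < t.2) (hf : flags l.tail = 0)
    (c : ℕ) : ∀ p ∈ dec c l, p < decEnd c l := by
  cases l with
  | nil => simp [dec]
  | cons t l =>
    rw [List.forall_mem_cons] at hl
    have h := le_of_mem_dec hl.2 hf ((if t.1 then 0 else c) + t.2)
    simp only [dec, decEnd, List.forall_mem_cons]
    refine ⟨?_, fun p hp => (h.2 p hp).2⟩
    have := h.1
    have := hl.1
    omega

/-! ### The number of sets of small weight -/

theorem toks_inj {S T : Finset ℕ} (h : toksCode (toks S) = toksCode (toks T)) : S = T := by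
  have h1 := toksCode_injOn (toks_pos S) (toks_pos T) h
  rw [← Finset.sort_toFinset S (r := (· ≤ ·)), ← Finset.sort_toFinset T (r := (· ≤ ·)),
    ← dec_toks 0 S, h1, dec_toks]

/-- A bit string of length at most `m` as a word of `m + 1` bits: a one marks the end. -/
def pad (m : ℕ) (l : List Bool) : Fin (m + 1) → Bool := fun i => (l ++ [true]).getD i false

theorem pad_inj {m : ℕ} {l l' : List Bool} (hl : l.length ≤ m) (hl' : l'.length ≤ m)
    (h : pad m l = pad m l') : l = l' := by
  have key : ∀ l l' : List Bool, l'.length ≤ m → pad m l = pad m l' → l'.length ≤ l.length := by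
    intro l l' hl' h
    by_contra hc
    have := congrFun h ⟨l'.length, by omega⟩
    simp only [pad] at this
    rw [List.getD_eq_default _ _ (by simp; omega)] at this
    simp [List.getD] at this
  have hlen := le_antisymm (key l' l hl h.symm) (key l l' hl' h)
  refine List.ext_getElem hlen fun i h1 h2 => ?_
  have := congrFun h ⟨i, by omega⟩
  simpa [pad, List.getD, List.getElem?_append_left, h1, h2] using this

/-- The sets of positions below `n` whose code has at most `m` bits. -/
abbrev SmallSet (n m : ℕ) := {S : Finset ℕ // S ⊆ Finset.range n ∧ wt S ≤ m}

theorem smallSet_injective (n m : ℕ) :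
    Function.Injective fun S : SmallSet n m => pad m (toksCode (toks S.1)) := by
  intro S T h
  refine Subtype.ext (toks_inj (pad_inj ?_ ?_ h))
  · rw [length_toksCode_toks]
    exact S.2.2
  · rw [length_toksCode_toks]
    exact T.2.2

noncomputable instance (n m : ℕ) : Fintype (SmallSet n m) :=
  Fintype.ofInjective _ (smallSet_injective n m)

theorem card_smallSet_le (n m : ℕ) : Fintype.card (SmallSet n m) ≤ 2 ^ (m + 1) := by
  refine (Fintype.card_le_of_injective _ (smallSet_injective n m)).trans ?_
  simp

/-- The set `S` as a `SmallSet`, if it is one. -/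
noncomputable def SmallSet.mk' (n m : ℕ) (S : Finset ℕ) : SmallSet n m :=
  if h : S ⊆ Finset.range n ∧ wt S ≤ m then ⟨S, h⟩ else ⟨∅, by simp⟩

theorem SmallSet.val_mk' {n m : ℕ} {S : Finset ℕ} (h : S ⊆ Finset.range n) (h' : wt S ≤ m) :
    (SmallSet.mk' n m S).1 = S := by
  rw [SmallSet.mk', dif_pos ⟨h, h'⟩]

/-! ### The compressed representation -/

/-- The gamma codes of a list of gaps. -/
def gammas (l : List ℕ) : List Bool := l.flatMap eliasGamma

theorem gammas_append (l m : List ℕ) : gammas (l ++ m) = gammas l ++ gammas m := by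
  simp [gammas]

/-- The positions of the ones in a bit string, counted from `o`. -/
def ones : ℕ → List Bool → List ℕ
  | _, [] => []
  | o, false :: l => ones (o + 1) l
  | o, true :: l => o :: ones (o + 1) l

theorem zeroRuns_eq (l : List Bool) (k o : ℕ) (h : k ≤ o) :
    (zeroRuns k l).map (· + 1) = gapsFrom (o - k) (ones o l) := by
  induction l generalizing k o with
  | nil => rfl
  | cons b l ih =>
    cases b with
    | false =>
      simp only [zeroRuns, ones]
      rw [ih (k + 1) (o + 1) (by omega)]
      congr 1
      omega
    | true =>
      simp only [zeroRuns, ones, gapsFrom, List.map_cons]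
      rw [ih 0 (o + 1) (by omega)]
      congr 1
      omega

theorem mem_ones (l : List Bool) (o p : ℕ) : p ∈ ones o l ↔ o ≤ p ∧ l[p - o]? = some true := by
  induction l generalizing o with
  | nil => simp [ones]
  | cons b l ih =>
    have h1 : o < p → (b :: l)[p - o]? = l[p - (o + 1)]? := fun h => by
      rw [show p - o = p - (o + 1) + 1 by omega, List.getElem?_cons_succ]
    cases b with
    | false =>
      simp only [ones, ih]
      constructor
      · rintro ⟨h, h'⟩
        exact ⟨by omega, by rw [h1 (by omega), h']⟩
      · rintro ⟨h, h'⟩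
        rcases Nat.lt_or_ge o p with hlt | hge
        · exact ⟨hlt, by rwa [h1 hlt] at h'⟩
        · simp [show p - o = 0 by omega] at h'
    | true =>
      simp only [ones, List.mem_cons, ih]
      constructor
      · rintro (rfl | ⟨h, h'⟩)
        · simp
        · exact ⟨by omega, by rw [h1 (by omega), h']⟩
      · rintro ⟨h, h'⟩
        rcases Nat.lt_or_ge o p with hlt | hge
        · exact Or.inr ⟨hlt, by rwa [h1 hlt] at h'⟩
        · exact Or.inl (by omega)

theorem ones_pairwise (l : List Bool) (o : ℕ) : (ones o l).Pairwise (· < ·) := by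
  induction l generalizing o with
  | nil => simp [ones]
  | cons b l ih =>
    cases b with
    | false => exact ih _
    | true =>
      rw [ones, List.pairwise_cons]
      exact ⟨fun p hp => by have := ((mem_ones _ _ _).1 hp).1; omega, ih _⟩

/-- The run-length encoding of a bitmap consists of the gamma codes of the gaps. -/
theorem runLength_bitmap {n : ℕ} (S : Finset (Fin n)) :
    runLength (bitmap S) = gammas (gapsFrom 0 (S.map Fin.valEmbedding).sort) := by
  have h1 : ones 0 (bitmap S) = (S.map Fin.valEmbedding).sort := by
    apply (List.sortedLT_iff_pairwise.2 (ones_pairwise _ _)).eq_of_mem_iff (Finset.sortedLT_sort _)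
    intro p
    rw [mem_ones, Finset.mem_sort]
    simp only [bitmap, Nat.sub_zero, Finset.mem_map, Fin.valEmbedding_apply, List.getElem?_ofFn]
    constructor
    · rintro ⟨-, h⟩
      split_ifs at h with hp
      exact ⟨⟨p, hp⟩, by simpa using h, rfl⟩
    · rintro ⟨a, ha, rfl⟩
      simp [a.2, ha]
  have h2 := zeroRuns_eq (bitmap S) 0 0 le_rfl
  rw [h1] at h2
  rw [← h2, runLength, gammas, List.flatMap_map]

theorem length_gammas_le (l : List ℕ) :
    (gammas l).length ≤ (l.map fun g => 2 * Nat.size g).sum := by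
  induction l with
  | nil => rfl
  | cons g l ih =>
    have := length_eliasGamma_le g
    simp only [gammas, List.flatMap_cons, List.length_append, List.map_cons, List.sum_cons] at ih ⊢
    omega

theorem length_gammas_gapsFrom_le (c : ℕ) (S : Finset ℕ) :
    (gammas (gapsFrom c S.sort)).length ≤ wt S := by
  rw [← sum_gapsFrom_sort]
  refine (length_gammas_le _).trans ?_
  cases S.sort with
  | nil => rfl
  | cons p l =>
    have := Nat.size_le_size (show p + 1 - c ≤ p + 1 by omega)
    simp only [gapsFrom, List.map_cons, List.sum_cons, Nat.sub_zero]
    omega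

theorem sort_union_of_lt {S T : Finset ℕ} (h : ∀ a ∈ S, ∀ b ∈ T, a < b) :
    (S ∪ T).sort = S.sort ++ T.sort := by
  apply (Finset.sortedLT_sort _).eq_of_mem_iff
  · rw [List.sortedLT_iff_pairwise, List.pairwise_append]
    refine ⟨List.sortedLT_iff_pairwise.1 (Finset.sortedLT_sort S),
      List.sortedLT_iff_pairwise.1 (Finset.sortedLT_sort T), ?_⟩
    simpa using h
  · intro a
    simp

end SecondaryIndex

namespace SecondaryIndex

/-! ### Programs with block transfers -/

/-- A program that transfers blocks and finally returns a value. The residual program after some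
transfers is all that has to be remembered, so the memory needed is the logarithm of the number of
residual programs. -/
inductive Prog (B : ℕ) (α : Type) : Type
  | ret (a : α)
  | readIndex (a : ℕ) (k : Block B → Prog B α)
  | readWork (a : ℕ) (k : Block B → Prog B α)
  | writeWork (a : ℕ) (v : Block B) (k : Prog B α)

namespace Prog

variable {B : ℕ} {α β : Type}

/-- Sequential composition. -/
def bind : Prog B α → (α → Prog B β) → Prog B β
  | ret a, f => f a
  | readIndex a k, f => readIndex a fun v => (k v).bind f
  | readWork a k, f => readWork a fun v => (k v).bind f
  | writeWork a v k, f => writeWork a v (k.bind f)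

/-- The result, the final working disk and the number of transfers. -/
def run (D : Disk) : Prog B α → Disk → α × Disk × ℕ
  | ret a, W => (a, W, 0)
  | readIndex a k, W => let r := (k (readBlock D a)).run D W; (r.1, r.2.1, r.2.2 + 1)
  | readWork a k, W => let r := (k (readBlock W a)).run D W; (r.1, r.2.1, r.2.2 + 1)
  | writeWork a v k, W => let r := k.run D (writeBlock W a v); (r.1, r.2.1, r.2.2 + 1)

/-- Started with the working disk `W`, the program returns `a` and leaves the working disk `W'`
after `t` transfers. -/
def Exec (D : Disk) (p : Prog B α) (W : Disk) (a : α) (W' : Disk) (t : ℕ) : Prop :=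
  p.run D W = (a, W', t)

theorem Exec.ret (D : Disk) (a : α) (W : Disk) : Exec (B := B) D (ret a) W a W 0 := rfl

theorem Exec.bind {D : Disk} {p : Prog B α} {f : α → Prog B β} {W W' W'' : Disk} {a : α} {b : β}
    {t t' : ℕ} (hp : Exec D p W a W' t) (hf : Exec D (f a) W' b W'' t') :
    Exec D (p.bind f) W b W'' (t + t') := by
  induction p generalizing W t with
  | ret c =>
    simp only [Exec, run, Prod.mk.injEq] at hp
    obtain ⟨rfl, rfl, rfl⟩ := hp
    simpa [Prog.bind] using hf
  | readIndex c k ih =>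
    simp only [Exec, run, Prod.mk.injEq] at hp
    have := ih (readBlock D c) (W := W) (t := t - 1)
      (by rw [Exec, ← hp.1, ← hp.2.1, ← hp.2.2]; rfl)
    simp only [Exec, Prog.bind, run] at this ⊢
    rw [this]
    simp only [Prod.mk.injEq, true_and]
    omega
  | readWork c k ih =>
    simp only [Exec, run, Prod.mk.injEq] at hp
    have := ih (readBlock W c) (W := W) (t := t - 1)
      (by rw [Exec, ← hp.1, ← hp.2.1, ← hp.2.2]; rfl)
    simp only [Exec, Prog.bind, run] at this ⊢
    rw [this]
    simp only [Prod.mk.injEq, true_and]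
    omega
  | writeWork c v k ih =>
    simp only [Exec, run, Prod.mk.injEq] at hp
    have := ih (W := writeBlock W c v) (t := t - 1)
      (by rw [Exec, ← hp.1, ← hp.2.1, ← hp.2.2]; rfl)
    simp only [Exec, Prog.bind, run] at this ⊢
    rw [this]
    simp only [Prod.mk.injEq, true_and]
    omega

/-- `n`-fold iteration. -/
def iter (f : α → Prog B α) : ℕ → α → Prog B α
  | 0, a => ret a
  | n + 1, a => (f a).bind (iter f n)

/-- The loop rule. `I k a W c` is an invariant in which `k` bounds the number of rounds that remain
and `c` is the number of transfers so far; with `k = 0` the loop is over, and the remaining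
iterations do nothing. -/
theorem Exec.iter {D : Disk} {f : α → Prog B α} (I : ℕ → α → Disk → ℕ → Prop)
    (hstep : ∀ k a W c, I (k + 1) a W c →
      ∃ a' W' t k', Exec D (f a) W a' W' t ∧ k' ≤ k ∧ I k' a' W' (c + t))
    (hdone : ∀ a W c, I 0 a W c → f a = Prog.ret a)
    (n : ℕ) {k : ℕ} {a : α} {W : Disk} {c : ℕ} (hI : I k a W c) (hk : k ≤ n) :
    ∃ a' W' t, Exec D (iter f n a) W a' W' t ∧ I 0 a' W' (c + t) := by
  induction n generalizing k a W c with
  | zero =>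
    obtain rfl : k = 0 := by omega
    exact ⟨a, W, 0, Exec.ret _ _ _, hI⟩
  | succ n ih =>
    cases k with
    | zero =>
      obtain ⟨a', W', t, h1, h2⟩ := ih hI (Nat.zero_le _)
      refine ⟨a', W', 0 + t, ?_, by rwa [Nat.zero_add]⟩
      have h3 : Exec D (f a) W a W 0 := by
        rw [hdone a W c hI]
        exact Exec.ret _ _ _
      exact h3.bind h1
    | succ k =>
      obtain ⟨a₁, W₁, t₁, k', h1, h2, h3⟩ := hstep k a W c hI
      obtain ⟨a', W', t, h4, h5⟩ := ih h3 (by omega)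
      exact ⟨a', W', t₁ + t, h1.bind h4, by rwa [← add_assoc]⟩

/-! ### Counting residual programs -/

/-- The program that follows the first transfer of `p`, if there is one, belongs to `S`. -/
def StepsInto (S : Finset (Prog B α)) : Prog B α → Prop
  | ret _ => True
  | readIndex _ k => ∀ v, k v ∈ S
  | readWork _ k => ∀ v, k v ∈ S
  | writeWork _ _ k => k ∈ S

/-- A set of programs that contains all their residual programs. -/
def Closed (S : Finset (Prog B α)) : Prop := ∀ p ∈ S, StepsInto S p

theorem StepsInto.mono {S T : Finset (Prog B α)} (h : S ⊆ T) {p : Prog B α}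
    (hp : StepsInto S p) : StepsInto T p := by
  cases p with
  | ret a => trivial
  | readIndex a k => exact fun v => h (hp v)
  | readWork a k => exact fun v => h (hp v)
  | writeWork a v k => exact h hp

/-- The programs `f i` have at most `N` residual programs altogether. -/
def FitsCard {ι : Type*} (N : ℕ) (f : ι → Prog B α) : Prop :=
  ∃ S : Finset (Prog B α), Closed S ∧ S.card ≤ N ∧ ∀ i, f i ∈ S

/-- The programs `f i` can all be run in `s` bits of memory. -/
def Fits {ι : Type*} (s : ℕ) (f : ι → Prog B α) : Prop := FitsCard (2 ^ s) f

/-- The program `p` can be run in `s` bits of memory. -/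
def Fits₁ (s : ℕ) (p : Prog B α) : Prop := Fits s fun _ : Unit => p

section
open Classical

variable {ι : Type*}

theorem Closed.union {S T : Finset (Prog B α)} (hS : Closed S) (hT : Closed T) :
    Closed (S ∪ T) := by
  intro p hp
  rcases Finset.mem_union.1 hp with hp | hp
  · exact (hS p hp).mono Finset.subset_union_left
  · exact (hT p hp).mono Finset.subset_union_right

theorem Closed.insert {S : Finset (Prog B α)} (hS : Closed S) {p : Prog B α}
    (hp : StepsInto S p) : Closed (insert p S) := by
  intro q hq
  rcases Finset.mem_insert.1 hq with rfl | hq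
  · exact hp.mono (Finset.subset_insert _ _)
  · exact (hS q hq).mono (Finset.subset_insert _ _)

theorem Closed.biUnion {I : Finset ι} {S : ι → Finset (Prog B α)} (h : ∀ i ∈ I, Closed (S i)) :
    Closed (I.biUnion S) := by
  intro p hp
  obtain ⟨i, hi, hp⟩ := Finset.mem_biUnion.1 hp
  exact (h i hi p hp).mono (Finset.subset_biUnion_of_mem S hi)

theorem Closed.bind {S : Finset (Prog B α)} {T : Finset (Prog B β)} {g : α → Prog B β}
    (hS : Closed S) (hT : Closed T) (hg : ∀ a, g a ∈ T) :
    Closed (S.image (fun p => p.bind g) ∪ T) := by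
  intro p hp
  rcases Finset.mem_union.1 hp with hp | hp
  · obtain ⟨q, hq, rfl⟩ := Finset.mem_image.1 hp
    have hq' := hS q hq
    cases q with
    | ret a => exact (hT _ (hg a)).mono Finset.subset_union_right
    | readIndex a k =>
      exact fun v => Finset.mem_union_left _ (Finset.mem_image_of_mem _ (hq' v))
    | readWork a k =>
      exact fun v => Finset.mem_union_left _ (Finset.mem_image_of_mem _ (hq' v))
    | writeWork a v k =>
      exact Finset.mem_union_left _ (Finset.mem_image_of_mem (fun p => p.bind g) hq')
  · exact (hT p hp).mono Finset.subset_union_right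

theorem FitsCard.mono {N N' : ℕ} {f : ι → Prog B α} (h : FitsCard N f) (hN : N ≤ N') :
    FitsCard N' f := by
  obtain ⟨S, h1, h2, h3⟩ := h
  exact ⟨S, h1, h2.trans hN, h3⟩

theorem Fits.mono {s t : ℕ} {f : ι → Prog B α} (h : Fits s f) (hst : s ≤ t) : Fits t f :=
  FitsCard.mono h (Nat.pow_le_pow_right (by norm_num) hst)

theorem Fits.comp {κ : Type*} {s : ℕ} {f : ι → Prog B α} (h : Fits s f) (u : κ → ι) :
    Fits s fun i => f (u i) := by
  obtain ⟨S, h1, h2, h3⟩ := h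
  exact ⟨S, h1, h2, fun i => h3 _⟩

theorem Fits.fits₁ {s : ℕ} {f : ι → Prog B α} (h : Fits s f) (i : ι) : Fits₁ s (f i) :=
  h.comp fun _ => i

theorem Fits.ret [Fintype α] {s : ℕ} (hs : Fintype.card α ≤ 2 ^ s) (h : ι → α) :
    Fits (B := B) s fun i => ret (h i) := by
  refine ⟨Finset.univ.image Prog.ret, ?_, Finset.card_image_le.trans (by simpa using hs), ?_⟩
  · intro p hp
    obtain ⟨a, _, rfl⟩ := Finset.mem_image.1 hp
    trivial
  · intro i
    exact Finset.mem_image_of_mem _ (Finset.mem_univ _)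

theorem Fits.prod {κ : Type*} [Fintype κ] {c s : ℕ} {f : κ → ι → Prog B α}
    (hc : Fintype.card κ ≤ 2 ^ c) (h : ∀ k, Fits s (f k)) :
    Fits (c + s) fun p : κ × ι => f p.1 p.2 := by
  choose S h1 h2 h3 using h
  refine ⟨Finset.univ.biUnion S, Closed.biUnion fun i _ => h1 i, ?_, fun p => ?_⟩
  · refine (Finset.card_biUnion_le_card_mul _ _ _ fun i _ => h2 i).trans ?_
    rw [pow_add]
    exact Nat.mul_le_mul_right _ hc
  · exact Finset.mem_biUnion.2 ⟨p.1, Finset.mem_univ _, h3 p.1 p.2⟩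

theorem Fits.of_forall [Fintype ι] {c s : ℕ} {f : ι → Prog B α} (hc : Fintype.card ι ≤ 2 ^ c)
    (h : ∀ i, Fits₁ s (f i)) : Fits (c + s) f :=
  (Fits.prod hc h).comp fun i => (i, ())

theorem two_pow_add_two_pow_le (a b : ℕ) : 2 ^ a + 2 ^ b ≤ 2 ^ (max a b + 1) := by
  have h1 := Nat.pow_le_pow_right (n := 2) (by norm_num) (le_max_left a b)
  have h2 := Nat.pow_le_pow_right (n := 2) (by norm_num) (le_max_right a b)
  rw [pow_succ]
  omega

theorem FitsCard.bind {N N' : ℕ} {f : ι → Prog B α} {g : α → Prog B β} (hf : FitsCard N f)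
    (hg : FitsCard N' g) : FitsCard (N + N') fun i => (f i).bind g := by
  obtain ⟨S, h1, h2, h3⟩ := hf
  obtain ⟨T, h4, h5, h6⟩ := hg
  refine ⟨_, h1.bind h4 h6, (Finset.card_union_le _ _).trans ?_, fun i => ?_⟩
  · have := Finset.card_image_le (s := S) (f := fun p => p.bind g)
    omega
  · exact Finset.mem_union_left _ (Finset.mem_image_of_mem (fun p => p.bind g) (h3 i))

theorem Fits.bind {s t : ℕ} {f : ι → Prog B α} {g : α → Prog B β} (hf : Fits s f)
    (hg : Fits t g) : Fits (max s t + 1) fun i => (f i).bind g :=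
  (FitsCard.bind hf hg).mono (two_pow_add_two_pow_le s t)

theorem Fits.ite {s : ℕ} {f g : ι → Prog B α} (c : ι → Prop) [DecidablePred c] (hf : Fits s f)
    (hg : Fits s g) : Fits (s + 1) fun i => if c i then f i else g i := by
  obtain ⟨S, h1, h2, h3⟩ := hf
  obtain ⟨T, h4, h5, h6⟩ := hg
  refine ⟨S ∪ T, h1.union h4, (Finset.card_union_le _ _).trans ?_, fun i => ?_⟩
  · rw [pow_succ]
    omega
  · by_cases h : c i
    · simp only [if_pos h]
      exact Finset.mem_union_left _ (h3 i)
    · simp only [if_neg h]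
      exact Finset.mem_union_right _ (h6 i)

theorem Fits.iter [Fintype α] {a c s : ℕ} {f : α → Prog B α} (ha : Fintype.card α ≤ 2 ^ a)
    (hf : Fits s f) {n : ℕ} (hn : n < 2 ^ c) : Fits (c + max s a) (iter f n) := by
  have key : ∀ n, FitsCard (n * 2 ^ s + 2 ^ a) (Prog.iter f n) := by
    intro n
    induction n with
    | zero =>
      exact FitsCard.mono (Fits.ret ha fun a => a : FitsCard (2 ^ a) _) (Nat.le_add_left _ _)
    | succ n ih =>
      refine (FitsCard.bind hf ih).mono ?_
      rw [Nat.succ_mul]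
      omega
  refine (key n).mono ?_
  have h1 := Nat.pow_le_pow_right (n := 2) (by norm_num) (le_max_left s a)
  have h2 := Nat.pow_le_pow_right (n := 2) (by norm_num) (le_max_right s a)
  rw [pow_add]
  nlinarith

theorem card_insert_le_two_pow {s : ℕ} {S : Finset (Prog B α)} (h : S.card ≤ 2 ^ s)
    (p : Prog B α) : (insert p S).card ≤ 2 ^ (s + 1) := by
  have := Finset.card_insert_le p S
  have := Nat.one_le_two_pow (n := s)
  rw [pow_succ]
  omega

theorem Fits₁.readIndex {s : ℕ} {k : Block B → Prog B α} (hk : Fits s k) (a : ℕ) :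
    Fits₁ (s + 1) (Prog.readIndex a k) := by
  obtain ⟨S, h1, h2, h3⟩ := hk
  exact ⟨_, h1.insert (p := .readIndex a k) h3, card_insert_le_two_pow h2 _,
    fun _ => Finset.mem_insert_self _ _⟩

theorem Fits₁.readWork {s : ℕ} {k : Block B → Prog B α} (hk : Fits s k) (a : ℕ) :
    Fits₁ (s + 1) (Prog.readWork a k) := by
  obtain ⟨S, h1, h2, h3⟩ := hk
  exact ⟨_, h1.insert (p := .readWork a k) h3, card_insert_le_two_pow h2 _,
    fun _ => Finset.mem_insert_self _ _⟩

theorem Fits₁.writeWork {s : ℕ} {k : Prog B α} (hk : Fits₁ s k) (a : ℕ) (v : Block B) :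
    Fits₁ (s + 1) (Prog.writeWork a v k) := by
  obtain ⟨S, h1, h2, h3⟩ := hk
  exact ⟨_, h1.insert (p := .writeWork a v k) (h3 ()), card_insert_le_two_pow h2 _,
    fun _ => Finset.mem_insert_self _ _⟩

end

/-- Apply a function to the result. -/
def map (h : α → β) (p : Prog B α) : Prog B β := p.bind fun a => ret (h a)

theorem Exec.map {D : Disk} {p : Prog B α} {W W' : Disk} {a : α} {t : ℕ} (h : α → β)
    (hp : Exec D p W a W' t) : Exec D (p.map h) W (h a) W' t :=
  hp.bind (f := fun a => Prog.ret (h a)) (Exec.ret D (h a) W')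

open Classical in
theorem FitsCard.map {ι : Type*} {N : ℕ} {f : ι → Prog B α} (hf : FitsCard N f) (h : α → β) :
    FitsCard N fun i => (f i).map h := by
  obtain ⟨S, h1, h2, h3⟩ := hf
  refine ⟨S.image fun p => p.map h, ?_, Finset.card_image_le.trans h2,
    fun i => Finset.mem_image_of_mem (fun p => p.map h) (h3 i)⟩
  intro p hp
  obtain ⟨q, hq, rfl⟩ := Finset.mem_image.1 hp
  have hq' := h1 q hq
  cases q with
  | ret a => trivial
  | readIndex a k => exact fun v => Finset.mem_image_of_mem (fun p => p.map h) (hq' v)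
  | readWork a k => exact fun v => Finset.mem_image_of_mem (fun p => p.map h) (hq' v)
  | writeWork a v k => exact Finset.mem_image_of_mem (fun p => p.map h) hq'

theorem Fits.map {ι : Type*} {s : ℕ} {f : ι → Prog B α} (hf : Fits s f) (h : α → β) :
    Fits s fun i => (f i).map h := FitsCard.map hf h

theorem Fits₁.ret (a : α) : Fits₁ (B := B) 0 (Prog.ret a) := by
  refine ⟨{Prog.ret a}, ?_, by simp, fun _ => by simp⟩
  intro p hp
  rw [Finset.mem_singleton.1 hp]
  trivial

/-! ### From programs to query algorithms -/

open Classical in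
/-- A family of programs that fits into `M` bits is a query algorithm with `M` bits of memory. -/
theorem exists_queryAlg {M σ : ℕ} {f : Fin σ → Fin σ → Prog B ℕ}
    (hf : Fits M fun p : Fin σ × Fin σ => f p.1 p.2) :
    ∃ A : QueryAlg B M σ, ∀ (D W W' : Disk) (l r : Fin σ) (len t : ℕ),
      Exec D (f l r) W len W' t → A.Runs D (A.init l r) W t ((List.range len).map W') := by
  obtain ⟨S, h1, h2, h3⟩ := hf
  obtain ⟨⟨code, hcode⟩⟩ : Nonempty (S ↪ Mem M) :=
    Function.Embedding.nonempty_of_card_le (by simpa using h2)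
  let code' : Prog B ℕ → Mem M := fun p => if h : p ∈ S then code ⟨p, h⟩ else fun _ => false
  let instr : Prog B ℕ → Instr B M := fun p =>
    match p with
    | ret len => Instr.halt len
    | readIndex a k => Instr.readIndex a fun v => code' (k v)
    | readWork a k => Instr.readWork a fun v => code' (k v)
    | writeWork a v k => Instr.writeWork a v (code' k)
  let A : QueryAlg B M σ :=
    { init := fun l r => code' (f l r)
      step := fun m => if h : ∃ p : S, code p = m then instr h.choose else Instr.halt 0 }
  have hstep : ∀ p ∈ S, A.step (code' p) = instr p := by
    intro p hp
    have h : ∃ q : S, code q = code' p := ⟨⟨p, hp⟩, by simp only [code', dif_pos hp]⟩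
    have h' : h.choose = ⟨p, hp⟩ := by
      apply hcode
      rw [h.choose_spec]
      simp only [code', dif_pos hp]
    simp only [A, dif_pos h, h']
  have key : ∀ (D W' : Disk) (len : ℕ) (p : Prog B ℕ) (W : Disk) (t : ℕ), p ∈ S →
      Exec D p W len W' t → A.Runs D (code' p) W t ((List.range len).map W') := by
    intro D W' len p
    induction p with
    | ret a =>
      intro W t hp h
      simp only [Exec, run, Prod.mk.injEq] at h
      obtain ⟨rfl, rfl, rfl⟩ := h
      exact QueryAlg.Runs.halt (hstep _ hp)
    | readIndex a k ih =>
      intro W t hp h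
      simp only [Exec, run, Prod.mk.injEq] at h
      obtain ⟨ha, hb, rfl⟩ := h
      exact QueryAlg.Runs.readIndex (hstep _ hp)
        (ih _ W _ (h1 _ hp _) (by rw [Exec, ← ha, ← hb]))
    | readWork a k ih =>
      intro W t hp h
      simp only [Exec, run, Prod.mk.injEq] at h
      obtain ⟨ha, hb, rfl⟩ := h
      exact QueryAlg.Runs.readWork (hstep _ hp)
        (ih _ W _ (h1 _ hp _) (by rw [Exec, ← ha, ← hb]))
    | writeWork a v k ih =>
      intro W t hp h
      simp only [Exec, run, Prod.mk.injEq] at h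
      obtain ⟨ha, hb, rfl⟩ := h
      exact QueryAlg.Runs.writeWork (hstep _ hp)
        (ih _ _ (h1 _ hp) (by rw [Exec, ← ha, ← hb]))
  exact ⟨A, fun D W W' l r len t h => key D W' len (f l r) W t (h3 (l, r)) h⟩

attribute [irreducible] Fits

end Prog

end SecondaryIndex

namespace SecondaryIndex

/-- A window: as many bits as fit into 64 blocks. -/
abbrev Window (B : ℕ) := Fin (64 * B) → Bool

/-- The window of a disk that starts at bit `p`. -/
def window (B : ℕ) (D : Disk) (p : ℕ) : Window B := fun i => D (p + i)

namespace Prog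

variable {B : ℕ} {α β : Type}

theorem card_block (B : ℕ) : Fintype.card (Block B) = 2 ^ B := by simp

/-! ### Windows of bits -/

/-- Read `c` blocks of the index from block `a` on; the bits are returned with their addresses. -/
def readIndexBlocks : ℕ → ℕ → Prog B (ℕ → Bool)
  | 0, _ => ret fun _ => false
  | c + 1, a => readIndex a fun v => (readIndexBlocks c (a + 1)).map fun g => writeBlock g a v

/-- Read `c` blocks of the working disk from block `a` on. -/
def readWorkBlocks : ℕ → ℕ → Prog B (ℕ → Bool)
  | 0, _ => ret fun _ => false
  | c + 1, a => readWork a fun v => (readWorkBlocks c (a + 1)).map fun g => writeBlock g a v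

/-- In the `c` blocks of the working disk from block `a` on, replace the bits that `patch`
specifies. -/
def patchBlocks (patch : ℕ → Option Bool) : ℕ → ℕ → Prog B Unit
  | 0, _ => ret ()
  | c + 1, a => readWork a fun v =>
      writeWork a (fun i => (patch (a * B + i)).getD (v i)) (patchBlocks patch c (a + 1))

theorem writeBlock_readBlock {D g : Disk} {a c : ℕ}
    (hg : ∀ b, (a + 1) * B ≤ b → b < (a + 1 + c) * B → g b = D b) :
    ∀ b, a * B ≤ b → b < (a + (c + 1)) * B →
      writeBlock g a (readBlock (B := B) D a) b = D b := by
  intro b h1 h2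
  simp only [writeBlock, readBlock]
  split_ifs with h
  · congr 1
    omega
  · refine hg b ?_ ?_
    · rw [Nat.add_mul]
      omega
    · rwa [show a + 1 + c = a + (c + 1) by omega]

theorem exec_readIndexBlocks (D W : Disk) (c a : ℕ) :
    ∃ g, Exec D (readIndexBlocks (B := B) c a) W g W c ∧
      ∀ b, a * B ≤ b → b < (a + c) * B → g b = D b := by
  induction c generalizing a with
  | zero => exact ⟨_, Exec.ret _ _ _, fun b h1 h2 => by rw [Nat.add_zero] at h2; omega⟩
  | succ c ih =>
    obtain ⟨g, h1, h2⟩ := ih (a + 1)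
    refine ⟨_, ?_, writeBlock_readBlock h2⟩
    have := h1.map fun g => writeBlock (B := B) g a (readBlock D a)
    simp only [Exec, readIndexBlocks, run] at this ⊢
    rw [this]

theorem exec_readWorkBlocks (D W : Disk) (c a : ℕ) :
    ∃ g, Exec D (readWorkBlocks (B := B) c a) W g W c ∧
      ∀ b, a * B ≤ b → b < (a + c) * B → g b = W b := by
  induction c generalizing a with
  | zero => exact ⟨_, Exec.ret _ _ _, fun b h1 h2 => by rw [Nat.add_zero] at h2; omega⟩
  | succ c ih =>
    obtain ⟨g, h1, h2⟩ := ih (a + 1)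
    refine ⟨_, ?_, writeBlock_readBlock h2⟩
    have := h1.map fun g => writeBlock (B := B) g a (readBlock W a)
    simp only [Exec, readWorkBlocks, run] at this ⊢
    rw [this]

theorem exec_patchBlocks (D W : Disk) (patch : ℕ → Option Bool) (c a : ℕ) :
    Exec D (patchBlocks (B := B) patch c a) W ()
      (fun b => if a * B ≤ b ∧ b < (a + c) * B then (patch b).getD (W b) else W b) (2 * c) := by
  induction c generalizing a W with
  | zero =>
    have h : (fun b => if a * B ≤ b ∧ b < (a + 0) * B then (patch b).getD (W b) else W b) = W := by
      funext b
      rw [if_neg]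
      rw [Nat.add_zero]
      omega
    rw [h]
    exact Exec.ret _ _ _
  | succ c ih =>
    have := ih (writeBlock W a fun i => (patch (a * B + i)).getD (readBlock (B := B) W a i)) (a + 1)
    simp only [Exec, patchBlocks, run] at this ⊢
    rw [this]
    simp only [Prod.mk.injEq, true_and]
    refine ⟨?_, by omega⟩
    funext b
    have e1 : (a + 1) * B = a * B + B := by ring
    have e2 : (a + 1 + c) * B = (a + (c + 1)) * B := by ring
    have e3 : (a + (c + 1)) * B = a * B + B + c * B := by ring
    simp only [writeBlock, readBlock, e1, e2]
    by_cases h1 : a * B ≤ b ∧ b < a * B + B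
    · have h2 : a * B + (b - a * B) = b := by omega
      rw [if_neg (by omega), dif_pos h1, if_pos (by omega)]
      simp only [h2]
    · rw [dif_neg h1]
      by_cases h3 : a * B + B ≤ b ∧ b < (a + (c + 1)) * B
      · rw [if_pos h3, if_pos (by omega)]
      · rw [if_neg h3, if_neg (by omega)]

theorem fits_readIndexBlocks (c a : ℕ) : Fits₁ (c * (B + 1)) (readIndexBlocks (B := B) c a) := by
  induction c generalizing a with
  | zero =>
    rw [Nat.zero_mul]
    exact Fits₁.ret _
  | succ c ih =>
    have h : Fits (B + c * (B + 1)) fun v : Block B =>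
        (readIndexBlocks c (a + 1)).map fun g => writeBlock g a v :=
      Fits.of_forall (card_block B).le fun v => Fits.map (ih (a + 1)) _
    exact (Fits₁.readIndex h a).mono (by rw [Nat.succ_mul]; omega)

theorem fits_readWorkBlocks (c a : ℕ) : Fits₁ (c * (B + 1)) (readWorkBlocks (B := B) c a) := by
  induction c generalizing a with
  | zero =>
    rw [Nat.zero_mul]
    exact Fits₁.ret _
  | succ c ih =>
    have h : Fits (B + c * (B + 1)) fun v : Block B =>
        (readWorkBlocks c (a + 1)).map fun g => writeBlock g a v :=
      Fits.of_forall (card_block B).le fun v => Fits.map (ih (a + 1)) _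
    exact (Fits₁.readWork h a).mono (by rw [Nat.succ_mul]; omega)

theorem fits_patchBlocks (patch : ℕ → Option Bool) (c a : ℕ) :
    Fits₁ (c * (B + 2)) (patchBlocks (B := B) patch c a) := by
  induction c generalizing a with
  | zero =>
    rw [Nat.zero_mul]
    exact Fits₁.ret _
  | succ c ih =>
    have h : Fits (B + (c * (B + 2) + 1)) fun v : Block B =>
        writeWork a (fun i => (patch (a * B + i)).getD (v i)) (patchBlocks patch c (a + 1)) :=
      Fits.of_forall (card_block B).le fun v => Fits₁.writeWork (ih (a + 1)) a _
    exact (Fits₁.readWork h a).mono (by rw [Nat.succ_mul]; omega)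

/-- Read the window of the index that starts at bit `p`. -/
def readIndexAt (p : ℕ) : Prog B (Window B) :=
  (readIndexBlocks 65 (p / B)).map fun g i => g (p + i)

/-- Read the window of the working disk that starts at bit `p`. -/
def readWorkAt (p : ℕ) : Prog B (Window B) :=
  (readWorkBlocks 65 (p / B)).map fun g i => g (p + i)

/-- The disk `W` after the string `s` has been written from bit `p` on. -/
def overwrite (W : Disk) (p : ℕ) (s : List Bool) : Disk := fun b =>
  if p ≤ b then (s[b - p]?).getD (W b) else W b

/-- Write a string of at most `64 * B` bits to the working disk, from bit `p` on. -/
def writeWorkAt (p : ℕ) (s : List Bool) : Prog B Unit :=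
  patchBlocks (fun b => if p ≤ b then s[b - p]? else none) 65 (p / B)

theorem window_mem {p i : ℕ} (hB : 0 < B) (hi : i < 64 * B) :
    p / B * B ≤ p + i ∧ p + i < (p / B + 65) * B := by
  have h1 := Nat.div_mul_le_self p B
  have h2 := Nat.lt_div_mul_add (a := p) hB
  rw [Nat.add_mul]
  omega

theorem exec_readIndexAt (hB : 0 < B) (D W : Disk) (p : ℕ) :
    Exec D (readIndexAt p) W (window B D p) W 65 := by
  obtain ⟨g, h1, h2⟩ := exec_readIndexBlocks (B := B) D W 65 (p / B)
  have h3 : window B D p = fun i : Fin (64 * B) => g (p + i) := by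
    funext i
    have := window_mem (p := p) hB i.2
    exact (h2 _ this.1 this.2).symm
  rw [h3]
  exact h1.map _

theorem exec_readWorkAt (hB : 0 < B) (D W : Disk) (p : ℕ) :
    Exec D (readWorkAt p) W (window B W p) W 65 := by
  obtain ⟨g, h1, h2⟩ := exec_readWorkBlocks (B := B) D W 65 (p / B)
  have h3 : window B W p = fun i : Fin (64 * B) => g (p + i) := by
    funext i
    have := window_mem (p := p) hB i.2
    exact (h2 _ this.1 this.2).symm
  rw [h3]
  exact h1.map _

theorem exec_writeWorkAt (hB : 0 < B) (D W : Disk) (p : ℕ) {s : List Bool}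
    (hs : s.length ≤ 64 * B) : Exec D (writeWorkAt (B := B) p s) W () (overwrite W p s) 130 := by
  have h := exec_patchBlocks (B := B) D W (fun b => if p ≤ b then s[b - p]? else none) 65 (p / B)
  have h1 : overwrite W p s = fun b => if p / B * B ≤ b ∧ b < (p / B + 65) * B then
      ((if p ≤ b then s[b - p]? else none).getD (W b)) else W b := by
    funext b
    unfold overwrite
    by_cases hb : p ≤ b
    · simp only [if_pos hb]
      rcases Nat.lt_or_ge (b - p) (64 * B) with hlt | hge
      · have := window_mem (p := p) hB hlt
        rw [if_pos (by omega)]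
      · rw [List.getElem?_eq_none (by omega)]
        simp
    · simp [if_neg hb]
  rw [h1]
  exact h

theorem fits_readIndexAt (p : ℕ) : Fits₁ (65 * (B + 1)) (readIndexAt (B := B) p) :=
  Fits.map (fits_readIndexBlocks _ _) _

theorem fits_readWorkAt (p : ℕ) : Fits₁ (65 * (B + 1)) (readWorkAt (B := B) p) :=
  Fits.map (fits_readWorkBlocks _ _) _

theorem fits_writeWorkAt (p : ℕ) (s : List Bool) :
    Fits₁ (65 * (B + 2)) (writeWorkAt (B := B) p s) := fits_patchBlocks _ _ _

/-! ### Cells -/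

end Prog

/-- The contents of a cell of 64 blocks of the working disk: a set of positions, and a flag that
tells whether the cell continues the run of the previous one. -/
abbrev Cell (n B : ℕ) := SmallSet n (40 * B) × Bool

instance (n m : ℕ) : Inhabited (SmallSet n m) := ⟨⟨∅, by simp⟩⟩

theorem card_cell_le (n B : ℕ) : Fintype.card (Cell n B) ≤ 2 ^ (40 * B + 2) := by
  rw [Fintype.card_prod, Fintype.card_bool, pow_succ]
  exact Nat.mul_le_mul_right _ (card_smallSet_le n _)

open Classical in
/-- Some injective encoding of cells by windows. -/
noncomputable def cellCode (n B : ℕ) : Cell n B → Window B :=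
  Classical.epsilon fun f : Cell n B → Window B => Function.Injective f

theorem cellCode_injective {B : ℕ} (n : ℕ) (hB : 0 < B) : Function.Injective (cellCode n B) := by
  obtain ⟨f⟩ : Nonempty (Cell n B ↪ Window B) := by
    refine Function.Embedding.nonempty_of_card_le ((card_cell_le n B).trans ?_)
    rw [Fintype.card_fun, Fintype.card_bool, Fintype.card_fin]
    exact Nat.pow_le_pow_right (by norm_num) (by omega)
  exact Classical.epsilon_spec (p := fun f : Cell n B → Window B => Function.Injective f) ⟨f, f.2⟩

/-- The contents of cell `i`; the cells lie behind the first `base` bits. -/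
noncomputable def cell (n B base : ℕ) (W : Disk) (i : ℕ) : Cell n B :=
  Function.invFun (cellCode n B) (window B W (base + i * (64 * B)))

namespace Prog

variable {B : ℕ}

/-- Read cell `i`. -/
noncomputable def readCell (n base i : ℕ) : Prog B (Cell n B) :=
  (readWorkAt (base + i * (64 * B))).map (Function.invFun (cellCode n B))

/-- Write cell `i`. -/
noncomputable def writeCell (n base i : ℕ) (c : Cell n B) : Prog B Unit :=
  writeWorkAt (base + i * (64 * B)) (List.ofFn (cellCode n B c))

theorem exec_readCell (n : ℕ) (hB : 0 < B) (D W : Disk) (base i : ℕ) :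
    Exec D (readCell n base i) W (cell n B base W i) W 65 :=
  (exec_readWorkAt hB D W _).map _

theorem cell_congr {n base : ℕ} {W W' : Disk} {i : ℕ} (h : ∀ b ≥ base, W' b = W b) :
    cell n B base W' i = cell n B base W i := by
  unfold cell
  congr 1
  funext j
  exact h _ (by omega)

theorem exec_writeCell (n : ℕ) (hB : 0 < B) (D W : Disk) (base i : ℕ) (c : Cell n B) :
    ∃ W', Exec D (writeCell n base i c) W () W' 130 ∧ cell n B base W' i = c ∧
      (∀ j, j ≠ i → cell n B base W' j = cell n B base W j) ∧ ∀ b < base, W' b = W b := by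
  refine ⟨_, exec_writeWorkAt hB D W _ (by simp), ?_, ?_, ?_⟩
  · unfold cell
    have h : window B (overwrite W (base + i * (64 * B)) (List.ofFn (cellCode n B c)))
        (base + i * (64 * B)) = cellCode n B c := by
      funext j
      simp [window, overwrite]
    rw [h]
    exact Function.leftInverse_invFun (cellCode_injective n hB) c
  · intro j hj
    unfold cell
    congr 1
    funext m
    have hm := m.2
    unfold window overwrite
    split_ifs with h
    · rw [List.getElem?_eq_none]
      · rfl
      · rw [List.length_ofFn]
        have hij : i < j := by
          by_contra hc
          have := Nat.mul_le_mul_right (64 * B) (show j + 1 ≤ i by omega)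
          rw [Nat.add_mul] at this
          omega
        have := Nat.mul_le_mul_right (64 * B) (show i + 1 ≤ j by omega)
        rw [Nat.add_mul] at this
        omega
    · rfl
  · intro b hb
    unfold overwrite
    rw [if_neg (by omega)]

theorem fits_readCell (n base i : ℕ) : Fits₁ (65 * (B + 1)) (readCell (B := B) n base i) :=
  Fits.map (fits_readWorkAt _) _

theorem fits_writeCell (n base i : ℕ) (c : Cell n B) :
    Fits₁ (65 * (B + 2)) (writeCell n base i c) := fits_writeWorkAt _ _

end Prog

end SecondaryIndex

namespace SecondaryIndex

/-! ### Merging runs -/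

/-- The number `x`, cut off at `A`. -/
def clamp (A x : ℕ) : Fin (A + 1) := ⟨min x A, by omega⟩

theorem clamp_val {A x : ℕ} (h : x ≤ A) : (clamp A x : ℕ) = x := min_eq_left h

/-- The positions in the `len` cells from cell `s` on. -/
def cellsUnion {n B : ℕ} (V : ℕ → Cell n B) (s len : ℕ) : Finset ℕ :=
  (Finset.range len).biUnion fun j => (V (s + j)).1.1

/-- The `len` cells from cell `s` on form a run: their positions ascend from cell to cell. -/
def IsRun {n B : ℕ} (V : ℕ → Cell n B) (s len : ℕ) : Prop :=
  ∀ j j', j < j' → j' < len → ∀ p ∈ (V (s + j)).1.1, ∀ p' ∈ (V (s + j')).1.1, p < p'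

theorem mem_cellsUnion {n B : ℕ} {V : ℕ → Cell n B} {s len p : ℕ} :
    p ∈ cellsUnion V s len ↔ ∃ j < len, p ∈ (V (s + j)).1.1 := by
  simp [cellsUnion]

theorem cellsUnion_congr {n B : ℕ} {V V' : ℕ → Cell n B} {s len : ℕ}
    (h : ∀ j < len, V (s + j) = V' (s + j)) : cellsUnion V s len = cellsUnion V' s len := by
  refine Finset.biUnion_congr rfl fun j hj => ?_
  rw [h j (Finset.mem_range.1 hj)]

theorem IsRun.congr {n B : ℕ} {V V' : ℕ → Cell n B} {s len : ℕ} (hr : IsRun V s len)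
    (h : ∀ j < len, V (s + j) = V' (s + j)) : IsRun V' s len := by
  intro j j' h1 h2
  rw [← h j (by omega), ← h j' h2]
  exact hr j j' h1 h2

theorem lt_of_mem_cell {n B p : ℕ} {c : Cell n B} (h : p ∈ c.1.1) : p < n :=
  Finset.mem_range.1 (c.1.2.1 h)

theorem cellsUnion_succ {n B : ℕ} (V : ℕ → Cell n B) (s len : ℕ) :
    cellsUnion V s (len + 1) = cellsUnion V s len ∪ (V (s + len)).1.1 := by
  rw [cellsUnion, Finset.range_add_one, Finset.biUnion_insert, Finset.union_comm]
  rfl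

theorem cellsUnion_add {n B : ℕ} (V : ℕ → Cell n B) (s len len' : ℕ) :
    cellsUnion V s (len + len') = cellsUnion V s len ∪ cellsUnion V (s + len) len' := by
  induction len' with
  | zero => simp [cellsUnion]
  | succ m ih => rw [← add_assoc, cellsUnion_succ, ih, cellsUnion_succ, Finset.union_assoc, add_assoc]

theorem wt_cellsUnion_le {n B : ℕ} (V : ℕ → Cell n B) (s len : ℕ) :
    wt (cellsUnion V s len) ≤ len * (40 * B) := by
  refine (wt_biUnion_le _ _).trans ((Finset.sum_le_card_nsmul _ _ _ fun j _ => (V _).1.2.2).trans ?_)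
  simp

/-- What a merge remembers of one of its source runs: the next cell, the number of cells that have
not been loaded, and one more than the last position loaded. -/
abbrev Source (n A : ℕ) := Fin (A + 1) × Fin (A + 1) × Fin (n + 1)

/-- The state of a merge of `F` runs: the sources, the pool of positions that have been loaded but
not emitted, and the number of cells emitted. -/
abbrev MergeState (n B A F : ℕ) :=
  (Fin F → Source n A) × SmallSet n ((F + 2) * (40 * B)) × Fin (A + 1)

namespace MergeState

variable {n B A F : ℕ} (s : MergeState n B A F)

/-- Address of the next cell of source `i`. -/
def nx (i : Fin F) : ℕ := (s.1 i).1
/-- Number of cells of source `i` that have not been loaded. -/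
def rem (i : Fin F) : ℕ := (s.1 i).2.1
/-- A lower bound for the positions of source `i` that have not been loaded. -/
def front (i : Fin F) : ℕ := (s.1 i).2.2
/-- The pool. -/
def pool : Finset ℕ := s.2.1.1
/-- Number of cells emitted. -/
def out : ℕ := s.2.2

open Classical in
/-- A source with the least lower bound among those with cells left. -/
noncomputable def next : Option (Fin F) :=
  if h : ∃ i, 0 < s.rem i ∧ ∀ j, 0 < s.rem j → s.front i ≤ s.front j then some h.choose else none

/-- The positions below this bound precede everything that has not been loaded. -/
noncomputable def thr : ℕ := match s.next with
  | some i => s.front i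
  | none => n

/-- The part of the pool that may be emitted. -/
noncomputable def ready : Finset ℕ := s.pool.filter (· < s.thr)

/-- The next cell to be emitted holds the positions of the pool below this bound: as many of those
that may be emitted as fit into a cell. -/
noncomputable def cut : ℕ :=
  min s.thr (Nat.findGreatest (fun t => wt (s.ready.filter (· < t)) ≤ 40 * B) n)

/-- The contents of the next cell to be emitted. -/
noncomputable def chunk : Finset ℕ := s.pool.filter (· < s.cut)

/-- The state after the cell `c` of source `i` has been loaded. -/
noncomputable def load (i : Fin F) (c : Cell n B) : MergeState n B A F :=
  (Function.update s.1 i (clamp A (s.nx i + 1), clamp A (s.rem i - 1),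
    clamp n (max (s.front i) (c.1.1.sup (· + 1)))), SmallSet.mk' _ _ (s.pool ∪ c.1.1), s.2.2)

/-- The state after a cell has been emitted. -/
noncomputable def emit : MergeState n B A F :=
  (s.1, SmallSet.mk' _ _ (s.pool.filter (s.cut ≤ ·)), clamp A (s.out + 1))

theorem next_eq_some {i : Fin F} (h : s.next = some i) :
    0 < s.rem i ∧ s.thr = s.front i ∧ ∀ j, 0 < s.rem j → s.front i ≤ s.front j := by
  have h1 : s.thr = s.front i := by
    unfold thr
    rw [h]
  unfold next at h
  split_ifs at h with hex
  have h2 := hex.choose_spec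
  rw [Option.some.injEq] at h
  rw [h] at h2
  exact ⟨h2.1, h1, h2.2⟩

theorem next_eq_none (h : s.next = none) : s.thr = n ∧ ∀ i, s.rem i = 0 := by
  refine ⟨by unfold thr; rw [h], ?_⟩
  by_contra! hc
  obtain ⟨i, hi⟩ := hc
  unfold next at h
  split_ifs at h with hex
  obtain ⟨m, hm, hmin⟩ := Finset.exists_min_image (Finset.univ.filter fun i => 0 < s.rem i) s.front
    ⟨i, by simp; omega⟩
  simp only [Finset.mem_filter, Finset.mem_univ, true_and] at hm hmin
  exact hex ⟨m, hm, hmin⟩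

theorem front_le (i : Fin F) : s.front i ≤ n := by
  have := (s.1 i).2.2.2
  unfold front
  omega

theorem thr_le : s.thr ≤ n := by
  unfold thr
  split
  · exact s.front_le _
  · exact le_rfl

theorem thr_le_front {i : Fin F} (hi : 0 < s.rem i) : s.thr ≤ s.front i := by
  cases h : s.next with
  | none => have := (s.next_eq_none h).2 i; omega
  | some j =>
    obtain ⟨_, h1, h2⟩ := s.next_eq_some h
    rw [h1]
    exact h2 i hi

theorem pool_subset : s.pool ⊆ Finset.range n := s.2.1.2.1

theorem chunk_eq : s.chunk = s.ready.filter
    (· < Nat.findGreatest (fun t => wt (s.ready.filter (· < t)) ≤ 40 * B) n) := by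
  ext p
  have h : p ∈ s.ready ↔ p ∈ s.pool ∧ p < s.thr := Finset.mem_filter
  rw [chunk, cut, Finset.mem_filter, lt_min_iff, Finset.mem_filter, h, and_assoc]

theorem wt_chunk_le : wt s.chunk ≤ 40 * B := by
  rw [chunk_eq]
  exact Nat.findGreatest_spec (P := fun t => wt (s.ready.filter (· < t)) ≤ 40 * B)
    (Nat.zero_le n) (by simp)

/-- A cell that does not take everything that may be emitted is nearly full. -/
theorem lt_wt_chunk (h : s.chunk ≠ s.ready) : 40 * B < wt s.chunk + 2 * Nat.size n := by
  rw [chunk_eq] at h ⊢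
  set t := Nat.findGreatest (fun t => wt (s.ready.filter (· < t)) ≤ 40 * B) n with ht
  have htn : t < n := by
    by_contra hc
    apply h
    refine Finset.filter_true_of_mem fun p hp => ?_
    have := Finset.mem_range.1 (s.pool_subset (Finset.mem_filter.1 hp).1)
    omega
  have h1 := Nat.findGreatest_is_greatest (P := fun t => wt (s.ready.filter (· < t)) ≤ 40 * B)
    (n := n) (k := t + 1) (by omega) (by omega)
  rw [not_le] at h1
  refine h1.trans_le ?_
  have h2 : s.ready.filter (· < t + 1) ⊆ s.ready.filter (· < t) ∪ {t} := by
    intro p hp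
    rw [Finset.mem_filter] at hp
    rw [Finset.mem_union, Finset.mem_filter, Finset.mem_singleton]
    rcases Nat.lt_or_ge p t with h | h
    · exact Or.inl ⟨hp.1, h⟩
    · exact Or.inr (by omega)
  refine (wt_mono h2).trans ((wt_union_le _ _).trans (Nat.add_le_add_left ?_ _))
  have h3 := wt_le_card_mul (n := n) (S := {t}) (by simpa using htn)
  simpa using h3

end MergeState

namespace Prog

variable {n B base A F : ℕ}

open Classical in
/-- One step of a merge that writes its output from cell `q` on: if everything that may be emitted
fits into a cell and there is a source with cells left, load a cell; otherwise emit one. -/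
noncomputable def mergeStep (base q : ℕ) (s : MergeState n B A F) : Prog B (MergeState n B A F) :=
  if s.chunk = s.ready ∧ s.next.isSome then
    match s.next with
    | some i => (readCell n base (s.nx i)).map fun c => s.load i c
    | none => ret s
  else if s.chunk = ∅ then ret s
  else (writeCell n base (q + s.out) (SmallSet.mk' n (40 * B) s.chunk, false)).map fun _ => s.emit

/-- Merge the runs `r i`, given by their first cells and their lengths, to a run that starts at
cell `q`; the result is the length of that run. -/
noncomputable def merge (base : ℕ) (r : Fin F → Fin (A + 1) × Fin (A + 1)) (q : ℕ) :
    Prog B (Fin (A + 1)) :=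
  (iter (mergeStep (n := n) base q) A
    (fun i => ((r i).1, (r i).2, clamp n 0), SmallSet.mk' _ _ ∅, clamp A 0)).map fun s => s.2.2

/-- The invariant of a merge. `V` are the cells and `W₀` is the disk at the start, `U` is the set
of all positions, `N` the number of source cells, `c` the number of transfers so far; the positions
below `g` have been emitted; `last i` are the positions of the cell last loaded from source `i`. -/
structure MergeInv (base q : ℕ) (V : ℕ → Cell n B) (W₀ : Disk) (U : Finset ℕ) (N : ℕ)
    (s : MergeState n B A F) (W : Disk) (c g : ℕ) (last : Fin F → Finset ℕ) : Prop where
  src_le : ∀ i, s.nx i + s.rem i ≤ q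
  cells : ∀ j < q, cell n B base W j = V j
  below : ∀ b < base, W b = W₀ b
  asc : ∀ i, IsRun V (s.nx i) (s.rem i)
  front_le : ∀ i, ∀ p ∈ cellsUnion V (s.nx i) (s.rem i), s.front i ≤ p
  le_src : ∀ i, ∀ p ∈ cellsUnion V (s.nx i) (s.rem i), g ≤ p
  le_pool : ∀ p ∈ s.pool, g ≤ p
  lt_of_emitted : ∀ p ∈ cellsUnion (cell n B base W) q s.out, p < g
  le_n : g ≤ n
  out_asc : IsRun (cell n B base W) q s.out
  mem_U : ∀ p, p ∈ U ↔ p ∈ cellsUnion (cell n B base W) q s.out ∨ p ∈ s.pool ∨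
    ∃ i, p ∈ cellsUnion V (s.nx i) (s.rem i)
  full : s.out * (32 * B) ≤ wt (cellsUnion (cell n B base W) q s.out) ∨
    s.pool = ∅ ∧ (∀ i, s.rem i = 0) ∧
      (s.out - 1) * (32 * B) ≤ wt (cellsUnion (cell n B base W) q s.out)
  out_le : s.out ≤ (cellsUnion (cell n B base W) q s.out).card
  pool_last : ∀ p ∈ s.pool, s.thr ≤ p → ∃ i, p ∈ last i
  wt_last : ∀ i, wt (last i) ≤ 40 * B
  last_lt : ∀ i, ∀ p ∈ last i, p < s.front i
  cost : c + 130 * ∑ i, s.rem i ≤ 130 * (N + s.out)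

theorem MergeInv.load {q : ℕ} {V : ℕ → Cell n B} {W₀ W : Disk} {U : Finset ℕ} {N c g : ℕ}
    {s : MergeState n B A F} {last : Fin F → Finset ℕ}
    (h : MergeInv base q V W₀ U N s W c g last) (hq : q ≤ A) (hrc : s.chunk = s.ready)
    {i : Fin F} (hi : s.next = some i) :
    MergeInv base q V W₀ U N (s.load i (V (s.nx i))) W (c + 65) g
        (Function.update last i (V (s.nx i)).1.1) ∧
      ∑ j, (s.load i (V (s.nx i))).rem j + 1 = ∑ j, s.rem j := by
  obtain ⟨hrem, hthr, hmin⟩ := s.next_eq_some hi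
  set C := (V (s.nx i)).1.1 with hC
  set s' := s.load i (V (s.nx i)) with hs'
  have hsrc := h.src_le i
  have hCn : C ⊆ Finset.range n := (V (s.nx i)).1.2.1
  have hwtC : wt C ≤ 40 * B := (V (s.nx i)).1.2.2
  have hcu : cellsUnion V (s.nx i) (s.rem i) = C ∪ cellsUnion V (s.nx i + 1) (s.rem i - 1) := by
    have := cellsUnion_add V (s.nx i) 1 (s.rem i - 1)
    rw [show 1 + (s.rem i - 1) = s.rem i by omega] at this
    rw [this]
    congr 1
    simp [cellsUnion, hC]
  have e1 : s'.nx i = s.nx i + 1 := by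
    simp only [hs', MergeState.load, MergeState.nx, Function.update_self]
    exact clamp_val (by simp only [MergeState.nx] at hsrc; omega)
  have e2 : s'.rem i = s.rem i - 1 := by
    simp only [hs', MergeState.load, MergeState.rem, Function.update_self]
    exact clamp_val (by have := (s.1 i).2.1.2; omega)
  have e3 : s'.front i = max (s.front i) (C.sup (· + 1)) := by
    simp only [hs', MergeState.load, MergeState.front, Function.update_self]
    refine clamp_val (max_le ?_ ?_)
    · exact s.front_le i
    · exact Finset.sup_le fun p hp => Finset.mem_range.1 (hCn hp)
  have e1' : ∀ j, j ≠ i → s'.nx j = s.nx j := fun j hj => by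
    simp only [hs', MergeState.load, MergeState.nx, Function.update_of_ne hj]
  have e2' : ∀ j, j ≠ i → s'.rem j = s.rem j := fun j hj => by
    simp only [hs', MergeState.load, MergeState.rem, Function.update_of_ne hj]
  have e3' : ∀ j, j ≠ i → s'.front j = s.front j := fun j hj => by
    simp only [hs', MergeState.load, MergeState.front, Function.update_of_ne hj]
  have e4 : s'.out = s.out := rfl
  have hpool : wt (s.pool ∪ C) ≤ (F + 2) * (40 * B) := by
    have h1 : s.pool ⊆ s.chunk ∪ Finset.univ.biUnion last := by
      intro p hp
      rw [Finset.mem_union, Finset.mem_biUnion, hrc, MergeState.ready, Finset.mem_filter]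
      rcases Nat.lt_or_ge p s.thr with hlt | hge
      · exact Or.inl ⟨hp, hlt⟩
      · obtain ⟨j, hj⟩ := h.pool_last p hp hge
        exact Or.inr ⟨j, Finset.mem_univ _, hj⟩
    have h2 : wt (Finset.univ.biUnion last) ≤ F * (40 * B) := by
      refine (wt_biUnion_le _ _).trans
        ((Finset.sum_le_card_nsmul _ _ _ fun j _ => h.wt_last j).trans ?_)
      simp
    have h3 := (wt_mono h1).trans (wt_union_le _ _)
    have h4 := wt_union_le s.pool C
    have h5 := s.wt_chunk_le
    rw [Nat.add_mul]
    omega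
  have e5 : s'.pool = s.pool ∪ C :=
    SmallSet.val_mk' (Finset.union_subset s.pool_subset hCn) hpool
  have hthr' : s.thr ≤ s'.thr := by
    cases hn : s'.next with
    | none =>
      rw [(s'.next_eq_none hn).1]
      exact s.thr_le
    | some j =>
      obtain ⟨hj, hj', _⟩ := s'.next_eq_some hn
      rw [hj']
      by_cases hji : j = i
      · rw [hji, e3, hthr]
        exact le_max_left _ _
      · rw [e2' j hji] at hj
        rw [e3' j hji]
        exact s.thr_le_front hj
  have hsub : ∀ j, cellsUnion V (s'.nx j) (s'.rem j) ⊆ cellsUnion V (s.nx j) (s.rem j) := by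
    intro j
    by_cases hj : j = i
    · rw [hj, e1, e2, hcu]
      exact Finset.subset_union_right
    · rw [e1' j hj, e2' j hj]
  have hsum : ∑ j, s'.rem j + 1 = ∑ j, s.rem j := by
    have a1 : s'.rem i + ∑ j ∈ Finset.univ.erase i, s'.rem j = ∑ j, s'.rem j :=
      Finset.add_sum_erase _ _ (Finset.mem_univ i)
    have a2 : s.rem i + ∑ j ∈ Finset.univ.erase i, s.rem j = ∑ j, s.rem j :=
      Finset.add_sum_erase _ _ (Finset.mem_univ i)
    have a3 : ∑ j ∈ Finset.univ.erase i, s'.rem j = ∑ j ∈ Finset.univ.erase i, s.rem j :=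
      Finset.sum_congr rfl fun j hj => e2' j (Finset.ne_of_mem_erase hj)
    omega
  refine ⟨⟨?_, h.cells, h.below, ?_, ?_, ?_, ?_, h.lt_of_emitted, h.le_n, h.out_asc, ?_, ?_,
    h.out_le, ?_, ?_, ?_, ?_⟩, hsum⟩
  · intro j
    by_cases hj : j = i
    · rw [hj, e1, e2]
      omega
    · rw [e1' j hj, e2' j hj]
      exact h.src_le j
  · intro j
    by_cases hj : j = i
    · rw [hj, e1, e2]
      intro a b hab hb p hp p' hp'
      refine h.asc i (a + 1) (b + 1) (by omega) (by omega) p ?_ p' ?_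
      · rwa [show s.nx i + (a + 1) = s.nx i + 1 + a by omega]
      · rwa [show s.nx i + (b + 1) = s.nx i + 1 + b by omega]
    · rw [e1' j hj, e2' j hj]
      exact h.asc j
  · intro j p hp
    by_cases hj : j = i
    · have hp' := hsub j hp
      rw [hj] at hp'
      rw [hj, e3]
      refine max_le (h.front_le i p hp') (Finset.sup_le fun p₀ hp₀ => ?_)
      rw [hj, e1, e2, mem_cellsUnion] at hp
      obtain ⟨m, hm, hp⟩ := hp
      refine h.asc i 0 (m + 1) (by omega) (by omega) p₀ hp₀ p ?_
      rwa [show s.nx i + (m + 1) = s.nx i + 1 + m by omega]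
    · rw [e3' j hj]
      exact h.front_le j p (hsub j hp)
  · exact fun j p hp => h.le_src j p (hsub j hp)
  · intro p hp
    rw [e5, Finset.mem_union] at hp
    rcases hp with hp | hp
    · exact h.le_pool p hp
    · exact h.le_src i p (by rw [hcu]; exact Finset.mem_union_left _ hp)
  · intro p
    rw [h.mem_U p, e4, e5, Finset.mem_union]
    constructor
    · rintro (h1 | h1 | ⟨j, h1⟩)
      · exact Or.inl h1
      · exact Or.inr (Or.inl (Or.inl h1))
      · by_cases hj : j = i
        · rw [hj, hcu, Finset.mem_union] at h1
          rcases h1 with h1 | h1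
          · exact Or.inr (Or.inl (Or.inr h1))
          · exact Or.inr (Or.inr ⟨i, by rwa [e1, e2]⟩)
        · exact Or.inr (Or.inr ⟨j, by rwa [e1' j hj, e2' j hj]⟩)
    · rintro (h1 | (h1 | h1) | ⟨j, h1⟩)
      · exact Or.inl h1
      · exact Or.inr (Or.inl h1)
      · exact Or.inr (Or.inr ⟨i, by rw [hcu]; exact Finset.mem_union_left _ h1⟩)
      · exact Or.inr (Or.inr ⟨j, hsub j h1⟩)
  · refine Or.inl ?_
    rcases h.full with hf | ⟨_, hf, _⟩
    · exact hf
    · have := hf i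
      omega
  · intro p hp hp'
    rw [e5, Finset.mem_union] at hp
    by_cases hpC : p ∈ C
    · exact ⟨i, by rwa [Function.update_self]⟩
    · have hpp := hp.resolve_right hpC
      obtain ⟨j, hj⟩ := h.pool_last p hpp (hthr'.trans hp')
      refine ⟨j, ?_⟩
      rwa [Function.update_of_ne]
      rintro rfl
      have := h.last_lt j p hj
      omega
  · intro j
    by_cases hj : j = i
    · rw [hj, Function.update_self]
      exact hwtC
    · rw [Function.update_of_ne hj]
      exact h.wt_last j
  · intro j p hp
    by_cases hj : j = i
    · rw [hj, Function.update_self] at hp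
      rw [hj, e3]
      exact lt_max_of_lt_right (Finset.le_sup (f := (· + 1)) hp)
    · rw [Function.update_of_ne hj] at hp
      rw [e3' j hj]
      exact h.last_lt j p hp
  · have := h.cost
    rw [e4]
    omega

theorem MergeInv.emit {q : ℕ} {V : ℕ → Cell n B} {W₀ W W' : Disk} {U : Finset ℕ} {N c g : ℕ}
    {s : MergeState n B A F} {last : Fin F → Finset ℕ}
    (h : MergeInv base q V W₀ U N s W c g last) (hn : n ≤ A) (hB : 2 * Nat.size n ≤ 4 * B)
    (hrc : ¬(s.chunk = s.ready ∧ s.next.isSome)) (hne : s.chunk ≠ ∅)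
    (hcell : cell n B base W' (q + s.out) = (SmallSet.mk' n (40 * B) s.chunk, false))
    (hcells : ∀ j, j ≠ q + s.out → cell n B base W' j = cell n B base W j)
    (hbelow : ∀ b < base, W' b = W b) :
    MergeInv base q V W₀ U N s.emit W' (c + 130) s.cut last ∧ g < s.cut := by
  set s' := s.emit with hs'
  have hcs : s.chunk ⊆ s.pool := Finset.filter_subset _ _
  have hcn : s.chunk ⊆ Finset.range n := hcs.trans s.pool_subset
  have hcell' : (cell n B base W' (q + s.out)).1.1 = s.chunk := by
    rw [hcell]
    exact SmallSet.val_mk' hcn s.wt_chunk_le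
  have hold : ∀ j < s.out, cell n B base W' (q + j) = cell n B base W (q + j) :=
    fun j hj => hcells _ (by omega)
  have hE := cellsUnion_congr (s := q) hold
  have hlt : ∀ p ∈ s.chunk, p < s.cut := fun p hp => (Finset.mem_filter.1 hp).2
  obtain ⟨p₀, hp₀⟩ := Finset.nonempty_iff_ne_empty.2 hne
  have hg : g < s.cut := (h.le_pool p₀ (hcs hp₀)).trans_lt (hlt p₀ hp₀)
  have hEc : ∀ a ∈ cellsUnion (cell n B base W) q s.out, ∀ b ∈ s.chunk, a < b :=
    fun a ha b hb => (h.lt_of_emitted a ha).trans_le (h.le_pool b (hcs hb))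
  have hdis : Disjoint (cellsUnion (cell n B base W) q s.out) s.chunk :=
    Finset.disjoint_left.2 fun a ha hb => (hEc a ha a hb).false
  have hout_n : s.out < n := by
    have h1 : cellsUnion (cell n B base W) q s.out ∪ s.chunk ⊆ Finset.range n := by
      refine Finset.union_subset (fun p hp => ?_) hcn
      obtain ⟨j, _, hj⟩ := mem_cellsUnion.1 hp
      exact Finset.mem_range.2 (lt_of_mem_cell hj)
    have h2 := Finset.card_le_card h1
    rw [Finset.card_union_of_disjoint hdis, Finset.card_range] at h2
    have h3 := h.out_le
    have h4 := Finset.card_pos.2 ⟨p₀, hp₀⟩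
    omega
  have e1 : s'.out = s.out + 1 := clamp_val (by omega)
  have e2 : s'.pool = s.pool.filter (s.cut ≤ ·) := SmallSet.val_mk'
    ((Finset.filter_subset _ _).trans s.pool_subset)
    ((wt_mono (Finset.filter_subset _ _)).trans s.2.1.2.2)
  have hE' : cellsUnion (cell n B base W') q s'.out
      = cellsUnion (cell n B base W) q s.out ∪ s.chunk := by
    rw [e1, cellsUnion_succ, hE, hcell']
  have hcut : s.cut ≤ s.thr := min_le_left _ _
  have hwt := wt_add_wt_le hEc (n := n) fun b hb => Finset.mem_range.1 (hcn hb)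
  have hfull : s.out * (32 * B) ≤ wt (cellsUnion (cell n B base W) q s.out) := by
    rcases h.full with hf | ⟨hf, _⟩
    · exact hf
    · rw [hf] at hcs
      exact absurd (Finset.subset_empty.1 hcs) hne
  refine ⟨⟨h.src_le, ?_, ?_, h.asc, h.front_le, ?_, ?_, ?_, hcut.trans s.thr_le, ?_, ?_, ?_, ?_,
    ?_, h.wt_last, h.last_lt, ?_⟩, hg⟩
  · intro j hj
    rw [hcells j (by omega)]
    exact h.cells j hj
  · intro b hb
    rw [hbelow b hb]
    exact h.below b hb
  · intro i p hp
    have h1 := h.front_le i p hp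
    have h2 : 0 < s.rem i := by
      obtain ⟨j, hj, _⟩ := mem_cellsUnion.1 hp
      exact (Nat.zero_le j).trans_lt hj
    exact hcut.trans ((s.thr_le_front h2).trans h1)
  · intro p hp
    rw [e2, Finset.mem_filter] at hp
    exact hp.2
  · intro p hp
    rw [hE', Finset.mem_union] at hp
    rcases hp with hp | hp
    · exact (h.lt_of_emitted p hp).trans hg
    · exact hlt p hp
  · intro a b hab hb p hp p' hp'
    rw [e1] at hb
    rw [hold a (by omega)] at hp
    rcases Nat.lt_or_ge b s.out with hb' | hb'
    · rw [hold b hb'] at hp'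
      exact h.out_asc a b hab hb' p hp p' hp'
    · obtain rfl : b = s.out := by omega
      rw [hcell'] at hp'
      exact hEc p (mem_cellsUnion.2 ⟨a, hab, hp⟩) p' hp'
  · intro p
    rw [h.mem_U p, hE', e2, Finset.mem_union, Finset.mem_filter]
    have hmem : p ∈ s.pool ↔ p ∈ s.chunk ∨ p ∈ s.pool ∧ s.cut ≤ p := by
      rw [MergeState.chunk, Finset.mem_filter]
      constructor
      · intro hp
        rcases Nat.lt_or_ge p s.cut with hlt | hge
        · exact Or.inl ⟨hp, hlt⟩
        · exact Or.inr ⟨hp, hge⟩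
      · rintro (hp | hp)
        · exact hp.1
        · exact hp.1
    constructor
    · rintro (h1 | h1 | h1)
      · exact Or.inl (Or.inl h1)
      · rcases hmem.1 h1 with h2 | h2
        · exact Or.inl (Or.inr h2)
        · exact Or.inr (Or.inl h2)
      · exact Or.inr (Or.inr h1)
    · rintro ((h1 | h1) | h1 | h1)
      · exact Or.inl h1
      · exact Or.inr (Or.inl (hmem.2 (Or.inl h1)))
      · exact Or.inr (Or.inl (hmem.2 (Or.inr h1)))
      · exact Or.inr (Or.inr h1)
  · rw [hE', e1]
    by_cases hr : s.chunk = s.ready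
    · have hnone : s.next = none := by
        rw [← Option.not_isSome_iff_eq_none]
        exact fun h' => hrc ⟨hr, h'⟩
      obtain ⟨h1, h2⟩ := s.next_eq_none hnone
      refine Or.inr ⟨?_, h2, ?_⟩
      · rw [e2, Finset.filter_eq_empty_iff]
        intro p hp
        rw [not_le]
        refine hlt p ?_
        rw [hr, MergeState.ready, Finset.mem_filter, h1]
        exact ⟨hp, Finset.mem_range.1 (s.pool_subset hp)⟩
      · rw [Nat.add_sub_cancel]
        exact hfull.trans (wt_mono Finset.subset_union_left)
    · have := s.lt_wt_chunk hr
      refine Or.inl ?_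
      rw [Nat.add_mul]
      omega
  · rw [hE', e1, Finset.card_union_of_disjoint hdis]
    have h3 := h.out_le
    have h4 := Finset.card_pos.2 ⟨p₀, hp₀⟩
    omega
  · intro p hp hp'
    rw [e2, Finset.mem_filter] at hp
    exact h.pool_last p hp.1 hp'
  · have := h.cost
    have h5 : ∀ i, s'.rem i = s.rem i := fun i => rfl
    simp only [h5, e1]
    omega

/-- When nothing can be emitted or loaded, everything has been emitted. -/
theorem MergeInv.done {q : ℕ} {V : ℕ → Cell n B} {W₀ W : Disk} {U : Finset ℕ} {N c g : ℕ}
    {s : MergeState n B A F} {last : Fin F → Finset ℕ}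
    (h : MergeInv base q V W₀ U N s W c g last) (hB : 2 * Nat.size n ≤ 4 * B)
    (hrc : ¬(s.chunk = s.ready ∧ s.next.isSome)) (he : s.chunk = ∅) :
    U = cellsUnion (cell n B base W) q s.out ∧ (s.out - 1) * (32 * B) ≤ wt U := by
  have h0 : s.chunk = s.ready := by
    by_contra hc
    have := s.lt_wt_chunk hc
    rw [he, wt_empty] at this
    omega
  have hnone : s.next = none := by
    rw [← Option.not_isSome_iff_eq_none]
    exact fun h' => hrc ⟨h0, h'⟩
  obtain ⟨h1, h2⟩ := s.next_eq_none hnone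
  have h3 : s.pool = ∅ := by
    rw [← he, h0, MergeState.ready, h1, Finset.filter_true_of_mem]
    exact fun p hp => Finset.mem_range.1 (s.pool_subset hp)
  have hU : U = cellsUnion (cell n B base W) q s.out := by
    ext p
    rw [h.mem_U p, h3]
    simp [h2, cellsUnion]
  refine ⟨hU, ?_⟩
  rw [hU]
  rcases h.full with hf | ⟨_, _, hf⟩
  · exact (Nat.mul_le_mul_right _ (Nat.sub_le _ _)).trans hf
  · exact hf

/-- The result of a merge. All output cells but the last one are nearly full. -/
theorem exec_merge (D W : Disk) (hn : n ≤ A) (hn0 : 0 < n) (hB : 2 * Nat.size n ≤ 4 * B)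
    (r : Fin F → Fin (A + 1) × Fin (A + 1)) {q : ℕ} (hq : q ≤ A)
    (hr : ∀ i, ((r i).1 : ℕ) + (r i).2 ≤ q)
    (hrun : ∀ i, IsRun (cell n B base W) (r i).1 (r i).2)
    (hA : ∑ i, ((r i).2 : ℕ) + n < A) :
    ∃ (len : Fin (A + 1)) (W' : Disk) (t : ℕ),
      Exec D (merge (n := n) (B := B) base r q) W len W' t ∧
      IsRun (cell n B base W') q len ∧
      cellsUnion (cell n B base W') q len
        = Finset.univ.biUnion (fun i => cellsUnion (cell n B base W) (r i).1 (r i).2) ∧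
      (∀ j < q, cell n B base W' j = cell n B base W j) ∧ (∀ b < base, W' b = W b) ∧
      ((len : ℕ) - 1) * (32 * B) ≤
        wt (Finset.univ.biUnion fun i => cellsUnion (cell n B base W) (r i).1 (r i).2) ∧
      (len : ℕ) ≤
        (Finset.univ.biUnion fun i => cellsUnion (cell n B base W) (r i).1 (r i).2).card ∧
      t ≤ 130 * (∑ i, ((r i).2 : ℕ) + len) := by
  have hB0 : 0 < B := by
    have : 0 < Nat.size n := Nat.lt_size.2 hn0
    omega
  set V := cell n B base W with hV
  set U := Finset.univ.biUnion fun i => cellsUnion V (r i).1 (r i).2 with hU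
  set N := ∑ i, ((r i).2 : ℕ) with hN
  set s₀ : MergeState n B A F :=
    (fun i => ((r i).1, (r i).2, clamp n 0), SmallSet.mk' _ _ ∅, clamp A 0) with hs₀
  have hpool₀ : s₀.pool = ∅ := SmallSet.val_mk' (by simp) (by simp)
  have hout₀ : s₀.out = 0 := clamp_val (Nat.zero_le _)
  have hfront₀ : ∀ i, s₀.front i = 0 := fun i => clamp_val (Nat.zero_le _)
  have hrem₀ : ∀ i, s₀.rem i = (r i).2 := fun i => rfl
  have hnx₀ : ∀ i, s₀.nx i = (r i).1 := fun i => rfl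
  let I : ℕ → MergeState n B A F → Disk → ℕ → Prop := fun k s W' c =>
    ∃ g last, MergeInv base q V W U N s W' c g last ∧
      (k = 0 ∧ ¬(s.chunk = s.ready ∧ s.next.isSome) ∧ s.chunk = ∅ ∨ ∑ i, s.rem i + (n - g) < k)
  have hinit : I (N + n + 1) s₀ W 0 := by
    refine ⟨0, fun _ => ∅, ⟨?_, fun _ _ => rfl, fun _ _ => rfl, ?_, ?_, ?_, ?_, ?_, Nat.zero_le _,
      ?_, ?_, ?_, ?_, ?_, ?_, ?_, ?_⟩, Or.inr ?_⟩
    · exact fun i => hr i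
    · exact fun i => hrun i
    · exact fun i p _ => by rw [hfront₀]; exact Nat.zero_le _
    · exact fun i p _ => Nat.zero_le _
    · exact fun p _ => Nat.zero_le _
    · intro p hp
      simp [hout₀, cellsUnion] at hp
    · intro a b _ hb
      rw [hout₀] at hb
      omega
    · intro p
      rw [hpool₀, hout₀, hU]
      simp [cellsUnion, hnx₀, hrem₀]
    · exact Or.inl (by rw [hout₀, Nat.zero_mul]; exact Nat.zero_le _)
    · rw [hout₀]
      exact Nat.zero_le _
    · intro p hp
      rw [hpool₀] at hp
      simp at hp
    · simp
    · simp
    · rw [hout₀]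
      simp only [hrem₀]
      omega
    · simp only [hrem₀]
      omega
  obtain ⟨s, W', t, h1, g, last, h2, h3⟩ := Exec.iter (D := D) (f := mergeStep (n := n) base q) I
    (fun k s W' c ⟨g, last, hinv, hk⟩ => by
      have hk := hk.resolve_left (by omega)
      by_cases hl : s.chunk = s.ready ∧ s.next.isSome
      · obtain ⟨i, hi⟩ := Option.isSome_iff_exists.1 hl.2
        have hex := (exec_readCell n hB0 D W' base (s.nx i)).map fun c => s.load i c
        have hlt : s.nx i < q := by
          have := (s.next_eq_some hi).1
          have := hinv.src_le i
          omega
        rw [hinv.cells _ hlt] at hex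
        obtain ⟨h1, h2⟩ := hinv.load hq hl.1 hi
        refine ⟨_, _, _, k, ?_, le_rfl, g, _, h1, Or.inr (by omega)⟩
        rw [mergeStep, if_pos hl, hi]
        exact hex
      · by_cases he : s.chunk = ∅
        · refine ⟨s, W', 0, 0, ?_, Nat.zero_le _, g, last, hinv, Or.inl ⟨rfl, hl, he⟩⟩
          rw [mergeStep, if_neg hl, if_pos he]
          exact Exec.ret _ _ _
        · obtain ⟨W'', h1, h2, h3, h4⟩ := exec_writeCell n hB0 D W' base (q + s.out)
            (SmallSet.mk' n (40 * B) s.chunk, false)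
          obtain ⟨h5, h6⟩ := hinv.emit hn hB hl he h2 h3 h4
          refine ⟨_, _, _, k, ?_, le_rfl, s.cut, last, h5, Or.inr ?_⟩
          · rw [mergeStep, if_neg hl, if_neg he]
            exact h1.map fun _ => s.emit
          · have h7 : ∀ i, s.emit.rem i = s.rem i := fun i => rfl
            have h8 := h5.le_n
            simp only [h7]
            omega)
    (fun s W' c ⟨g, last, _, hk⟩ => by
      obtain ⟨_, hl, he⟩ := hk.resolve_right (by omega)
      rw [mergeStep, if_neg hl, if_pos he])
    A hinit (by omega)
  obtain ⟨_, hl, he⟩ := h3.resolve_right (by omega)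
  obtain ⟨h4, h5⟩ := h2.done hB hl he
  refine ⟨s.2.2, W', t, h1.map _, h2.out_asc, h4.symm, h2.cells, h2.below, h5, ?_, ?_⟩
  · have := h2.out_le
    rw [← h4] at this
    exact this
  · have := h2.cost
    simp only [MergeState.out] at this
    omega

theorem card_fin_succ_le {A a : ℕ} (hA : A < 2 ^ a) : Fintype.card (Fin (A + 1)) ≤ 2 ^ a := by
  rw [Fintype.card_fin]
  exact hA

theorem card_mergeState_le {a : ℕ} (hA : A < 2 ^ a) (hn : n ≤ A) :
    Fintype.card (MergeState n B A F) ≤ 2 ^ (a * 3 * F + ((F + 2) * (40 * B) + 1 + a)) := by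
  have h1 : Fintype.card (Source n A) ≤ 2 ^ (a * 3) := by
    rw [Fintype.card_prod, Fintype.card_prod, show a * 3 = a + (a + a) by ring, pow_add, pow_add]
    exact Nat.mul_le_mul (card_fin_succ_le hA) (Nat.mul_le_mul (card_fin_succ_le hA)
      (card_fin_succ_le (by omega)))
  rw [Fintype.card_prod, Fintype.card_prod, Fintype.card_fun, Fintype.card_fin, pow_add, pow_mul,
    pow_add]
  exact Nat.mul_le_mul (Nat.pow_le_pow_left h1 _)
    (Nat.mul_le_mul (card_smallSet_le _ _) (card_fin_succ_le hA))

/-- The memory of a merge: `F` blocks, up to a constant factor. -/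
theorem fits_merge {a : ℕ} (hA : A < 2 ^ a) (hn : n ≤ A) :
    Fits (a + (a + (a * 3 * F + ((F + 2) * (40 * B) + 1 + a) + (65 * (B + 2)) + 2)))
      fun p : (Fin F → Fin (A + 1) × Fin (A + 1)) × Fin (A + 1) =>
        merge (n := n) (B := B) base p.1 p.2 := by
  classical
  set m := a * 3 * F + ((F + 2) * (40 * B) + 1 + a) with hm
  have hcard := card_mergeState_le (B := B) (F := F) hA hn
  rw [← hm] at hcard
  have hstep : ∀ q : ℕ, Fits (m + 65 * (B + 2) + 2)
      fun s : MergeState n B A F => mergeStep base q s := by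
    intro q
    have h1 : Fits (m + 65 * (B + 2)) fun s : MergeState n B A F =>
        match s.next with
        | some i => (readCell n base (s.nx i)).map fun c => s.load i c
        | none => ret s := by
      refine Fits.of_forall hcard fun s => ?_
      cases s.next with
      | none => exact (Fits₁.ret s).mono (Nat.zero_le _)
      | some i => exact (Fits.map (fits_readCell n base (s.nx i)) _).mono (by omega)
    have h2 : Fits (m + 65 * (B + 2)) fun s : MergeState n B A F =>
        (ret s : Prog B (MergeState n B A F)) := (Fits.ret hcard fun s => s).mono (by omega)
    have h3 : Fits (m + 65 * (B + 2)) fun s : MergeState n B A F =>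
        (writeCell n base (q + s.out) (SmallSet.mk' n (40 * B) s.chunk, false)).map
          fun _ => s.emit :=
      Fits.of_forall hcard fun s => Fits.map (fits_writeCell n base _ _) _
    unfold mergeStep
    exact Fits.ite _ (h1.mono (Nat.le_succ _)) (Fits.ite _ h2 h3)
  have hq : ∀ q : Fin (A + 1), Fits (a + (m + 65 * (B + 2) + 2))
      fun r : Fin F → Fin (A + 1) × Fin (A + 1) => merge (n := n) (B := B) base r q := by
    intro q
    have h4 := Fits.iter hcard (hstep q) hA
    rw [max_eq_left (by omega)] at h4
    exact Fits.map (h4.comp fun r : Fin F → Fin (A + 1) × Fin (A + 1) =>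
      (fun i => ((r i).1, (r i).2, clamp n 0), SmallSet.mk' _ _ ∅, clamp A 0)) _
  exact (Fits.prod (card_fin_succ_le hA) hq).comp
    fun p : (Fin F → Fin (A + 1) × Fin (A + 1)) × Fin (A + 1) => (p.2, p.1)

end Prog

end SecondaryIndex

namespace SecondaryIndex

/-! ### External merge sort -/

/-- The number of cells among `p, …, p' - 1` that start a run. -/
def starts {n B : ℕ} (V : ℕ → Cell n B) (p p' : ℕ) : ℕ :=
  ∑ j ∈ Finset.Ico p p', if (V j).2 then 0 else 1

/-- The input of the merge sort: `N` nonempty cells, where a cell whose flag is set continues the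
run of the cell before it. -/
def IsInput {n B : ℕ} (V : ℕ → Cell n B) (N : ℕ) : Prop :=
  (∀ j < N, (V j).1.1.Nonempty) ∧
    ∀ j, j + 1 < N → (V (j + 1)).2 = true → ∀ p ∈ (V j).1.1, ∀ p' ∈ (V (j + 1)).1.1, p < p'

theorem starts_add {n B : ℕ} (V : ℕ → Cell n B) {p p' p'' : ℕ} (h : p ≤ p') (h' : p' ≤ p'') :
    starts V p p' + starts V p' p'' = starts V p p'' :=
  Finset.sum_Ico_consecutive _ h h'

theorem starts_congr {n B : ℕ} {V V' : ℕ → Cell n B} {p p' N : ℕ} (h : ∀ j < N, V j = V' j)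
    (hp : p' ≤ N) : starts V p p' = starts V' p p' := by
  refine Finset.sum_congr rfl fun j hj => ?_
  rw [h j ((Finset.mem_Ico.1 hj).2.trans_le hp)]

theorem starts_pos {n B : ℕ} {V : ℕ → Cell n B} {p p' : ℕ} (h : p < p') (hp : (V p).2 = false) :
    1 ≤ starts V p p' := by
  have h1 := Finset.single_le_sum (f := fun j => if (V j).2 then 0 else 1)
    (fun _ _ => Nat.zero_le _) (Finset.mem_Ico.2 ⟨le_rfl, h⟩)
  simp only [hp, Bool.false_eq_true, if_false] at h1
  exact h1

theorem IsInput.congr {n B : ℕ} {V V' : ℕ → Cell n B} {N : ℕ} (hV : IsInput V N)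
    (h : ∀ j < N, V j = V' j) : IsInput V' N := by
  refine ⟨fun j hj => ?_, fun j hj => ?_⟩
  · rw [← h j hj]
    exact hV.1 j hj
  · rw [← h j (by omega), ← h (j + 1) hj]
    exact hV.2 j hj

theorem IsInput.isRun {n B : ℕ} {V : ℕ → Cell n B} {N p len : ℕ} (hV : IsInput V N)
    (hN : p + len ≤ N) (hf : ∀ j < len, 0 < j → (V (p + j)).2 = true) : IsRun V p len := by
  have key : ∀ j m, j + m + 1 < len → ∀ x ∈ (V (p + j)).1.1, ∀ y ∈ (V (p + (j + m + 1))).1.1,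
      x < y := by
    intro j m
    induction m with
    | zero =>
      intro h x hx y hy
      exact hV.2 (p + j) (by omega) (hf (j + 1) h (by omega)) x hx y hy
    | succ m ih =>
      intro h x hx y hy
      obtain ⟨z, hz⟩ := hV.1 (p + (j + m + 1)) (by omega)
      have h1 := ih (by omega) x hx z hz
      have h2 := hV.2 (p + (j + m + 1)) (by omega) (hf (j + m + 2) (by omega) (by omega)) z hz y hy
      omega
  intro j j' h1 h2 x hx y hy
  obtain ⟨m, rfl⟩ := Nat.exists_eq_add_of_lt h1
  exact key j m h2 x hx y hy

namespace Prog

variable {n B base A F : ℕ}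

/-- One step of the scan for the end of the run that starts at cell `p`. The state is the length
found so far and a flag that tells whether the run is over. -/
noncomputable def scanStep (n B base A p N : ℕ) (s : Fin (A + 1) × Bool) :
    Prog B (Fin (A + 1) × Bool) :=
  if s.2 = false ∧ p + s.1 < N then
    (readCell n base (p + s.1)).map fun c =>
      if (s.1 : ℕ) = 0 ∨ c.2 = true then (clamp A (s.1 + 1), false) else (s.1, true)
  else ret s

/-- The length of the run that starts at cell `p`, if there are `N` cells. -/
noncomputable def scan (n B base A p N : ℕ) : Prog B (Fin (A + 1)) :=
  (iter (scanStep n B base A p N) A (clamp A 0, false)).map Prod.fst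

theorem exec_scan (hB0 : 0 < B) (D W : Disk) {p N : ℕ} (hp : p ≤ N) (hN : N < A) :
    ∃ (len : Fin (A + 1)) (t : ℕ), Exec D (scan n B base A p N) W len W t ∧
      p + len ≤ N ∧ (p + len = N ∨ (cell n B base W (p + len)).2 = false) ∧
      (p < N → 0 < (len : ℕ)) ∧
      (∀ j < (len : ℕ), 0 < j → (cell n B base W (p + j)).2 = true) ∧ t ≤ 130 * len := by
  set V := cell n B base W with hV
  let I : ℕ → Fin (A + 1) × Bool → Disk → ℕ → Prop := fun k s W' c =>
    W' = W ∧ p + s.1 ≤ N ∧ (∀ j < (s.1 : ℕ), 0 < j → (V (p + j)).2 = true) ∧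
    (s.2 = true → 0 < (s.1 : ℕ) ∧ (V (p + s.1)).2 = false) ∧
    c ≤ 65 * (s.1 + if s.2 then 1 else 0) ∧
    (k = 0 ∧ (s.2 = true ∨ p + s.1 = N) ∨ N - (p + s.1) < k)
  have h0 : ((clamp A 0 : Fin (A + 1)) : ℕ) = 0 := clamp_val (Nat.zero_le _)
  obtain ⟨⟨len, b⟩, W', t, h1, h2, h3, h4, h5, h6, h7⟩ := Exec.iter (D := D)
    (f := scanStep n B base A p N) I
    (fun k s W' c ⟨hW, h1, h2, h3, h4, h5⟩ => by
      subst hW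
      have h5 := h5.resolve_left (by omega)
      by_cases hs : s.2 = false ∧ p + s.1 < N
      · have hex := (exec_readCell n hB0 D W' base (p + s.1)).map fun c : Cell n B =>
          if (s.1 : ℕ) = 0 ∨ c.2 = true then (clamp A (s.1 + 1), false) else (s.1, true)
        have hsc : ((clamp A (s.1 + 1) : Fin (A + 1)) : ℕ) = s.1 + 1 := clamp_val (by omega)
        rw [hs.1] at h4
        simp only [Bool.false_eq_true, if_false] at h4
        by_cases hc : (s.1 : ℕ) = 0 ∨ (V (p + s.1)).2 = true
        · rw [if_pos hc] at hex
          refine ⟨_, _, _, k, by rw [scanStep, if_pos hs]; exact hex, le_rfl, rfl, ?_, ?_, ?_, ?_,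
            Or.inr ?_⟩
          · simp only [hsc]
            omega
          · intro j hj hj0
            simp only [hsc] at hj
            rcases Nat.lt_or_ge j s.1 with h | h
            · exact h2 j h hj0
            · obtain rfl : j = s.1 := by omega
              exact hc.resolve_left (by omega)
          · intro h
            simp at h
          · simp only [hsc, Bool.false_eq_true, if_false]
            omega
          · simp only [hsc]
            omega
        · rw [if_neg hc] at hex
          rw [not_or] at hc
          refine ⟨(s.1, true), W', 65, 0, by rw [scanStep, if_pos hs]; exact hex, Nat.zero_le _,
            rfl, h1, h2, ?_, ?_, Or.inl ⟨rfl, Or.inl rfl⟩⟩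
          · intro _
            exact ⟨Nat.pos_of_ne_zero hc.1, by simpa using hc.2⟩
          · simp only [if_true]
            omega
      · refine ⟨s, W', 0, 0, by rw [scanStep, if_neg hs]; exact Exec.ret _ _ _, Nat.zero_le _, rfl,
          h1, h2, h3, h4, Or.inl ⟨rfl, ?_⟩⟩
        cases hb : s.2 with
        | true => exact Or.inl rfl
        | false =>
          refine Or.inr ?_
          have : ¬(p + (s.1 : ℕ) < N) := fun h => hs ⟨hb, h⟩
          omega)
    (fun s W' c ⟨_, _, _, _, _, h5⟩ => by
      obtain ⟨_, h5⟩ := h5.resolve_right (by omega)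
      rw [scanStep, if_neg]
      rintro ⟨h6, h7⟩
      rcases h5 with h5 | h5
      · rw [h5] at h6
        simp at h6
      · omega)
    A (k := N - p + 1) (a := (clamp A 0, false)) (W := W) (c := 0)
    ⟨rfl, by simpa [h0] using hp, by simp [h0], by simp, by simp, Or.inr (by simp [h0])⟩ (by omega)
  subst h2
  obtain ⟨_, h7⟩ := h7.resolve_right (by omega)
  refine ⟨len, t, h1.map _, h3, ?_, ?_, h4, ?_⟩
  · rcases h7 with h7 | h7
    · exact Or.inr (h5 h7).2
    · exact Or.inl h7
  · intro hpN
    rcases h7 with h7 | h7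
    · exact (h5 h7).1
    · simp only at h7
      omega
  · cases b with
    | true =>
      have := (h5 rfl).1
      simp only [if_true] at h6 this
      omega
    | false =>
      simp only [Bool.false_eq_true, if_false] at h6
      omega

/-- The state while runs are collected: their number, the runs, the next input cell and the first
free cell. -/
abbrev CollectState (A F : ℕ) :=
  Fin (F + 1) × (Fin F → Fin (A + 1) × Fin (A + 1)) × (Fin (A + 1) × Fin (A + 1))

/-- Collect one more run with the program `f`, unless there are `F` already. -/
def collectStep
    (f : Fin (A + 1) × Fin (A + 1) →
      Prog B ((Fin (A + 1) × Fin (A + 1)) × (Fin (A + 1) × Fin (A + 1))))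
    (s : CollectState A F) : Prog B (CollectState A F) :=
  if h : (s.1 : ℕ) < F then
    (f s.2.2).map fun r => (clamp F (s.1 + 1), Function.update s.2.1 ⟨s.1, h⟩ r.1, r.2)
  else ret s

/-- Merge the next `F ^ d` of the runs that make up the first `N` cells. The argument consists of
the next input cell and the first free cell; the result consists of the merged run, given by its
first cell and its length, and of the new values of the two arguments. -/
noncomputable def sort (n B base A F N : ℕ) : ℕ → Fin (A + 1) × Fin (A + 1) →
    Prog B ((Fin (A + 1) × Fin (A + 1)) × (Fin (A + 1) × Fin (A + 1)))
  | 0, s => (scan n B base A s.1 N).map fun len => ((s.1, len), (clamp A (s.1 + len), s.2))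
  | d + 1, s =>
    (iter (collectStep (sort n B base A F N d)) F
      (clamp F 0, fun _ => (clamp A 0, clamp A 0), s)).bind fun s =>
        (merge (n := n) base s.2.1 s.2.2.2).map fun len =>
          ((s.2.2.2, len), (s.2.2.1, clamp A (s.2.2.2 + len)))

/-- What is claimed of one call of `sort`: `Δ` cells are consumed, among them `F ^ d` starts of
runs unless the input is exhausted; all quantities are linear in `Δ`. -/
theorem exec_sort (D : Disk) (hn : n ≤ A) (hn0 : 0 < n) (hB : 2 * Nat.size n ≤ 4 * B) {N : ℕ}
    (d : ℕ) : ∀ (W : Disk) (p q : Fin (A + 1)), (p : ℕ) ≤ N → N ≤ q →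
      q + 3 * d * (N - p) + 3 * N + n < A → IsInput (cell n B base W) N →
      ((p : ℕ) = N ∨ (cell n B base W p).2 = false) →
      ∃ (r : Fin (A + 1) × Fin (A + 1)) (p' q' : Fin (A + 1)) (W' : Disk) (t : ℕ),
        Exec D (sort n B base A F N d (p, q)) W (r, (p', q')) W' t ∧
        (p : ℕ) ≤ p' ∧ (p' : ℕ) ≤ N ∧ ((p' : ℕ) = N ∨ (cell n B base W p').2 = false) ∧
        ((p' : ℕ) = N ∨ F ^ d ≤ starts (cell n B base W) p p') ∧
        (q : ℕ) ≤ q' ∧ (q' : ℕ) ≤ q + 3 * d * (p' - p) ∧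
        (∀ j < (q : ℕ), cell n B base W' j = cell n B base W j) ∧ (∀ b < base, W' b = W b) ∧
        (r.1 : ℕ) + r.2 ≤ q' ∧ IsRun (cell n B base W') r.1 r.2 ∧
        cellsUnion (cell n B base W') r.1 r.2 = cellsUnion (cell n B base W) p (p' - p) ∧
        (r.2 : ℕ) ≤ 3 * (p' - p) ∧ t ≤ (130 + 780 * d) * (p' - p) := by
  have hB0 : 0 < B := by
    have : 0 < Nat.size n := Nat.lt_size.2 hn0
    omega
  induction d with
  | zero =>
    intro W p q hp hq hA hin hst
    obtain ⟨len, t, h1, h2, h3, h4, h5, h6⟩ := exec_scan (n := n) (base := base) hB0 D W hp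
      (show N < A by omega)
    have e1 : ((clamp A (p + len) : Fin (A + 1)) : ℕ) = p + len := clamp_val (by omega)
    have e2 : (p : ℕ) + len - p = len := by omega
    refine ⟨(p, len), clamp A (p + len), q, W, t, h1.map _, ?_⟩
    rw [e1, e2]
    refine ⟨by omega, h2, h3, ?_, le_rfl, by omega, fun _ _ => rfl, fun _ _ => rfl, by simp; omega,
      hin.isRun h2 h5, rfl, by simp; omega, by omega⟩
    rw [pow_zero]
    rcases hst with h | h
    · exact Or.inl (by omega)
    · rcases hp.eq_or_lt with h' | h'
      · exact Or.inl (by omega)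
      · have := h4 h'
        exact Or.inr (starts_pos (by omega) h)
  | succ d ih =>
    intro W p q hp hq hA hin hst
    set V := cell n B base W with hV
    have hlin : ∀ a b c : ℕ, a ≤ b → b ≤ c → 3 * d * (b - a) + 3 * d * (c - b) = 3 * d * (c - a) :=
      fun a b c h1 h2 => by rw [← Nat.mul_add]; congr 1; omega
    have hlin' : ∀ a b c : ℕ, a ≤ b → b ≤ c →
        (130 + 780 * d) * (b - a) + (130 + 780 * d) * (c - b) = (130 + 780 * d) * (c - a) :=
      fun a b c h1 h2 => by rw [← Nat.mul_add]; congr 1; omega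
    have hd1 : 3 * (d + 1) * (N - p) = 3 * d * (N - p) + 3 * (N - p) := by ring
    let I : ℕ → CollectState A F → Disk → ℕ → Prop := fun k s W' c =>
      k + (s.1 : ℕ) = F ∧ (p : ℕ) ≤ s.2.2.1 ∧ (s.2.2.1 : ℕ) ≤ N ∧
      ((s.2.2.1 : ℕ) = N ∨ (V s.2.2.1).2 = false) ∧
      ((s.2.2.1 : ℕ) = N ∨ s.1 * F ^ d ≤ starts V p s.2.2.1) ∧
      (q : ℕ) ≤ s.2.2.2 ∧ (s.2.2.2 : ℕ) ≤ q + 3 * d * (s.2.2.1 - p) ∧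
      (∀ j < (q : ℕ), cell n B base W' j = V j) ∧ (∀ b < base, W' b = W b) ∧
      (∀ j, ((s.2.1 j).1 : ℕ) + (s.2.1 j).2 ≤ s.2.2.2) ∧
      (∀ j, IsRun (cell n B base W') (s.2.1 j).1 (s.2.1 j).2) ∧
      Finset.univ.biUnion (fun j => cellsUnion (cell n B base W') (s.2.1 j).1 (s.2.1 j).2)
        = cellsUnion V p (s.2.2.1 - p) ∧
      (∀ j : Fin F, (s.1 : ℕ) ≤ j → ((s.2.1 j).2 : ℕ) = 0) ∧
      ∑ j, ((s.2.1 j).2 : ℕ) ≤ 3 * (s.2.2.1 - p) ∧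
      c ≤ (130 + 780 * d) * (s.2.2.1 - p)
    have e0 : ((clamp A 0 : Fin (A + 1)) : ℕ) = 0 := clamp_val (Nat.zero_le _)
    have e0' : ((clamp F 0 : Fin (F + 1)) : ℕ) = 0 := clamp_val (Nat.zero_le _)
    obtain ⟨s, W₁, t₁, h1, g1, g2, g3, g4, g5, g6, g7, g8, g9, g10, g11, g12, g13, g14, g15⟩ :=
      Exec.iter (D := D) (f := collectStep (F := F) (sort n B base A F N d)) I
      (fun k s W₁ c ⟨g1, g2, g3, g4, g5, g6, g7, g8, g9, g10, g11, g12, g13, g14, g15⟩ => by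
        have hi : (s.1 : ℕ) < F := by omega
        obtain ⟨i, runs, p₁, q₁⟩ := s
        simp only at g1 g2 g3 g4 g5 g6 g7 g8 g9 g10 g11 g12 g13 g14 g15 hi
        have hl1 := hlin p p₁ N g2 g3
        have hcN : ∀ j < N, V j = cell n B base W₁ j := fun j hj => (g8 j (by omega)).symm
        obtain ⟨r, p₂, q₂, W₂, t₂, k1, k2, k3, k4, k5, k6, k7, k8, k9, k10, k11, k12, k13, k14⟩ :=
          ih W₁ p₁ q₁ g3 (by omega) (by omega) (hin.congr hcN)
            (by
              rcases g4 with h | h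
              · exact Or.inl h
              · rcases g3.eq_or_lt with h' | h'
                · exact Or.inl h'
                · rw [← hcN _ h']
                  exact Or.inr h)
        have ei : ((clamp F (i + 1) : Fin (F + 1)) : ℕ) = i + 1 := clamp_val hi
        have hl2 := hlin p p₁ p₂ g2 k2
        have hl3 := hlin' p p₁ p₂ g2 k2
        refine ⟨(clamp F (i + 1), Function.update runs ⟨i, hi⟩ r, p₂, q₂), W₂, t₂, k, ?_, le_rfl,
          ?_, g2.trans k2, k3, ?_, ?_, g6.trans k6, ?_, ?_, ?_, ?_, ?_, ?_, ?_, ?_, ?_⟩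
        · rw [collectStep, dif_pos hi]
          exact k1.map fun r => (clamp F (i + 1), Function.update runs ⟨i, hi⟩ r.1, r.2)
        · simp only [ei]
          omega
        · rcases k4 with h | h
          · exact Or.inl h
          · rcases k3.eq_or_lt with h' | h'
            · exact Or.inl h'
            · rw [← hcN _ h'] at h
              exact Or.inr h
        · rcases k5 with h | h
          · exact Or.inl h
          · rcases g5 with h' | h'
            · exact Or.inl (by simp only; omega)
            · refine Or.inr ?_
              simp only [ei]
              rw [← starts_congr hcN k3] at h
              rw [← starts_add V g2 k2, Nat.add_mul, Nat.one_mul]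
              exact Nat.add_le_add h' h
        · simp only
          omega
        · intro j hj
          rw [k8 j (by omega)]
          exact g8 j hj
        · intro b hb
          rw [k9 b hb]
          exact g9 b hb
        · intro j
          by_cases hj : j = ⟨i, hi⟩
          · simp only [hj, Function.update_self]
            exact k10
          · simp only [Function.update_of_ne hj]
            exact (g10 j).trans k6
        · intro j
          by_cases hj : j = ⟨i, hi⟩
          · simp only [hj, Function.update_self]
            exact k11
          · simp only [Function.update_of_ne hj]
            refine (g11 j).congr fun m hm => (k8 _ ?_).symm
            have := g10 j
            omega
        · simp only
          have hsplit := cellsUnion_add V p (p₁ - p) (p₂ - p₁)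
          rw [show (p : ℕ) + (p₁ - p) = p₁ by omega,
            show (p₁ : ℕ) - p + (p₂ - p₁) = p₂ - p by omega] at hsplit
          have k12' : cellsUnion (cell n B base W₂) r.1 r.2 = cellsUnion V p₁ (p₂ - p₁) := by
            rw [k12]
            exact cellsUnion_congr fun j hj => (hcN _ (by omega)).symm
          rw [hsplit, ← g12, ← k12']
          have hold : ∀ j, cellsUnion (cell n B base W₂) (runs j).1 (runs j).2
              = cellsUnion (cell n B base W₁) (runs j).1 (runs j).2 := fun j =>
            cellsUnion_congr fun m hm => k8 _ (by have := g10 j; omega)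
          ext x
          simp only [Finset.mem_biUnion, Finset.mem_union, Finset.mem_univ, true_and]
          constructor
          · rintro ⟨j, hj⟩
            by_cases hji : j = ⟨i, hi⟩
            · simp only [hji, Function.update_self] at hj
              exact Or.inr hj
            · simp only [Function.update_of_ne hji] at hj
              exact Or.inl ⟨j, by rwa [← hold]⟩
          · rintro (⟨j, hj⟩ | hj)
            · by_cases hji : j = ⟨i, hi⟩
              · have h0 := g13 j (by rw [hji])
                rw [h0] at hj
                simp [cellsUnion] at hj
              · exact ⟨j, by simp only [Function.update_of_ne hji, hold]; exact hj⟩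
            · exact ⟨⟨i, hi⟩, by simpa only [Function.update_self] using hj⟩
        · intro j hj
          simp only [ei] at hj
          have hji : j ≠ ⟨i, hi⟩ := by
            rintro rfl
            simp at hj
          simp only [Function.update_of_ne hji]
          exact g13 j (by omega)
        · simp only
          have a1 : ((runs ⟨i, hi⟩).2 : ℕ) + ∑ j ∈ Finset.univ.erase ⟨i, hi⟩, ((runs j).2 : ℕ)
              = ∑ j, ((runs j).2 : ℕ) :=
            Finset.add_sum_erase _ (fun j => ((runs j).2 : ℕ)) (Finset.mem_univ _)
          have a2 : (r.2 : ℕ) + ∑ j ∈ Finset.univ.erase ⟨i, hi⟩,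
              ((Function.update runs ⟨i, hi⟩ r j).2 : ℕ)
              = ∑ j, ((Function.update runs ⟨i, hi⟩ r j).2 : ℕ) := by
            have := Finset.add_sum_erase _
              (fun j => ((Function.update runs ⟨i, hi⟩ r j).2 : ℕ)) (Finset.mem_univ ⟨i, hi⟩)
            simpa only [Function.update_self] using this
          have a3 : ∑ j ∈ Finset.univ.erase ⟨i, hi⟩, ((Function.update runs ⟨i, hi⟩ r j).2 : ℕ)
              = ∑ j ∈ Finset.univ.erase ⟨i, hi⟩, ((runs j).2 : ℕ) :=
            Finset.sum_congr rfl fun j hj => by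
              rw [Function.update_of_ne (Finset.ne_of_mem_erase hj)]
          omega
        · simp only
          omega)
      (fun s W' c ⟨g1, _⟩ => by rw [collectStep, dif_neg (by omega)])
      F (k := F) (a := (clamp F 0, fun _ => (clamp A 0, clamp A 0), (p, q))) (W := W) (c := 0)
      ⟨by simp only [e0']; omega, le_rfl, hp, hst, Or.inr (by simp [e0']), le_rfl, by simp,
        fun _ _ => rfl, fun _ _ => rfl, fun j => by simp [e0], fun j => by
          simp only [e0]
          intro a b _ hb
          omega, by ext x; simp [e0, cellsUnion], fun j _ => e0, by simp [e0], by simp⟩ le_rfl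
    obtain ⟨i, runs, p₁, q₁⟩ := s
    simp only at g1 g2 g3 g4 g5 g6 g7 g8 g9 g10 g11 g12 g13 g14 g15
    have hl1 := hlin p p₁ N g2 g3
    obtain ⟨len, W', t, m1, m2, m3, m4, m5, m6, m7, m8⟩ := exec_merge (n := n) (B := B)
      (base := base) D W₁ hn hn0 hB runs (q := q₁) (by omega) g10 g11 (by omega)
    rw [g12] at m3 m6 m7
    have hwt := wt_cellsUnion_le V p (p₁ - p)
    have hlen : (len : ℕ) ≤ 3 * (p₁ - p) := by
      rcases Nat.eq_zero_or_pos ((p₁ : ℕ) - p) with h0 | h0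
      · rw [h0] at m7
        simpa [cellsUnion, h0] using m7
      · have h2 := m6.trans hwt
        have h3 : ((len : ℕ) - 1) * 32 ≤ (p₁ - p) * 40 := by
          refine Nat.le_of_mul_le_mul_right ?_ hB0
          rwa [Nat.mul_assoc, Nat.mul_assoc]
        omega
    have hd2 : 3 * (d + 1) * ((p₁ : ℕ) - p) = 3 * d * (p₁ - p) + 3 * (p₁ - p) := by ring
    have hd3 : (130 + 780 * (d + 1)) * ((p₁ : ℕ) - p)
        = (130 + 780 * d) * (p₁ - p) + 780 * (p₁ - p) := by ring
    have eq : ((clamp A (q₁ + len) : Fin (A + 1)) : ℕ) = q₁ + len := clamp_val (by omega)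
    refine ⟨(q₁, len), p₁, clamp A (q₁ + len), W', t₁ + t, ?_, g2, g3, g4, ?_, ?_, ?_, ?_, ?_, ?_, m2,
      m3, hlen, ?_⟩
    · exact h1.bind (f := fun s : CollectState A F =>
        (merge (n := n) base s.2.1 s.2.2.2).map fun len : Fin (A + 1) =>
          ((s.2.2.2, len), (s.2.2.1, clamp A (s.2.2.2 + len))))
        (Exec.map (fun len : Fin (A + 1) => ((q₁, len), (p₁, clamp A (q₁ + len)))) m1)
    · rcases g5 with h | h
      · exact Or.inl h
      · refine Or.inr ?_
        rw [pow_succ, mul_comm]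
        rwa [show (i : ℕ) = F by omega] at h
    · rw [eq]
      omega
    · rw [eq]
      omega
    · intro j hj
      rw [m4 j (by omega)]
      exact g8 j hj
    · intro b hb
      rw [m5 b hb]
      exact g9 b hb
    · rw [eq]
    · omega

theorem fits_scan {a : ℕ} (hA : A < 2 ^ a) (N : ℕ) :
    Fits (a + (a + (a + 1 + 65 * (B + 1) + 1)))
      fun p : Fin (A + 1) => scan n B base A p N := by
  have hcard : Fintype.card (Fin (A + 1) × Bool) ≤ 2 ^ (a + 1) := by
    rw [Fintype.card_prod, Fintype.card_bool, pow_succ]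
    exact Nat.mul_le_mul_right _ (card_fin_succ_le hA)
  refine Fits.of_forall (card_fin_succ_le hA) fun p => ?_
  have hstep : Fits (a + 1 + 65 * (B + 1) + 1) (scanStep n B base A p N) := by
    unfold scanStep
    refine Fits.ite _ ?_ ?_
    · exact Fits.of_forall hcard fun s => Fits.map (fits_readCell n base _) _
    · exact (Fits.ret hcard fun s => s).mono (by omega)
  have h := Fits.iter hcard hstep hA
  rw [max_eq_left (by omega)] at h
  exact Fits.map (h.fits₁ _) _

/-- The memory of the merge sort: `F` blocks, up to a factor that depends on `d`. -/
theorem fits_sort {a : ℕ} (hA : A < 2 ^ a) (hn : n ≤ A) (N d : ℕ) :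
    Fits (d * (F + (F + (2 * a * F + 2 * a)) + 2) +
        (a + (a + (a + (a + 1 + 65 * (B + 1) + 1)) + ((F + (2 * a * F + 2 * a)) +
          (a + (a + (a * 3 * F + ((F + 2) * (40 * B) + 1 + a) + (65 * (B + 2)) + 2)))))))
      (sort n B base A F N d) := by
  have hF : F < 2 ^ F := Nat.lt_two_pow_self
  have hc2 : Fintype.card (Fin (A + 1) × Fin (A + 1)) ≤ 2 ^ (2 * a) := by
    rw [Fintype.card_prod, two_mul, pow_add]
    exact Nat.mul_le_mul (card_fin_succ_le hA) (card_fin_succ_le hA)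
  have hcard : Fintype.card (CollectState A F) ≤ 2 ^ (F + (2 * a * F + 2 * a)) := by
    rw [Fintype.card_prod, Fintype.card_prod, Fintype.card_fun, pow_add, pow_add, pow_mul,
      Fintype.card_fin F]
    exact Nat.mul_le_mul (card_fin_succ_le hF) (Nat.mul_le_mul (Nat.pow_le_pow_left hc2 _) hc2)
  set x := F + (2 * a * F + 2 * a) with hx
  set y := a + (a + (a * 3 * F + ((F + 2) * (40 * B) + 1 + a) + (65 * (B + 2)) + 2)) with hy
  have hz : ∀ d, a + (a + (a + 1 + 65 * (B + 1) + 1)) ≤ d * (F + x + 2) +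
      (a + (a + (a + (a + 1 + 65 * (B + 1) + 1)) + (x + y))) := fun d => by omega
  have h2a : 2 * a + (a + (a + (a + 1 + 65 * (B + 1) + 1))) ≤ d * (F + x + 2) +
      (a + (a + (a + (a + 1 + 65 * (B + 1) + 1)) + (x + y))) := by omega
  induction d with
  | zero =>
    refine (Fits.of_forall hc2 fun s => ?_).mono h2a
    exact Fits.map ((fits_scan hA N).fits₁ s.1) _
  | succ d ih =>
    set m := d * (F + x + 2) + (a + (a + (a + (a + 1 + 65 * (B + 1) + 1)) + (x + y))) with hm
    have hstep : Fits (x + m) (collectStep (F := F) (sort n B base A F N d)) := by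
      refine Fits.of_forall hcard fun s => ?_
      by_cases h : (s.1 : ℕ) < F
      · have := Fits.map ((ih (by omega)).fits₁ s.2.2)
          fun r => (clamp F (s.1 + 1), Function.update s.2.1 ⟨s.1, h⟩ r.1, r.2)
        simp only [collectStep, dif_pos h]
        exact this
      · simp only [collectStep, dif_neg h]
        exact (Fits₁.ret s).mono (Nat.zero_le _)
    have hit := Fits.iter hcard hstep hF
    have hmerge : Fits (x + y) fun s : CollectState A F =>
        (merge (n := n) (B := B) base s.2.1 s.2.2.2).map fun len : Fin (A + 1) =>
          ((s.2.2.2, len), (s.2.2.1, clamp A (s.2.2.2 + len))) :=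
      Fits.of_forall hcard fun s =>
        Fits.map ((fits_merge (n := n) (B := B) (base := base) hA hn).fits₁ (s.2.1, s.2.2.2))
          fun len : Fin (A + 1) => ((s.2.2.2, len), (s.2.2.1, clamp A (s.2.2.2 + len)))
    refine (Fits.bind (hit.comp fun s => (clamp F 0, fun _ => (clamp A 0, clamp A 0), s))
      hmerge).mono ?_
    have : (d + 1) * (F + x + 2) = d * (F + x + 2) + (F + x + 2) := by ring
    omega

end Prog

end SecondaryIndex

namespace SecondaryIndex

/-! ### A hierarchy of partitions of the alphabet -/

section

variable (y : ℕ → ℕ) (n σ : ℕ)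

/-- The positions `p < n` with `c ≤ y p < d`. -/
def interval (c d : ℕ) : Finset ℕ := (Finset.range n).filter fun p => c ≤ y p ∧ y p < d

/-- The number of positions `p < n` with `y p < c`. -/
def below (c : ℕ) : ℕ := ((Finset.range n).filter fun p => y p < c).card

/-- The exponents `0, 1, 3, 7, …`; on level `j` of the hierarchy the range of `below` is cut
into `2 ^ expo j` parts. -/
def expo (j : ℕ) : ℕ := 2 ^ j - 1

/-- The part of `0, …, n` to which `t` belongs on level `j`. -/
def bucket (j t : ℕ) : ℕ := t * 2 ^ expo j / (n + 1)

/-- The boundaries of level `j`: the block of a character with large multiplicity consists of this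
character alone, and the other blocks are as long as the buckets permit. -/
def IsBoundary (j c : ℕ) : Prop :=
  c = 0 ∨ σ ≤ c ∨ ¬(bucket n j (below y n (c - 1)) = bucket n j (below y n c) ∧
    bucket n j (below y n c) = bucket n j (below y n (c + 1)))

instance (j c : ℕ) : Decidable (IsBoundary y n σ j c) := by
  unfold IsBoundary
  infer_instance

variable {n σ}

theorem mem_interval {c d p : ℕ} : p ∈ interval y n c d ↔ p < n ∧ c ≤ y p ∧ y p < d := by
  simp [interval]

theorem below_mono {c d : ℕ} (h : c ≤ d) : below y n c ≤ below y n d :=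
  Finset.card_le_card fun p hp => by
    rw [Finset.mem_filter] at hp ⊢
    exact ⟨hp.1, hp.2.trans_le h⟩

theorem below_le (c : ℕ) : below y n c ≤ n :=
  (Finset.card_filter_le _ _).trans (Finset.card_range n).le

theorem card_interval (c d : ℕ) : (interval y n c d).card = below y n d - below y n c := by
  rcases le_total c d with h | h
  · have h1 : interval y n c d
        = ((Finset.range n).filter fun p => y p < d) \ (Finset.range n).filter fun p => y p < c := by
      ext p
      simp only [mem_interval, Finset.mem_sdiff, Finset.mem_filter, Finset.mem_range]
      omega
    rw [h1, Finset.card_sdiff_of_subset]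
    · rfl
    · intro p hp
      rw [Finset.mem_filter] at hp ⊢
      exact ⟨hp.1, hp.2.trans_le h⟩
  · have h1 : interval y n c d = ∅ := by
      ext p
      simp only [mem_interval, Finset.notMem_empty, iff_false]
      omega
    rw [h1, Finset.card_empty, Nat.sub_eq_zero_of_le (below_mono y h)]

theorem expo_succ (j : ℕ) : expo (j + 1) = 2 * expo j + 1 := by
  have := Nat.one_le_two_pow (n := j)
  simp only [expo, pow_succ]
  omega

theorem expo_add_one (j : ℕ) : expo j + 1 = 2 ^ j := by
  have := Nat.one_le_two_pow (n := j)
  simp only [expo]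
  omega

theorem expo_zero : expo 0 = 0 := rfl

theorem le_expo (j : ℕ) : j ≤ expo j := by
  have := Nat.lt_two_pow_self (n := j)
  simp only [expo]
  omega

theorem bucket_mono (j : ℕ) {s t : ℕ} (h : s ≤ t) : bucket n j s ≤ bucket n j t :=
  Nat.div_le_div_right (Nat.mul_le_mul_right _ h)

theorem bucket_zero {t : ℕ} (h : t ≤ n) : bucket n 0 t = 0 := by
  simp only [bucket, expo_zero, pow_zero, mul_one]
  exact Nat.div_eq_of_lt (by omega)

theorem bucket_lt (j : ℕ) {t : ℕ} (h : t ≤ n) : bucket n j t < 2 ^ expo j := by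
  rw [bucket, Nat.div_lt_iff_lt_mul (by omega), mul_comm]
  exact Nat.mul_lt_mul_of_pos_left (by omega) (by positivity)

theorem bucket_eq_of_succ {j s t : ℕ} (h : bucket n (j + 1) s = bucket n (j + 1) t) :
    bucket n j s = bucket n j t := by
  have key : ∀ t, bucket n j t = bucket n (j + 1) t / 2 ^ 2 ^ j := by
    intro t
    have : expo (j + 1) = expo j + 2 ^ j := by rw [expo_succ, ← expo_add_one]; ring
    rw [bucket, bucket, this, pow_add, ← mul_assoc, Nat.div_div_eq_div_mul,
      Nat.mul_div_mul_right _ _ (by positivity)]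
  rw [key, key, h]

theorem sub_mul_le_of_bucket_eq {j s t : ℕ} (h : bucket n j s = bucket n j t) :
    (t - s) * 2 ^ expo j ≤ n := by
  have h1 := Nat.div_mul_le_self (s * 2 ^ expo j) (n + 1)
  have h2 := Nat.lt_div_mul_add (a := t * 2 ^ expo j) (b := n + 1) (by omega)
  unfold bucket at h
  rw [h] at h1
  rw [Nat.sub_mul]
  omega

theorem eq_of_bucket_eq {j s t : ℕ} (hj : n < 2 ^ expo j) (h : bucket n j s = bucket n j t) :
    s = t := by
  have key : ∀ {s t}, bucket n j s = bucket n j t → t ≤ s := by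
    intro s t h
    have h1 := sub_mul_le_of_bucket_eq h
    by_contra h2
    have h3 : 1 * 2 ^ expo j ≤ (t - s) * 2 ^ expo j := Nat.mul_le_mul_right _ (by omega)
    omega
  exact le_antisymm (key h.symm) (key h)

theorem isBoundary_zero (j : ℕ) : IsBoundary y n σ j 0 := Or.inl rfl

theorem isBoundary_of_le (j : ℕ) {c : ℕ} (h : σ ≤ c) : IsBoundary y n σ j c := Or.inr (Or.inl h)

theorem IsBoundary.succ {j c : ℕ} (h : IsBoundary y n σ j c) : IsBoundary y n σ (j + 1) c := by
  rcases h with h | h | h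
  · exact Or.inl h
  · exact Or.inr (Or.inl h)
  · exact Or.inr (Or.inr fun h' => h ⟨bucket_eq_of_succ h'.1, bucket_eq_of_succ h'.2⟩)

theorem IsBoundary.bucket_eq {j c : ℕ} (h : ¬ IsBoundary y n σ j c) :
    bucket n j (below y n (c - 1)) = bucket n j (below y n c) ∧
      bucket n j (below y n c) = bucket n j (below y n (c + 1)) := by
  unfold IsBoundary at h
  tauto

variable (n σ)

/-- The least boundary of level `j` from `c` on. -/
def nextB (j c : ℕ) : ℕ :=
  Nat.find (p := fun d => c ≤ d ∧ IsBoundary y n σ j d)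
    ⟨max c σ, le_max_left _ _, isBoundary_of_le y j (le_max_right _ _)⟩

/-- The greatest boundary of level `j` up to `c`. -/
def prevB (j c : ℕ) : ℕ := Nat.findGreatest (IsBoundary y n σ j) c

variable {n σ}

theorem le_nextB (j c : ℕ) : c ≤ nextB y n σ j c :=
  (Nat.find_spec (p := fun d => c ≤ d ∧ IsBoundary y n σ j d) _).1

theorem isBoundary_nextB (j c : ℕ) : IsBoundary y n σ j (nextB y n σ j c) :=
  (Nat.find_spec (p := fun d => c ≤ d ∧ IsBoundary y n σ j d) _).2

theorem nextB_le {j c d : ℕ} (h : c ≤ d) (hd : IsBoundary y n σ j d) : nextB y n σ j c ≤ d :=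
  Nat.find_min' _ ⟨h, hd⟩

theorem not_isBoundary_of_lt_nextB {j c d : ℕ} (h : c ≤ d) (hd : d < nextB y n σ j c) :
    ¬ IsBoundary y n σ j d := fun h' => absurd (nextB_le y h h') (by omega)

theorem nextB_le_of_le {j c : ℕ} (h : c ≤ σ) : nextB y n σ j c ≤ σ :=
  nextB_le y h (isBoundary_of_le y j le_rfl)

theorem prevB_le (j c : ℕ) : prevB y n σ j c ≤ c := Nat.findGreatest_le c

theorem isBoundary_prevB (j c : ℕ) : IsBoundary y n σ j (prevB y n σ j c) :=
  Nat.findGreatest_spec (P := IsBoundary y n σ j) (Nat.zero_le c) (isBoundary_zero y j)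

theorem le_prevB {j c d : ℕ} (h : d ≤ c) (hd : IsBoundary y n σ j d) : d ≤ prevB y n σ j c :=
  Nat.le_findGreatest h hd

theorem not_isBoundary_of_prevB_lt {j c d : ℕ} (h : d ≤ c) (hd : prevB y n σ j c < d) :
    ¬ IsBoundary y n σ j d := fun h' => absurd (le_prevB y h h') (by omega)

theorem nextB_succ_le (j c : ℕ) : nextB y n σ (j + 1) c ≤ nextB y n σ j c :=
  nextB_le y (le_nextB y j c) (isBoundary_nextB y j c).succ

theorem prevB_le_succ (j c : ℕ) : prevB y n σ j c ≤ prevB y n σ (j + 1) c :=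
  le_prevB y (prevB_le y j c) (isBoundary_prevB y j c).succ

/-- There are `O(2 ^ expo j)` boundaries on level `j`: apart from `0`, each of them is next to a
character at which the bucket changes. -/
theorem card_isBoundary_le (j : ℕ) :
    ((Finset.range σ).filter fun c => IsBoundary y n σ j c).card ≤ 3 * 2 ^ expo j := by
  set g : ℕ → ℕ := fun c => bucket n j (below y n c) with hg
  have gm : ∀ {c d}, c ≤ d → g c ≤ g d := fun h => bucket_mono j (below_mono y h)
  set X := (Finset.range σ).filter fun c => g c ≠ g (c + 1) with hX
  have hcard : X.card ≤ 2 ^ expo j := by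
    rw [← Finset.card_range (2 ^ expo j)]
    refine Finset.card_le_card_of_injOn g (fun c _ => ?_) ?_
    · exact Finset.mem_coe.2 (Finset.mem_range.2 (bucket_lt j (below_le y c)))
    · have key : ∀ c d, c ∈ X → c < d → g c ≠ g d := by
        intro c d hc h
        have h1 := gm (show c + 1 ≤ d from h)
        have h2 := gm (Nat.le_succ c)
        have h3 := (Finset.mem_filter.1 hc).2
        simp only [Nat.succ_eq_add_one] at h2
        omega
      intro c hc d hd h
      rcases Nat.lt_trichotomy c d with h' | h' | h'
      · exact absurd h (key c d hc h')
      · exact h'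
      · exact absurd h.symm (key d c hd h')
  have hsub : ((Finset.range σ).filter fun c => IsBoundary y n σ j c)
      ⊆ {0} ∪ (X ∪ X.image (· + 1)) := by
    intro c hc
    rw [Finset.mem_filter, Finset.mem_range] at hc
    simp only [Finset.mem_union, Finset.mem_singleton, Finset.mem_image]
    obtain ⟨hc, h | h | h⟩ := hc
    · exact Or.inl h
    · omega
    · rcases Nat.eq_zero_or_pos c with h0 | h0
      · exact Or.inl h0
      · refine Or.inr ?_
        by_cases h1 : g c = g (c + 1)
        · refine Or.inr ⟨c - 1, Finset.mem_filter.2 ⟨Finset.mem_range.2 (by omega), fun h2 => h ?_⟩,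
            by omega⟩
          rw [show c - 1 + 1 = c by omega] at h2
          exact ⟨h2, h1⟩
        · exact Or.inl (Finset.mem_filter.2 ⟨Finset.mem_range.2 hc, h1⟩)
  have h1 := Finset.card_le_card hsub
  have h2 := Finset.card_union_le {0} (X ∪ X.image (· + 1))
  have h3 := Finset.card_union_le X (X.image (· + 1))
  have h4 := Finset.card_image_le (s := X) (f := (· + 1))
  have h5 := Nat.one_le_two_pow (n := expo j)
  rw [Finset.card_singleton] at h2
  omega

/-! ### The stored blocks -/

variable (n σ)

/-- The block of level `j` that begins with the character `c`. It is left empty if `c` is no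
boundary, or if the character `c` is a block on the level above already. -/
def piece (j c : ℕ) : Finset ℕ :=
  if IsBoundary y n σ j c ∧
      bucket n (j - 1) (below y n c) = bucket n (j - 1) (below y n (c + 1)) then
    interval y n c (nextB y n σ j (c + 1))
  else ∅

variable {n σ}

theorem piece_subset {j c p : ℕ} (hp : p ∈ piece y n σ j c) :
    IsBoundary y n σ j c ∧ bucket n (j - 1) (below y n c) = bucket n (j - 1) (below y n (c + 1)) ∧
      p < n ∧ c ≤ y p ∧ y p < nextB y n σ j (c + 1) := by
  unfold piece at hp
  split_ifs at hp with h
  · exact ⟨h.1, h.2, (mem_interval y).1 hp⟩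
  · simp at hp

theorem lt_of_mem_piece {j c p : ℕ} (hp : p ∈ piece y n σ j c) : p < n :=
  (piece_subset y hp).2.2.1

theorem piece_disjoint {j c d : ℕ} (h : c ≠ d) :
    Disjoint (piece y n σ j c) (piece y n σ j d) := by
  rw [Finset.disjoint_left]
  intro p hc hd
  obtain ⟨h1, -, -, h2, h3⟩ := piece_subset y hc
  obtain ⟨h4, -, -, h5, h6⟩ := piece_subset y hd
  rcases Nat.lt_or_ge c d with h' | h'
  · have := nextB_le y (show c + 1 ≤ d from h') h4
    omega
  · have := nextB_le y (show d + 1 ≤ c by omega) h1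
    omega

theorem sum_card_piece_le {j u v : ℕ} (hv : IsBoundary y n σ j v) :
    ∑ c ∈ Finset.Ico u v, (piece y n σ j c).card ≤ below y n v - below y n u := by
  rw [← card_interval, ← Finset.card_biUnion fun c _ d _ h => piece_disjoint y h]
  refine Finset.card_le_card fun p hp => ?_
  obtain ⟨c, hc, hp⟩ := Finset.mem_biUnion.1 hp
  rw [Finset.mem_Ico] at hc
  obtain ⟨h1, -, h0, h2, h3⟩ := piece_subset y hp
  have := nextB_le y (show c + 1 ≤ v from hc.2) hv
  exact (mem_interval y).2 ⟨h0, by omega, by omega⟩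

/-- The blocks of level `j + 1` between two boundaries, if none of them is left out. -/
theorem mem_piece_iff {j u v : ℕ} (hu : IsBoundary y n σ (j + 1) u)
    (hv : IsBoundary y n σ (j + 1) v) (huv : ∀ c, u ≤ c → c < v → IsBoundary y n σ j c →
      bucket n j (below y n c) = bucket n j (below y n (c + 1))) (p : ℕ) :
    (∃ c, u ≤ c ∧ c < v ∧ p ∈ piece y n σ (j + 1) c) ↔ p < n ∧ u ≤ y p ∧ y p < v := by
  constructor
  · rintro ⟨c, h1, h2, h3⟩
    obtain ⟨-, -, h4, h5, h6⟩ := piece_subset y h3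
    have := nextB_le y (show c + 1 ≤ v from h2) hv
    exact ⟨h4, by omega, by omega⟩
  · rintro ⟨h1, h2, h3⟩
    have h4 := le_prevB y h2 hu
    have h5 := prevB_le y (n := n) (σ := σ) (j + 1) (y p)
    have h6 := isBoundary_prevB y (n := n) (σ := σ) (j + 1) (y p)
    refine ⟨prevB y n σ (j + 1) (y p), h4, by omega, ?_⟩
    have h7 : bucket n j (below y n (prevB y n σ (j + 1) (y p)))
        = bucket n j (below y n (prevB y n σ (j + 1) (y p) + 1)) := by
      by_cases hb : IsBoundary y n σ j (prevB y n σ (j + 1) (y p))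
      · exact huv _ h4 (by omega) hb
      · exact (IsBoundary.bucket_eq y hb).2
    rw [piece, if_pos ⟨h6, h7⟩, mem_interval]
    refine ⟨h1, h5, ?_⟩
    by_contra h8
    exact not_isBoundary_of_prevB_lt y (not_lt.1 h8)
      (by have := le_nextB y (n := n) (σ := σ) (j + 1) (prevB y n σ (j + 1) (y p) + 1); omega)
      (isBoundary_nextB y _ _)

/-! ### Decomposition of a range into stored blocks -/

variable (n σ)

/-- The two groups of blocks of level `j + 1` that are used for the range of characters
`l ≤ c < e`: those to the left and those to the right of the blocks of level `j`. -/
def segment (l e j : ℕ) (right : Bool) : ℕ × ℕ :=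
  if right then
    (max (prevB y n σ j e) (nextB y n σ j l), prevB y n σ (j + 1) e)
  else (nextB y n σ (j + 1) l, min (nextB y n σ j l) (prevB y n σ (j + 1) e))

variable {n σ}

theorem isBoundary_segment (l e j : ℕ) (right : Bool) :
    IsBoundary y n σ (j + 1) (segment y n σ l e j right).1 ∧
      IsBoundary y n σ (j + 1) (segment y n σ l e j right).2 := by
  cases right
  · refine ⟨isBoundary_nextB y _ _, ?_⟩
    rcases min_choice (nextB y n σ j l) (prevB y n σ (j + 1) e) with h | h
    · simp only [segment, Bool.false_eq_true, if_false, h]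
      exact (isBoundary_nextB y _ _).succ
    · simp only [segment, Bool.false_eq_true, if_false, h]
      exact isBoundary_prevB y _ _
  · refine ⟨?_, isBoundary_prevB y _ _⟩
    rcases max_choice (prevB y n σ j e) (nextB y n σ j l) with h | h
    · simp only [segment, if_true, h]
      exact (isBoundary_prevB y _ _).succ
    · simp only [segment, if_true, h]
      exact (isBoundary_nextB y _ _).succ

theorem segment_snd_le {l e j : ℕ} (he : e ≤ σ) (right : Bool) :
    (segment y n σ l e j right).2 ≤ σ := by
  have := prevB_le y (n := n) (σ := σ) (j + 1) e
  cases right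
  · exact (min_le_right _ _).trans (this.trans he)
  · exact this.trans he

theorem segment_fst_le {l e j : ℕ} (hl : l ≤ σ) (he : e ≤ σ) (right : Bool) :
    (segment y n σ l e j right).1 ≤ σ := by
  cases right
  · exact nextB_le_of_le y hl
  · exact max_le ((prevB_le y j e).trans he) (nextB_le_of_le y hl)

theorem mem_segment_iff (l e j : ℕ) (right : Bool) (p : ℕ) :
    (∃ c, (segment y n σ l e j right).1 ≤ c ∧ c < (segment y n σ l e j right).2 ∧
        p ∈ piece y n σ (j + 1) c) ↔
      p < n ∧ (segment y n σ l e j right).1 ≤ y p ∧ y p < (segment y n σ l e j right).2 := by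
  refine mem_piece_iff y (isBoundary_segment y l e j right).1 (isBoundary_segment y l e j right).2
    (fun c h1 h2 hc => ?_) p
  cases right
  · simp only [segment, Bool.false_eq_true, if_false] at h1 h2
    have h3 := le_nextB y (n := n) (σ := σ) (j + 1) l
    exact absurd hc (not_isBoundary_of_lt_nextB y (h3.trans h1) (h2.trans_le (min_le_left _ _)))
  · simp only [segment, if_true] at h1 h2
    by_contra h3
    have h4 := prevB_le y (n := n) (σ := σ) (j + 1) e
    -- If the bucket changes at `c`, then `c + 1` is a boundary to the right of the last one.
    refine not_isBoundary_of_prevB_lt y (show c + 1 ≤ e by omega)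
      (show prevB y n σ j e < c + 1 from Nat.lt_succ_of_le ((le_max_left _ _).trans h1))
      (Or.inr (Or.inr fun h5 => h3 h5.1))

/-- The blocks of the first `J` levels make up the part of the range between the boundaries of level
`J`. On level `0` there are no boundaries inside the alphabet. -/
theorem mem_segments_iff {l e : ℕ} (hle : 0 < l ∨ e < σ) (he : e ≤ σ) (J p : ℕ) :
    (∃ j < J, ∃ right, p < n ∧ (segment y n σ l e j right).1 ≤ y p ∧
      y p < (segment y n σ l e j right).2) ↔
      p < n ∧ nextB y n σ J l ≤ y p ∧ y p < prevB y n σ J e := by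
  induction J with
  | zero =>
    have hb : ∀ c, IsBoundary y n σ 0 c → c = 0 ∨ σ ≤ c := by
      intro c hc
      rcases hc with hc | hc | hc
      · exact Or.inl hc
      · exact Or.inr hc
      · exact absurd (by simp only [bucket_zero (below_le y _), and_self]) hc
    have h1 := hb _ (isBoundary_nextB y 0 l)
    have h2 := hb _ (isBoundary_prevB y 0 e)
    have h3 := le_nextB y (n := n) (σ := σ) 0 l
    have h4 := prevB_le y (n := n) (σ := σ) 0 e
    constructor
    · rintro ⟨j, hj, -⟩
      omega
    · rintro ⟨h5, h6, h7⟩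
      rcases hle with h | h
      · have h8 : σ ≤ nextB y n σ 0 l := by omega
        have h9 : σ ≤ prevB y n σ 0 e := by omega
        omega
      · omega
  | succ J ih =>
    have h1 := nextB_succ_le y (n := n) (σ := σ) J l
    have h2 := prevB_le_succ y (n := n) (σ := σ) J e
    have h3 : (∃ j < J + 1, ∃ right, p < n ∧ (segment y n σ l e j right).1 ≤ y p ∧
        y p < (segment y n σ l e j right).2) ↔
        (∃ j < J, ∃ right, p < n ∧ (segment y n σ l e j right).1 ≤ y p ∧
          y p < (segment y n σ l e j right).2) ∨
        ∃ right, p < n ∧ (segment y n σ l e J right).1 ≤ y p ∧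
          y p < (segment y n σ l e J right).2 := by
      constructor
      · rintro ⟨j, hj, h⟩
        rcases Nat.lt_succ_iff_lt_or_eq.1 hj with hj | rfl
        · exact Or.inl ⟨j, hj, h⟩
        · exact Or.inr h
      · rintro (⟨j, hj, h⟩ | h)
        · exact ⟨j, by omega, h⟩
        · exact ⟨J, by omega, h⟩
    rw [h3, ih]
    simp only [Bool.exists_bool, segment, Bool.false_eq_true, if_false, if_true]
    omega

/-- Nothing is missing if the buckets of level `J` are singletons. -/
theorem mem_segments_iff_of_lt {l e J : ℕ} (hle : 0 < l ∨ e < σ) (he : e ≤ σ)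
    (hJ : n < 2 ^ expo J) (p : ℕ) :
    (∃ j < J, ∃ right, ∃ c, (segment y n σ l e j right).1 ≤ c ∧
      c < (segment y n σ l e j right).2 ∧ p ∈ piece y n σ (j + 1) c) ↔
      p < n ∧ l ≤ y p ∧ y p < e := by
  simp only [mem_segment_iff]
  rw [mem_segments_iff y hle he]
  have hb : ∀ c, bucket n J (below y n c) = bucket n J (below y n (c + 1)) → p < n → y p ≠ c := by
    intro c hc hp h
    have h1 := eq_of_bucket_eq hJ hc
    have h2 := card_interval y (n := n) c (c + 1)
    rw [← h1, Nat.sub_self, Finset.card_eq_zero] at h2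
    have h3 : p ∈ interval y n c (c + 1) := (mem_interval y).2 ⟨hp, by omega, by omega⟩
    simp [h2] at h3
  have h1 := le_nextB y (n := n) (σ := σ) J l
  have h2 := prevB_le y (n := n) (σ := σ) J e
  constructor
  · rintro ⟨h3, h4, h5⟩
    exact ⟨h3, by omega, by omega⟩
  · rintro ⟨h3, h4, h5⟩
    refine ⟨h3, ?_, ?_⟩
    · by_contra h6
      exact hb _ (IsBoundary.bucket_eq y (not_isBoundary_of_lt_nextB y h4 (not_le.1 h6))).2 h3 rfl
    · by_contra h6
      have := (IsBoundary.bucket_eq y (not_isBoundary_of_prevB_lt y (show y p + 1 ≤ e from h5)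
        (show prevB y n σ J e < y p + 1 by omega))).1
      rw [Nat.add_sub_cancel] at this
      exact hb _ this h3 rfl

end

end SecondaryIndex

namespace SecondaryIndex

/-! ### The sizes of the stored blocks -/

theorem sum_div_two_pow_le (m J : ℕ) : ∑ j ∈ Finset.range J, m / 2 ^ (j + 1) ≤ m := by
  have h : ∑ j ∈ Finset.range J, m / 2 ^ (j + 1) + m / 2 ^ J ≤ m := by
    induction J with
    | zero => simp
    | succ J ih =>
      rw [Finset.sum_range_succ]
      have : m / 2 ^ (J + 1) = m / 2 ^ J / 2 := by rw [pow_succ, Nat.div_div_eq_div_mul]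
      omega
  exact (Nat.le_add_right _ _).trans h

theorem sum_two_pow_filter_le (J x : ℕ) :
    ∑ j ∈ (Finset.range J).filter (fun j => 2 ^ j ≤ x), 2 ^ j ≤ 2 * x := by
  rcases Nat.eq_zero_or_pos x with rfl | hx
  · rw [Finset.sum_eq_zero]
    · simp
    · intro j hj
      exact absurd (Finset.mem_filter.1 hj).2 (not_le.2 (by positivity))
  · have hsub : (Finset.range J).filter (fun j => 2 ^ j ≤ x) ⊆ Finset.range (Nat.log 2 x + 1) := by
      intro j hj
      rw [Finset.mem_range, Nat.lt_succ_iff]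
      exact Nat.le_log_of_pow_le (by norm_num) (Finset.mem_filter.1 hj).2
    have h1 := Finset.sum_le_sum_of_subset (f := fun j => 2 ^ j) hsub
    have h2 := Nat.geomSum_eq (m := 2) le_rfl (Nat.log 2 x + 1)
    have h3 := Nat.pow_log_le_self 2 (x := x) (by omega)
    have h4 : 2 ^ (Nat.log 2 x + 1) = 2 * 2 ^ Nat.log 2 x := by ring
    simp only [Nat.add_one_sub_one, Nat.div_one] at h2
    omega

theorem two_pow_mul_div_le (e n : ℕ) : 2 ^ e * (n / 2 ^ (2 * e + 1)) ≤ n / 2 ^ (e + 1) := by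
  rw [Nat.le_div_iff_mul_le (by positivity)]
  calc 2 ^ e * (n / 2 ^ (2 * e + 1)) * 2 ^ (e + 1)
      = n / 2 ^ (2 * e + 1) * 2 ^ (2 * e + 1) := by ring
    _ ≤ n := Nat.div_mul_le_self _ _

section

variable (y : ℕ → ℕ) {n σ : ℕ}

theorem sum_wt_piece_le {X : Finset ℕ} (hX : ∀ c ∈ X, c < σ) (j s : ℕ) :
    ∑ c ∈ X, wt (piece y n σ j c) ≤
      2 * ((∑ c ∈ X, (piece y n σ j c).card) * s + 3 * 2 ^ expo j * (n / 2 ^ s)) := by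
  have h1 : ∀ c ∈ X, wt (piece y n σ j c) ≤
      2 * ((piece y n σ j c).card * s + if IsBoundary y n σ j c then n / 2 ^ s else 0) := by
    intro c _
    by_cases h : IsBoundary y n σ j c
    · rw [if_pos h]
      exact wt_le (fun p hp => lt_of_mem_piece y hp) s
    · rw [piece, if_neg fun h' => h h'.1]
      simp [wt_empty]
  refine (Finset.sum_le_sum h1).trans ?_
  rw [← Finset.mul_sum, Finset.sum_add_distrib, ← Finset.sum_mul, ← Finset.sum_filter,
    Finset.sum_const, smul_eq_mul]
  have h2 : (X.filter fun c => IsBoundary y n σ j c).card ≤ 3 * 2 ^ expo j := by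
    refine (Finset.card_le_card fun c hc => ?_).trans (card_isBoundary_le y (n := n) (σ := σ) j)
    rw [Finset.mem_filter] at hc ⊢
    exact ⟨Finset.mem_range.2 (hX c hc.1), hc.2⟩
  have h3 := Nat.mul_le_mul_right (n / 2 ^ s) h2
  omega

/-- The number of occurrences of the character at position `p`. -/
def mult (n p : ℕ) : ℕ := below y n (y p + 1) - below y n (y p)

theorem sum_card_piece_le_card (j : ℕ) :
    ∑ c ∈ Finset.range σ, (piece y n σ (j + 1) c).card ≤
      ((Finset.range n).filter fun p => mult y n p * 2 ^ expo j ≤ n).card := by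
  rw [← Finset.card_biUnion fun c _ d _ h => piece_disjoint y h]
  refine Finset.card_le_card fun p hp => ?_
  obtain ⟨c, -, hp⟩ := Finset.mem_biUnion.1 hp
  obtain ⟨-, h1, h2, h3, h4⟩ := piece_subset y hp
  rw [Finset.mem_filter, Finset.mem_range]
  refine ⟨h2, sub_mul_le_of_bucket_eq ?_⟩
  rcases h3.eq_or_lt with h | h
  · rw [← h]
    exact h1
  · exact bucket_eq_of_succ
      (IsBoundary.bucket_eq y (not_isBoundary_of_lt_nextB y (show c + 1 ≤ y p from h) h4)).2

/-- All blocks together have weight `O(n H₀ + n)`: a position whose character occurs `m` times is in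
blocks of the levels `j + 1` with `m * 2 ^ expo j ≤ n` only, on each of which it has a share of
about `expo (j + 1)`, and these numbers form a geometric progression. -/
theorem sum_wt_le (J : ℕ) :
    ∑ j ∈ Finset.range J, ∑ c ∈ Finset.range σ, wt (piece y n σ (j + 1) c) ≤
      16 * ∑ p ∈ Finset.range n, (Nat.log 2 (n / mult y n p) + 1) + 6 * n := by
  have h1 : ∀ j ∈ Finset.range J, ∑ c ∈ Finset.range σ, wt (piece y n σ (j + 1) c) ≤
      8 * (∑ p ∈ Finset.range n, if mult y n p * 2 ^ expo j ≤ n then 2 ^ j else 0)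
        + 6 * (n / 2 ^ (j + 1)) := by
    intro j _
    refine (sum_wt_piece_le y (fun c hc => Finset.mem_range.1 hc) (j + 1) (expo (j + 2))).trans ?_
    have h2 := sum_card_piece_le_card y (n := n) (σ := σ) j
    have h3 : expo (j + 2) ≤ 4 * 2 ^ j := by
      have := expo_add_one (j + 2)
      rw [pow_add] at this
      omega
    have h4 := Nat.mul_le_mul h2 h3
    have h5 := two_pow_mul_div_le (expo (j + 1)) n
    rw [← expo_succ, show j + 1 + 1 = j + 2 from rfl] at h5
    have h6 : n / 2 ^ (expo (j + 1) + 1) ≤ n / 2 ^ (j + 1) :=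
      Nat.div_le_div_left (Nat.pow_le_pow_right (by norm_num)
        ((le_expo (j + 1)).trans (Nat.le_succ _))) (by positivity)
    have h7 : (∑ p ∈ Finset.range n, if mult y n p * 2 ^ expo j ≤ n then 2 ^ j else 0)
        = ((Finset.range n).filter fun p => mult y n p * 2 ^ expo j ≤ n).card * 2 ^ j := by
      rw [← Finset.sum_filter, Finset.sum_const, smul_eq_mul]
    rw [h7, mul_assoc 3]
    set N := ((Finset.range n).filter fun p => mult y n p * 2 ^ expo j ≤ n).card
    have h8 : N * (4 * 2 ^ j) = 4 * (N * 2 ^ j) := by ring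
    omega
  refine (Finset.sum_le_sum h1).trans ?_
  rw [Finset.sum_add_distrib, ← Finset.mul_sum, ← Finset.mul_sum, Finset.sum_comm]
  have h2 := sum_div_two_pow_le n J
  have h3 : ∑ p ∈ Finset.range n, ∑ j ∈ Finset.range J,
      (if mult y n p * 2 ^ expo j ≤ n then 2 ^ j else 0) ≤
      ∑ p ∈ Finset.range n, 2 * (Nat.log 2 (n / mult y n p) + 1) := by
    refine Finset.sum_le_sum fun p hp => ?_
    have hpos : 0 < mult y n p := by
      rw [mult, ← card_interval]
      exact Finset.card_pos.2 ⟨p, (mem_interval y).2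
        ⟨Finset.mem_range.1 hp, le_rfl, Nat.lt_succ_self _⟩⟩
    refine le_trans ?_ (sum_two_pow_filter_le J (Nat.log 2 (n / mult y n p) + 1))
    rw [Finset.sum_filter]
    refine Finset.sum_le_sum fun j _ => ?_
    split_ifs with h4 h5
    · exact le_rfl
    · refine absurd ?_ h5
      rw [← expo_add_one]
      refine Nat.succ_le_succ (Nat.le_log_of_pow_le (by norm_num) ?_)
      rwa [Nat.le_div_iff_mul_le hpos, mul_comm]
    · exact Nat.zero_le _
    · exact le_rfl
  rw [← Finset.mul_sum] at h3
  omega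

/-! ### The sizes of the blocks that are read by a query -/

variable (n σ)

/-- The number of positions in one of the groups of blocks. -/
def segmentCard (l e j : ℕ) (right : Bool) : ℕ :=
  below y n (segment y n σ l e j right).2 - below y n (segment y n σ l e j right).1

/-- The total weight of one of the groups of blocks. -/
def segmentWt (l e j : ℕ) (right : Bool) : ℕ :=
  ∑ c ∈ Finset.Ico (segment y n σ l e j right).1 (segment y n σ l e j right).2,
    wt (piece y n σ (j + 1) c)

variable {n σ}

theorem sum_segmentCard_le (l e J : ℕ) :
    ∑ j ∈ Finset.range J, ∑ right, segmentCard y n σ l e j right ≤ below y n e - below y n l := by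
  have key : ∑ j ∈ Finset.range J, ∑ right, segmentCard y n σ l e j right ≤
      below y n (prevB y n σ J e) - below y n (nextB y n σ J l) := by
    induction J with
    | zero => simp
    | succ J ih =>
      rw [Finset.sum_range_succ]
      have h1 := nextB_succ_le y (n := n) (σ := σ) J l
      have h2 := prevB_le_succ y (n := n) (σ := σ) J e
      simp only [Fintype.sum_bool, segmentCard, segment, if_true, Bool.false_eq_true, if_false]
      simp only [Fintype.sum_bool, segmentCard, segment, if_true, Bool.false_eq_true, if_false] at ih
      set a := nextB y n σ (J + 1) l
      set a' := nextB y n σ J l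
      set b := prevB y n σ (J + 1) e
      set b' := prevB y n σ J e
      have m1 := below_mono y (n := n) h1
      have m2 := below_mono y (n := n) h2
      rcases le_total a' b with h3 | h3
      · rw [min_eq_left h3]
        have m3 := below_mono y (n := n) h3
        rcases le_total a' b' with h4 | h4
        · rw [max_eq_left h4]
          have m4 := below_mono y (n := n) h4
          omega
        · rw [max_eq_right h4]
          have m4 := below_mono y (n := n) h4
          omega
      · rw [min_eq_right h3, max_eq_right (h2.trans h3)]
        have m3 := below_mono y (n := n) h3
        omega
  have h1 := below_mono y (n := n) (le_nextB y (n := n) (σ := σ) J l)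
  have h2 := below_mono y (n := n) (prevB_le y (n := n) (σ := σ) J e)
  omega

/-- There is no boundary of level `j` in a group of blocks of level `j + 1`. -/
theorem segmentCard_mul_le (l e j : ℕ) (right : Bool) :
    segmentCard y n σ l e j right * 2 ^ expo j ≤ n := by
  have key : ∀ u v, (∀ c, u ≤ c → c < v →
      bucket n j (below y n c) = bucket n j (below y n (c + 1))) →
      (below y n v - below y n u) * 2 ^ expo j ≤ n := by
    intro u v h
    rcases le_total v u with huv | huv
    · rw [Nat.sub_eq_zero_of_le (below_mono y huv), zero_mul]
      exact Nat.zero_le n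
    · refine sub_mul_le_of_bucket_eq ?_
      induction v, huv using Nat.le_induction with
      | base => rfl
      | succ v huv ih =>
        rw [ih fun c h1 h2 => h c h1 (by omega), h v huv (by omega)]
  unfold segmentCard
  cases right
  · refine key _ _ fun c h1 h2 => ?_
    simp only [segment, Bool.false_eq_true, if_false] at h1 h2
    have h3 := le_nextB y (n := n) (σ := σ) (j + 1) l
    exact (IsBoundary.bucket_eq y
      (not_isBoundary_of_lt_nextB y (h3.trans h1) (h2.trans_le (min_le_left _ _)))).2
  · refine key _ _ fun c h1 h2 => ?_
    simp only [segment, if_true] at h1 h2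
    have h3 := prevB_le y (n := n) (σ := σ) (j + 1) e
    have h4 := (IsBoundary.bucket_eq y (not_isBoundary_of_prevB_lt y (show c + 1 ≤ e by omega)
      (show prevB y n σ j e < c + 1 from Nat.lt_succ_of_le ((le_max_left _ _).trans h1)))).1
    rwa [Nat.add_sub_cancel] at h4

theorem segmentWt_le {l e j : ℕ} (he : e ≤ σ) (right : Bool) (s : ℕ) :
    segmentWt y n σ l e j right ≤
      2 * (segmentCard y n σ l e j right * s + 3 * 2 ^ expo (j + 1) * (n / 2 ^ s)) := by
  refine (sum_wt_piece_le y (fun c hc => ?_) (j + 1) s).trans ?_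
  · exact (Finset.mem_Ico.1 hc).2.trans_le (segment_snd_le y he right)
  · have := sum_card_piece_le y (u := (segment y n σ l e j right).1)
      (isBoundary_segment y (n := n) (σ := σ) l e j right).2
    exact Nat.mul_le_mul_left _ (Nat.add_le_add_right (Nat.mul_le_mul_right _ this) _)

theorem sum_two_pow_expo_le (i : ℕ) :
    ∑ j ∈ Finset.range i, 2 ^ expo (j + 1) ≤ 2 * 2 ^ expo i := by
  induction i with
  | zero => simp
  | succ i ih =>
    rw [Finset.sum_range_succ, expo_succ]
    have : 2 ^ expo i ≤ 2 ^ (2 * expo i) := Nat.pow_le_pow_right (by norm_num) (by omega)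
    rw [pow_succ]
    omega

/-- On the levels up to `i`, where `n / 2 ^ expo i ≤ k`, each position is charged about
`lg (n / k)` bits, and the number of blocks is small. -/
theorem sum_segmentWt_low_le {l e k i : ℕ} (he : e ≤ σ) (hk : below y n e - below y n l ≤ k)
    (hi : n ≤ k * 2 ^ expo i) :
    ∑ j ∈ Finset.range i, ∑ right, segmentWt y n σ l e j right ≤ 4 * (k * 2 ^ i) + 12 * k := by
  have h1 : ∀ j ∈ Finset.range i, ∑ right, segmentWt y n σ l e j right ≤
      2 * expo (i + 1) * ∑ right, segmentCard y n σ l e j right +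
        12 * (n / 2 ^ expo (i + 1)) * 2 ^ expo (j + 1) := by
    intro j _
    rw [Finset.mul_sum]
    simp only [Fintype.sum_bool]
    have h2 := segmentWt_le y (n := n) (l := l) (j := j) he true (expo (i + 1))
    have h3 := segmentWt_le y (n := n) (l := l) (j := j) he false (expo (i + 1))
    nlinarith
  refine (Finset.sum_le_sum h1).trans ?_
  rw [Finset.sum_add_distrib, ← Finset.mul_sum, ← Finset.mul_sum]
  have h2 := (sum_segmentCard_le y (n := n) (σ := σ) l e i).trans hk
  have h3 := sum_two_pow_expo_le i
  have h4 : expo (i + 1) ≤ 2 * 2 ^ i := by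
    have := expo_add_one (i + 1)
    rw [pow_succ] at this
    omega
  have h5 : n / 2 ^ expo (i + 1) * (2 * 2 ^ expo i) ≤ k := by
    have h6 := two_pow_mul_div_le (expo i) n
    rw [← expo_succ] at h6
    have h7 : n / 2 ^ (expo i + 1) = n / 2 ^ expo i / 2 := by
      rw [pow_succ, Nat.div_div_eq_div_mul]
    have h8 : n / 2 ^ expo i ≤ k := by
      rw [Nat.div_le_iff_le_mul (by positivity)]
      have := Nat.one_le_two_pow (n := expo i)
      omega
    have h9 : n / 2 ^ expo (i + 1) * (2 * 2 ^ expo i)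
        = 2 * (2 ^ expo i * (n / 2 ^ expo (i + 1))) := by ring
    omega
  have h6 := Nat.mul_le_mul (Nat.mul_le_mul_left 2 h4) h2
  have h7 := Nat.mul_le_mul_left (12 * (n / 2 ^ expo (i + 1))) h3
  nlinarith

theorem expo_add (i t : ℕ) : expo (i + t) = expo i + 2 ^ i * (2 ^ t - 1) := by
  have h1 := expo_add_one (i + t)
  have h2 := expo_add_one i
  have h3 := Nat.one_le_two_pow (n := t)
  have h4 := Nat.one_le_two_pow (n := i)
  rw [pow_add] at h1
  have h5 : 2 ^ i * (2 ^ t - 1) + 2 ^ i = 2 ^ i * 2 ^ t := by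
    rw [← Nat.mul_succ]
    congr 1
    omega
  omega

/-- On the levels from `i` on there are few positions: their number is divided by more than `2 ^ t`
on level `i + t`. -/
theorem sum_segmentWt_high_le {l e k i : ℕ} (he : e ≤ σ) (hi0 : 1 ≤ i) (hi : n ≤ k * 2 ^ expo i)
    (J : ℕ) :
    ∑ t ∈ Finset.range J, ∑ right, segmentWt y n σ l e (i + t) right ≤
      128 * (k * 2 ^ i) + 12 * k := by
  have h8 : n / 2 ^ expo i ≤ k := by
    rw [Nat.div_le_iff_le_mul (by positivity)]
    have := Nat.one_le_two_pow (n := expo i)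
    omega
  have hside : ∀ t right, segmentWt y n σ l e (i + t) right ≤
      8 * 2 ^ i * (8 * k / 2 ^ (t + 1)) + 6 * (k / 2 ^ (t + 1)) := by
    intro t right
    have h2 := segmentWt_le y (n := n) (l := l) (j := i + t) he right (expo (i + t + 2))
    have h3 := two_pow_mul_div_le (expo (i + t + 1)) n
    rw [← expo_succ, show i + t + 1 + 1 = i + t + 2 from rfl] at h3
    have h4 : n / 2 ^ (expo (i + t + 1) + 1) ≤ k / 2 ^ (t + 1) := by
      have h5 : expo i + (t + 1) ≤ expo (i + t + 1) + 1 := by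
        rw [add_assoc i t 1, expo_add]
        have h6 := Nat.lt_two_pow_self (n := t + 1)
        have h7 : 1 * (2 ^ (t + 1) - 1) ≤ 2 ^ i * (2 ^ (t + 1) - 1) :=
          Nat.mul_le_mul_right _ Nat.one_le_two_pow
        omega
      refine (Nat.div_le_div_left (Nat.pow_le_pow_right (by norm_num) h5) (by positivity)).trans ?_
      rw [pow_add, ← Nat.div_div_eq_div_mul]
      exact Nat.div_le_div_right h8
    have h5 : segmentCard y n σ l e (i + t) right * 2 ^ t ≤ 8 * k / 2 ^ (t + 1) := by
      have h6 := segmentCard_mul_le y (n := n) (σ := σ) l e (i + t) right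
      have h7 : expo i + 2 * (2 ^ t - 1) ≤ expo (i + t) := by
        rw [expo_add]
        have : 2 ^ 1 ≤ 2 ^ i := Nat.pow_le_pow_right (by norm_num) hi0
        exact Nat.add_le_add_left (Nat.mul_le_mul_right _ (by omega)) _
      have h9 : segmentCard y n σ l e (i + t) right * 2 ^ (2 * (2 ^ t - 1)) ≤ k := by
        refine le_trans ?_ h8
        rw [Nat.le_div_iff_mul_le (by positivity), mul_assoc, ← pow_add]
        refine le_trans (Nat.mul_le_mul_left _ (Nat.pow_le_pow_right (by norm_num) ?_)) h6
        omega
      rw [Nat.le_div_iff_mul_le (by positivity)]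
      have h10 : 2 ^ t * 2 ^ (t + 1) ≤ 8 * 2 ^ (2 * (2 ^ t - 1)) := by
        rw [← pow_add, show (8 : ℕ) = 2 ^ 3 by norm_num, ← pow_add]
        refine Nat.pow_le_pow_right (by norm_num) ?_
        have := Nat.lt_two_pow_self (n := t)
        omega
      rw [mul_assoc]
      calc _ ≤ segmentCard y n σ l e (i + t) right * (8 * 2 ^ (2 * (2 ^ t - 1))) :=
            Nat.mul_le_mul_left _ h10
        _ = 8 * (segmentCard y n σ l e (i + t) right * 2 ^ (2 * (2 ^ t - 1))) := by ring
        _ ≤ 8 * k := Nat.mul_le_mul_left _ h9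
    have h6 : expo (i + t + 2) ≤ 4 * 2 ^ i * 2 ^ t := by
      have := expo_add_one (i + t + 2)
      rw [pow_add, pow_add] at this
      nlinarith
    have h7 := Nat.mul_le_mul_left (segmentCard y n σ l e (i + t) right) h6
    have h9 := Nat.mul_le_mul_left (8 * 2 ^ i) h5
    nlinarith
  have h1 : ∀ t ∈ Finset.range J, ∑ right, segmentWt y n σ l e (i + t) right ≤
      16 * 2 ^ i * (8 * k / 2 ^ (t + 1)) + 12 * (k / 2 ^ (t + 1)) := by
    intro t _
    simp only [Fintype.sum_bool]
    have h2 := hside t true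
    have h3 := hside t false
    nlinarith
  refine (Finset.sum_le_sum h1).trans ?_
  rw [Finset.sum_add_distrib, ← Finset.mul_sum, ← Finset.mul_sum]
  have h2 := Nat.mul_le_mul_left (16 * 2 ^ i) (sum_div_two_pow_le (8 * k) J)
  have h3 := sum_div_two_pow_le k J
  nlinarith

/-- A query reads `O(k lg (n / k))` bits of blocks, where `2 ^ i` is about `lg (n / k)`. -/
theorem sum_segmentWt_le {l e k i : ℕ} (he : e ≤ σ) (hk : below y n e - below y n l ≤ k)
    (hi0 : 1 ≤ i) (hi : n ≤ k * 2 ^ expo i) (J : ℕ) :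
    ∑ j ∈ Finset.range J, ∑ right, segmentWt y n σ l e j right ≤ 144 * (k * 2 ^ i) := by
  have h1 : ∑ j ∈ Finset.range J, ∑ right, segmentWt y n σ l e j right ≤
      ∑ j ∈ Finset.range (i + J), ∑ right, segmentWt y n σ l e j right :=
    Finset.sum_le_sum_of_subset (Finset.range_subset_range.2 (Nat.le_add_left _ _))
  rw [Finset.sum_range_add] at h1
  have h2 := sum_segmentWt_low_le y he hk hi
  have h3 := sum_segmentWt_high_le y (l := l) he hi0 hi J
  have h4 : k * 2 ^ 1 ≤ k * 2 ^ i :=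
    Nat.mul_le_mul_left _ (Nat.pow_le_pow_right (by norm_num) hi0)
  omega

end

end SecondaryIndex

namespace SecondaryIndex

/-! ### From encoded blocks to cells -/

theorem decEnd_le {n : ℕ} {l : List Tok} (hl : ∀ t ∈ l, 0 < t.2) (c : ℕ) (hc : c ≤ n)
    (h : ∀ p ∈ dec c l, p < n) : decEnd c l ≤ n := by
  induction l generalizing c with
  | nil => exact hc
  | cons t l ih =>
    rw [List.forall_mem_cons] at hl
    simp only [dec, List.forall_mem_cons] at h
    exact ih hl.2 _ (by omega) h.2

theorem toksCode_length_pos {l : List Tok} (hl : l ≠ []) : 0 < (toksCode l).length := by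
  cases l with
  | nil => exact absurd rfl hl
  | cons t l =>
    rw [toksCode_cons, List.length_append, tokCode, List.length_cons]
    omega

theorem flags_tail_le (l : List Tok) : flags l.tail ≤ flags l :=
  List.Sublist.countP_le (List.tail_sublist l)

/-- The state of the conversion of tokens to cells: the first `N` cells are an input of the merge
sort and hold the set `U`. The positions in the last cell are below `last` unless `single` is
false; `single` is false only if a flag was met behind the first token of that cell, so the number
of runs is bounded by means of the number `Φ` of flags. -/
structure Written {n B : ℕ} (V : ℕ → Cell n B) (N last : ℕ) (single : Bool) (U : Finset ℕ)
    (Φ : ℕ) : Prop where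
  isInput : IsInput V N
  link : N = 0 ∨ (single = true → ∀ p ∈ (V (N - 1)).1.1, p < last)
  union : cellsUnion V 0 N = U
  first : if N = 0 then single = false else (V 0).2 = false
  starts_le : starts V 0 N + (if single then 0 else 1) ≤ 2 * Φ + 1

theorem written_zero {n B : ℕ} (V : ℕ → Cell n B) : Written V 0 0 false ∅ 0 where
  isInput := ⟨fun j hj => absurd hj (Nat.not_lt_zero j), fun j hj => absurd hj (Nat.not_lt_zero _)⟩
  link := Or.inl rfl
  union := by simp [cellsUnion]
  first := by simp
  starts_le := by simp [starts]

theorem Written.step {n B : ℕ} {V V' : ℕ → Cell n B} {N last : ℕ} {single : Bool} {U : Finset ℕ}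
    {Φ : ℕ} (h : Written V N last single U Φ) (hV : ∀ j < N, V' j = V j) {l : List Tok}
    (hl : ∀ t ∈ l, 0 < t.2) (hl0 : l ≠ []) (hN : (V' N).1.1 = (dec last l).toFinset)
    (hf : (V' N).2 = decide (flags l = 0 ∧ single = true)) :
    Written V' (N + 1) (decEnd last l) (decide (flags l.tail = 0)) (U ∪ (dec last l).toFinset)
      (Φ + flags l) := by
  refine ⟨⟨fun j hj => ?_, fun j hj hj' p hp p' hp' => ?_⟩, Or.inr fun hs p hp => ?_, ?_, ?_, ?_⟩
  · rcases Nat.lt_succ_iff_lt_or_eq.1 hj with hj | rfl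
    · rw [hV j hj]
      exact h.isInput.1 j hj
    · rw [hN, List.toFinset_nonempty_iff]
      intro h0
      have := length_dec last l
      rw [h0, List.length_nil, eq_comm, List.length_eq_zero_iff] at this
      exact hl0 this
  · rcases Nat.lt_succ_iff_lt_or_eq.1 hj with hj | rfl
    · rw [hV j (by omega)] at hp
      rw [hV _ hj] at hj' hp'
      exact h.isInput.2 j hj hj' p hp p' hp'
    · rw [hf, decide_eq_true_eq] at hj'
      rw [hV j (Nat.lt_succ_self j)] at hp
      rw [hN, List.mem_toFinset] at hp'
      have h1 := (h.link.resolve_left (Nat.succ_ne_zero j)) hj'.2 p hp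
      have h2 := ((le_of_mem_dec hl hj'.1 last).2 p' hp').1
      omega
  · rw [Nat.add_sub_cancel, hN, List.mem_toFinset] at hp
    exact lt_decEnd_of_mem_dec hl (by simpa using hs) last p hp
  · rw [cellsUnion_succ, Nat.zero_add, hN, cellsUnion_congr (V' := V) fun j hj => by
      rw [Nat.zero_add, hV j hj], h.union]
  · rw [if_neg (Nat.succ_ne_zero N)]
    have h1 := h.first
    rcases Nat.eq_zero_or_pos N with rfl | h0
    · rw [if_pos rfl] at h1
      simp [hf, h1]
    · rw [if_neg h0.ne'] at h1
      rw [hV 0 h0, h1]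
  · have h1 := h.starts_le
    have h2 := flags_tail_le l
    have h3 : starts V' 0 N = starts V 0 N := starts_congr (fun j hj => hV j hj) le_rfl
    rw [← starts_add V' (Nat.zero_le N) (Nat.le_succ N), h3]
    have h4 : starts V' N (N + 1) = if flags l = 0 ∧ single = true then 0 else 1 := by
      simp [starts, hf]
    rw [Nat.succ_eq_add_one, h4]
    simp only [decide_eq_true_eq]
    cases single <;> split_ifs at * <;> simp_all <;> omega

namespace Prog

variable {n B base A X : ℕ}

/-- Besides the positions in the stream, what is remembered while tokens are converted: the end of
the last position, the flag `single` of `Written` and the number of cells. -/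
abbrev WriteState (n A : ℕ) := Fin (n + 1) × Bool × Fin (A + 1)

/-- Convert one window of the stream to a cell. The stream begins with bit `tb` of the index; its
part from bit `s.1.1` to bit `s.1.2` remains to be converted. -/
noncomputable def readStep (n B base A X tb : ℕ)
    (s : (Fin (X + 1) × Fin (X + 1)) × WriteState n A) :
    Prog B ((Fin (X + 1) × Fin (X + 1)) × WriteState n A) :=
  if s.1.1 < s.1.2 then
    (readIndexAt (tb + s.1.1)).bind fun w : Window B =>
      let l := parse (32 * B) ((List.ofFn w).take (min (32 * B) (s.1.2 - s.1.1 : ℕ)))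
      (writeCell n base s.2.2.2 (SmallSet.mk' n (40 * B) (dec s.2.1 l).toFinset,
        decide (flags l = 0 ∧ s.2.2.1 = true))).map fun _ =>
          ((clamp X (s.1.1 + (toksCode l).length), s.1.2),
            (clamp n (decEnd s.2.1 l), decide (flags l.tail = 0), clamp A (s.2.2.2 + 1)))
  else ret s

theorem take_window {D : Disk} {p m : ℕ} {u : List Bool} (hm : m ≤ u.length) (hB : m ≤ 64 * B)
    (h : ∀ t < u.length, D (p + t) = u.getD t false) :
    (List.ofFn (window B D p)).take m = u.take m := by
  refine List.ext_getElem (by simp; omega) fun t h1 h2 => ?_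
  rw [List.length_take, lt_min_iff] at h2
  rw [List.getElem_take, List.getElem_take, List.getElem_ofFn]
  simp only [window]
  rw [h t h2.2, List.getD_eq_getElem _ _ h2.2]

theorem exec_readTokens (hn : 0 < n) (hB : 2 * Nat.size n ≤ 4 * B) (D W : Disk) {tb : ℕ}
    {L : List Tok} (hL : ∀ t ∈ L, 0 < t.2) (hLn : ∀ t ∈ L, t.2 ≤ n)
    (x e : Fin (X + 1)) (he : (e : ℕ) - x = (toksCode L).length)
    (hD : ∀ t < (toksCode L).length, D (tb + x + t) = (toksCode L).getD t false)
    (s : WriteState n A) (hdec : ∀ p ∈ dec s.1 L, p < n) (hA : s.2.2 + L.length ≤ A)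
    {U : Finset ℕ} {Φ : ℕ} (hs : Written (cell n B base W) s.2.2 s.1 s.2.1 U Φ) :
    ∃ (x' : Fin (X + 1) × Fin (X + 1)) (s' : WriteState n A) (W' : Disk) (t : ℕ),
      Exec D (iter (readStep n B base A X tb) A ((x, e), s)) W (x', s') W' t ∧
      Written (cell n B base W') s'.2.2 s'.1 s'.2.1 (U ∪ (dec s.1 L).toFinset) (Φ + flags L) ∧
      (∀ b < base, W' b = W b) ∧ (s.2.2 : ℕ) ≤ s'.2.2 ∧ (s'.2.2 : ℕ) ≤ s.2.2 + L.length ∧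
      16 * B * (s'.2.2 - s.2.2) ≤ (toksCode L).length + 16 * B ∧
      t ≤ 195 * (s'.2.2 - s.2.2) := by
  have hB0 : 0 < B := by
    have : 0 < Nat.size n := Nat.lt_size.2 hn
    omega
  set N₀ := Fin.val s.2.2 with hN₀
  let I : ℕ → (Fin (X + 1) × Fin (X + 1)) × WriteState n A → Disk → ℕ → Prop := fun k r W' c =>
    ∃ l₀ l, L = l₀ ++ l ∧ r.1.2 = e ∧ (e : ℕ) - r.1.1 = (toksCode l).length ∧
      (l ≠ [] → (r.1.1 : ℕ) = x + (toksCode l₀).length) ∧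
      (r.2.1 : ℕ) = decEnd s.1 l₀ ∧ N₀ ≤ r.2.2.2 ∧ (r.2.2.2 : ℕ) ≤ N₀ + l₀.length ∧
      Written (cell n B base W') r.2.2.2 r.2.1 r.2.2.1 (U ∪ (dec s.1 l₀).toFinset)
        (Φ + flags l₀) ∧
      (∀ b < base, W' b = W b) ∧
      16 * B * (r.2.2.2 - N₀) ≤ (toksCode l₀).length + 16 * B ∧
      (l ≠ [] → 16 * B * (r.2.2.2 - N₀) ≤ (toksCode l₀).length) ∧
      c ≤ 195 * (r.2.2.2 - N₀) ∧ l.length ≤ k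
  obtain ⟨⟨x', s'⟩, W', t, h1, l₀, l, h2, h3, h4, h5, h6, h7, h8, h9, h10, h11, h12, h13, h14⟩ :=
    Exec.iter (D := D) (f := readStep n B base A X tb) I
    (fun k r W₁ c ⟨l₀, l, g2, g3, g4, g5, g6, g7, g8, g9, g10, g11, g12, g13, g14⟩ => by
      obtain ⟨⟨q, e'⟩, last, single, N⟩ := r
      simp only at g3 g4 g5 g6 g7 g8 g9 g11 g12 g13
      subst g3
      by_cases hl : l = []
      · have hq : ¬ q < e' := by
          rw [hl, toksCode_nil, List.length_nil] at g4
          rw [Fin.lt_def]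
          omega
        refine ⟨_, W₁, 0, k, by rw [readStep, if_neg hq]; exact Exec.ret _ _ _, le_rfl,
          l₀, l, g2, rfl, g4, g5, g6, g7, g8, g9, g10, g11, g12, g13, by simp [hl]⟩
      · have hpos := toksCode_length_pos hl
        have hq : q < e' := by
          rw [Fin.lt_def]
          omega
        have g5 := g5 hl
        have g12 := g12 hl
        have hl1 : ∀ t ∈ l, 0 < t.2 := fun t ht => hL t (g2 ▸ List.mem_append_right _ ht)
        set m := min (32 * B) (e' - q : ℕ) with hm
        have hw : (List.ofFn (window B D (tb + q))).take m = (toksCode l).take m := by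
          refine take_window (by omega) (by omega) fun t ht => ?_
          have h := hD ((toksCode l₀).length + t) (by
            rw [g2, toksCode_append, List.length_append]
            omega)
          rw [g2, toksCode_append, List.getD_append_right _ _ _ _ (Nat.le_add_right _ _),
            Nat.add_sub_cancel_left] at h
          rw [← h, g5]
          congr 1
          ring
        obtain ⟨l₁, l₂, k1, k2, k3, k4⟩ := parse_take hl1 m (32 * B) (min_le_left _ _)
        have hcode : ∀ t ∈ l, (tokCode t).length ≤ 4 * B := by
          intro t ht
          rw [length_tokCode (hl1 t ht)]
          have := Nat.size_le_size (hLn t (g2 ▸ List.mem_append_right _ ht))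
          omega
        have hlen : (toksCode l).length = (toksCode l₁).length + (toksCode l₂).length := by
          rw [k1, toksCode_append, List.length_append]
        have hbig : l₂ = [] ∨ 28 * B < (toksCode l₁).length := by
          rcases k4 with h | ⟨t, ht, h⟩
          · exact Or.inl h
          · have ha := hcode t (k1 ▸ List.mem_append_right _ ht)
            by_cases hmm : m = 32 * B
            · exact Or.inr (by omega)
            · refine Or.inl ?_
              by_contra h0
              have hb : (tokCode t).length ≤ (toksCode l₂).length := by
                obtain ⟨u, v, rfl⟩ := List.append_of_mem ht
                rw [toksCode_append, toksCode_cons]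
                simp only [List.length_append]
                omega
              omega
        have hl₁ : l₁ ≠ [] := by
          rintro rfl
          rcases hbig with h | h
          · rw [h, List.append_nil] at k1
            exact hl k1
          · simp at h
        have hpos1 := toksCode_length_pos hl₁
        have hl₁p : ∀ t ∈ l₁, 0 < t.2 := fun t ht => hl1 t (k1 ▸ List.mem_append_left _ ht)
        have hL1 : L = (l₀ ++ l₁) ++ l₂ := by rw [g2, k1, List.append_assoc]
        have hdec0 : dec s.1 (l₀ ++ l₁) = dec s.1 l₀ ++ dec last l₁ := by rw [dec_append, g6]
        have hdec1 : ∀ p ∈ dec (last : ℕ) l₁, p < n := by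
          intro p hp
          refine hdec p ?_
          rw [hL1, dec_append, hdec0]
          exact List.mem_append_left _ (List.mem_append_right _ hp)
        have hend := decEnd_le hl₁p last (Nat.lt_succ_iff.1 last.2) hdec1
        have hset : (SmallSet.mk' n (40 * B) (dec last l₁).toFinset).1
            = (dec last l₁).toFinset := by
          refine SmallSet.val_mk' (fun p hp => ?_) ?_
          · exact Finset.mem_range.2 (hdec1 p (List.mem_toFinset.1 hp))
          · have := wt_dec_le hl₁p last hdec1
            omega
        have hNA : (N : ℕ) + 1 ≤ A := by
          rw [g2, List.length_append] at hA
          have := List.length_pos_of_ne_nil hl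
          omega
        have hlen1 := List.length_pos_of_ne_nil hl₁
        have hX : (q : ℕ) + (toksCode l₁).length ≤ X := by
          have := e'.2
          omega
        obtain ⟨W₂, m1, m2, m3, m4⟩ := exec_writeCell n hB0 D W₁ base N
          (SmallSet.mk' n (40 * B) (dec last l₁).toFinset,
            decide (flags l₁ = 0 ∧ single = true))
        have hstep := g9.step (V' := cell n B base W₂) (fun j hj => m3 j (by omega)) hl₁p hl₁
          (by rw [m2]; exact hset) (by rw [m2])
        have e1 : ((clamp X (q + (toksCode l₁).length) : Fin (X + 1)) : ℕ)
            = q + (toksCode l₁).length := clamp_val hX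
        have e2 : ((clamp n (decEnd last l₁) : Fin (n + 1)) : ℕ) = decEnd last l₁ := clamp_val hend
        have e3 : ((clamp A (N + 1) : Fin (A + 1)) : ℕ) = N + 1 := clamp_val hNA
        refine ⟨((clamp X (q + (toksCode l₁).length), e'), (clamp n (decEnd last l₁),
          decide (flags l₁.tail = 0), clamp A (N + 1))), W₂, 65 + 130, k, ?_, le_rfl,
          l₀ ++ l₁, l₂, hL1, rfl, ?_, fun _ => ?_, ?_, ?_, ?_, ?_, ?_, ?_, fun h => ?_, ?_, ?_⟩
        · rw [readStep, if_pos hq]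
          refine (exec_readIndexAt hB0 D W₁ _).bind ?_
          simp only
          rw [← hm, hw, k2]
          exact m1.map fun _ => ((clamp X (q + (toksCode l₁).length), e'),
            (clamp n (decEnd last l₁), decide (flags l₁.tail = 0), clamp A (N + 1)))
        · simp only [e1]
          omega
        · simp only [e1]
          rw [toksCode_append, List.length_append]
          omega
        · simp only [e2]
          rw [decEnd_append, g6]
        · simp only [e3]
          omega
        · simp only [e3]
          rw [List.length_append]
          omega
        · simp only [e2, e3]
          rw [hdec0, List.toFinset_append, flags_append, ← Finset.union_assoc, ← Nat.add_assoc]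
          exact hstep
        · intro b hb
          rw [m4 b hb, g10 b hb]
        · simp only [e3]
          rw [toksCode_append, List.length_append, Nat.succ_sub g7, Nat.mul_succ]
          omega
        · simp only [e3]
          rw [toksCode_append, List.length_append, Nat.succ_sub g7, Nat.mul_succ]
          have := hbig.resolve_left h
          omega
        · simp only [e3]
          omega
        · have : l.length = l₁.length + l₂.length := by rw [k1, List.length_append]
          omega)
    (fun r W₁ c ⟨l₀, l, _, g3, g4, _, _, _, _, _, _, _, _, _, g14⟩ => by
      have hl : l = [] := List.eq_nil_of_length_eq_zero (by omega)
      rw [readStep, if_neg]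
      rw [Fin.lt_def, g3]
      rw [hl, toksCode_nil, List.length_nil] at g4
      omega)
    A (k := L.length) (a := ((x, e), s)) (W := W) (c := 0)
    ⟨[], L, rfl, rfl, he, fun _ => rfl, rfl, le_rfl, le_rfl, by simpa [dec, flags] using hs,
      fun _ _ => rfl, by simp [hN₀], by simp [hN₀], by simp, le_rfl⟩ (by omega)
  have hl : l = [] := List.eq_nil_of_length_eq_zero (by omega)
  rw [hl, List.append_nil] at h2
  subst h2
  exact ⟨x', s', W', t, h1, h9, h10, h7, h8, h11, by simpa using h13⟩

theorem card_writeState_le {a : ℕ} (hA : A < 2 ^ a) (hn : n ≤ A) :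
    Fintype.card (WriteState n A) ≤ 2 ^ (a + (1 + a)) := by
  rw [Fintype.card_prod, Fintype.card_prod, Fintype.card_bool, pow_add, pow_add, pow_one]
  exact Nat.mul_le_mul (card_fin_succ_le (by omega))
    (Nat.mul_le_mul_left _ (card_fin_succ_le hA))

theorem fits_readTokens {a w : ℕ} (hA : A < 2 ^ a) (hn : n ≤ A) (hX : X < 2 ^ w) (tb : ℕ) :
    Fits (a + ((w + w) + (a + (1 + a)) + (64 * B + 65 * (B + 2) + 1)))
      (iter (readStep n B base A X tb) A) := by
  have hcard : Fintype.card ((Fin (X + 1) × Fin (X + 1)) × WriteState n A)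
      ≤ 2 ^ ((w + w) + (a + (1 + a))) := by
    rw [Fintype.card_prod, Fintype.card_prod, pow_add, pow_add 2 w w]
    exact Nat.mul_le_mul (Nat.mul_le_mul (card_fin_succ_le hX) (card_fin_succ_le hX))
      (card_writeState_le hA hn)
  have hstep : Fits ((w + w) + (a + (1 + a)) + (64 * B + 65 * (B + 2) + 1))
      (readStep n B base A X tb) := by
    refine Fits.of_forall hcard fun s => ?_
    unfold readStep
    by_cases h : s.1.1 < s.1.2
    · simp only [if_pos h]
      have h2 : Fits (64 * B + 65 * (B + 2)) fun w : Window B =>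
          let l := parse (32 * B) ((List.ofFn w).take (min (32 * B) (s.1.2 - s.1.1 : ℕ)))
          (writeCell n base s.2.2.2 (SmallSet.mk' n (40 * B) (dec s.2.1 l).toFinset,
            decide (flags l = 0 ∧ s.2.2.1 = true))).map fun _ =>
              ((clamp X (s.1.1 + (toksCode l).length), s.1.2),
                (clamp n (decEnd s.2.1 l), decide (flags l.tail = 0), clamp A (s.2.2.2 + 1))) :=
        Fits.of_forall (by simp) fun w => Fits.map (fits_writeCell n base _ _) _
      exact (Fits.bind (fits_readIndexAt _) h2).mono (by omega)
    · simp only [if_neg h]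
      exact (Fits₁.ret s).mono (Nat.zero_le _)
  have h := Fits.iter hcard hstep hA
  rwa [max_eq_left (by omega)] at h

/-- Convert the segments of the stream that are given by `bounds 0, …, bounds (K - 1)`; the
first component of the state is the number of the segment. -/
noncomputable def readSegments (n B base A X tb K : ℕ)
    (bounds : ℕ → Prog B (Fin (X + 1) × Fin (X + 1))) : Prog B (Fin (A + 1)) :=
  (iter (fun s : Fin (K + 1) × WriteState n A =>
    if (s.1 : ℕ) < K then
      ((bounds s.1).bind fun x => iter (readStep n B base A X tb) A (x, s.2)).map
        fun s' => (clamp K (s.1 + 1), s'.2)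
    else ret s) K (clamp K 0, (clamp n 0, false, clamp A 0))).map fun s => s.2.2.2

theorem exec_readSegments (hn : 0 < n) (hB : 2 * Nat.size n ≤ 4 * B) (D W : Disk) {tb K : ℕ}
    {bounds : ℕ → Prog B (Fin (X + 1) × Fin (X + 1))} {L : ℕ → List Tok} {U : ℕ → Finset ℕ}
    {x e : ℕ → Fin (X + 1)} {t₀ : ℕ}
    (hb : ∀ i < K, ∀ W, Exec D (bounds i) W (x i, e i) W t₀)
    (hL : ∀ i < K, ∀ t ∈ L i, 0 < t.2 ∧ t.2 ≤ n)
    (he : ∀ i < K, (e i : ℕ) - x i = (toksCode (L i)).length)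
    (hD : ∀ i < K, ∀ t < (toksCode (L i)).length,
      D (tb + x i + t) = (toksCode (L i)).getD t false)
    (hU : ∀ i < K, ∀ c, (dec c (L i)).toFinset = U i) (hUn : ∀ i < K, ∀ p ∈ U i, p < n)
    (hA : ∑ i ∈ Finset.range K, (L i).length ≤ A) :
    ∃ (N : Fin (A + 1)) (W' : Disk) (t : ℕ),
      Exec D (readSegments n B base A X tb K bounds) W N W' t ∧
      IsInput (cell n B base W') N ∧
      ((N : ℕ) = 0 ∨ (cell n B base W' 0).2 = false) ∧
      cellsUnion (cell n B base W') 0 N = (Finset.range K).biUnion U ∧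
      starts (cell n B base W') 0 N ≤ 2 * ∑ i ∈ Finset.range K, flags (L i) + 1 ∧
      (N : ℕ) ≤ ∑ i ∈ Finset.range K, (L i).length ∧
      16 * B * N ≤ ∑ i ∈ Finset.range K, (toksCode (L i)).length + 16 * B * K ∧
      t ≤ t₀ * K + 195 * N := by
  let I : ℕ → Fin (K + 1) × WriteState n A → Disk → ℕ → Prop := fun k s W' c =>
    k + (s.1 : ℕ) = K ∧
    Written (cell n B base W') s.2.2.2 s.2.1 s.2.2.1 ((Finset.range s.1).biUnion U)
      (∑ i ∈ Finset.range s.1, flags (L i)) ∧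
    (s.2.2.2 : ℕ) ≤ ∑ i ∈ Finset.range s.1, (L i).length ∧
    16 * B * s.2.2.2 ≤ ∑ i ∈ Finset.range s.1, (toksCode (L i)).length + 16 * B * s.1 ∧
    c ≤ t₀ * s.1 + 195 * s.2.2.2
  have e0 : ((clamp K 0 : Fin (K + 1)) : ℕ) = 0 := clamp_val (Nat.zero_le _)
  have e1 : ((clamp n 0 : Fin (n + 1)) : ℕ) = 0 := clamp_val (Nat.zero_le _)
  have e2 : ((clamp A 0 : Fin (A + 1)) : ℕ) = 0 := clamp_val (Nat.zero_le _)
  obtain ⟨⟨i, s⟩, W', t, h1, h2, h3, h4, h5, h6⟩ := Exec.iter (D := D)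
    (f := fun s : Fin (K + 1) × WriteState n A =>
      if (s.1 : ℕ) < K then
        ((bounds s.1).bind fun x => iter (readStep n B base A X tb) A (x, s.2)).map
          fun s' => (clamp K (s.1 + 1), s'.2)
      else ret s) I
    (fun k r W₁ c ⟨g2, g3, g4, g5, g6⟩ => by
      obtain ⟨i, s⟩ := r
      simp only at g2 g3 g4 g5 g6
      have hi : (i : ℕ) < K := by omega
      have hsum : ∑ j ∈ Finset.range (i + 1), (L j).length ≤ A :=
        (Finset.sum_le_sum_of_subset (Finset.range_subset_range.2 hi)).trans hA
      rw [Finset.sum_range_succ] at hsum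
      obtain ⟨x', s', W₂, t, k1, k2, k3, k4, k5, k6, k7⟩ := exec_readTokens (A := A) (X := X)
        (base := base) hn hB D W₁ (fun t ht => (hL i hi t ht).1) (fun t ht => (hL i hi t ht).2)
        (x i) (e i) (he i hi) (hD i hi) s
        (fun p hp => hUn i hi p (hU i hi s.1 ▸ List.mem_toFinset.2 hp)) (by omega) g3
      have e3 : ((clamp K (i + 1) : Fin (K + 1)) : ℕ) = i + 1 := clamp_val hi
      refine ⟨(clamp K (i + 1), s'), W₂, t₀ + t, k, ?_, le_rfl, ?_, ?_, ?_, ?_, ?_⟩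
      · simp only [if_pos hi]
        exact ((hb i hi W₁).bind (f := fun x => iter (readStep n B base A X tb) A (x, s)) k1).map
          fun s' => (clamp K (i + 1), s'.2)
      · simp only [e3]
        omega
      · simp only [e3]
        rw [hU i hi] at k2
        rw [Finset.range_add_one, Finset.biUnion_insert, Finset.union_comm,
          Finset.sum_insert Finset.notMem_range_self, Nat.add_comm (flags _)]
        exact k2
      · simp only [e3, Finset.sum_range_succ]
        omega
      · simp only [e3, Finset.sum_range_succ]
        have : 16 * B * (s'.2.2 : ℕ) = 16 * B * (s'.2.2 - s.2.2) + 16 * B * s.2.2 := by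
          rw [← Nat.mul_add]
          congr 1
          omega
        rw [Nat.mul_succ]
        omega
      · simp only [e3]
        rw [Nat.mul_succ]
        omega)
    (fun s W' c ⟨g2, _⟩ => by
      rw [if_neg (by omega)])
    K (k := K) (a := (clamp K 0, (clamp n 0, false, clamp A 0))) (W := W) (c := 0)
    ⟨by simp [e0], by simpa [e0, e1, e2] using written_zero (cell n B base W), by simp [e2],
      by simp [e2], by simp⟩ le_rfl
  simp only at h2 h3 h4 h5 h6
  rw [show (i : ℕ) = K by omega] at h3 h4 h5 h6
  refine ⟨s.2.2, W', t, h1.map fun s : Fin (K + 1) × WriteState n A => s.2.2.2, h3.isInput,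
    ?_, h3.union, (Nat.le_add_right _ _).trans h3.starts_le, h4, h5, by simpa using h6⟩
  have h7 := h3.first
  split_ifs at h7 with h8
  · exact Or.inl h8
  · exact Or.inr h7

theorem fits_readSegments {a w v m tb K : ℕ} (hA : A < 2 ^ a) (hn : n ≤ A) (hX : X < 2 ^ w)
    (hK : K < 2 ^ v) {bounds : ℕ → Prog B (Fin (X + 1) × Fin (X + 1))}
    (hb : ∀ i < K, Fits₁ m (bounds i)) :
    Fits₁ (v + ((v + (a + (1 + a))) + (m + ((w + w) +
        (a + ((w + w) + (a + (1 + a)) + (64 * B + 65 * (B + 2) + 1)))) + 1)))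
      (readSegments n B base A X tb K bounds) := by
  have hcard : Fintype.card (Fin (K + 1) × WriteState n A) ≤ 2 ^ (v + (a + (1 + a))) := by
    rw [Fintype.card_prod, pow_add]
    exact Nat.mul_le_mul (card_fin_succ_le hK) (card_writeState_le hA hn)
  have hcard2 : Fintype.card (Fin (X + 1) × Fin (X + 1)) ≤ 2 ^ (w + w) := by
    rw [Fintype.card_prod, pow_add]
    exact Nat.mul_le_mul (card_fin_succ_le hX) (card_fin_succ_le hX)
  have hstep : Fits ((v + (a + (1 + a))) + (m + ((w + w) +
        (a + ((w + w) + (a + (1 + a)) + (64 * B + 65 * (B + 2) + 1)))) + 1))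
      fun s : Fin (K + 1) × WriteState n A =>
        if (s.1 : ℕ) < K then
          ((bounds s.1).bind fun x => iter (readStep n B base A X tb) A (x, s.2)).map
            fun s' => (clamp K (s.1 + 1), s'.2)
        else ret s := by
    refine Fits.of_forall hcard fun s => ?_
    by_cases h : (s.1 : ℕ) < K
    · simp only [if_pos h]
      have h2 : Fits ((w + w) + (a + ((w + w) + (a + (1 + a)) + (64 * B + 65 * (B + 2) + 1))))
          fun x => iter (readStep n B base A X tb) A (x, s.2) :=
        Fits.of_forall hcard2 fun x => (fits_readTokens hA hn hX tb).fits₁ _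
      exact (Fits.map (Fits.bind (hb s.1 h) h2) _).mono (by omega)
    · simp only [if_neg h]
      exact (Fits₁.ret s).mono (Nat.zero_le _)
  have h := Fits.iter hcard hstep hK
  rw [max_eq_left (by omega)] at h
  exact Fits.map (h.fits₁ _) _

end Prog

end SecondaryIndex

namespace SecondaryIndex

/-! ### The stored bit string -/

section

variable (y : ℕ → ℕ) (n σ : ℕ)

/-- The number of levels that are stored; the buckets of the last one are singletons. -/
def levels : ℕ := Nat.log 2 (Nat.log 2 n) + 2

/-- The stored blocks in one sequence: the block of level `j + 1` that begins with `c` has the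
number `j * σ + c`. -/
def block (i : ℕ) : Finset ℕ := piece y n σ (i / σ + 1) (i % σ)

/-- The position of a block in the stream. -/
def offset (i : ℕ) : ℕ := ∑ i' ∈ Finset.range i, wt (block y n σ i')

/-- The tokens of the blocks with numbers `u, …, v - 1`. -/
def blockToks (u v : ℕ) : List Tok := ((List.range' u (v - u)).map (block y n σ)).flatMap toks

/-- The encoded blocks. -/
def stream : List Bool := toksCode (blockToks y n σ 0 (levels n * σ))

/-- The number of bits of a table entry. -/
def width : ℕ := 3 * Nat.size n + 2

/-- The entries of the table. There are five of them for each `c ≤ σ` and each level `j + 1`,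
in record `c * levels n + j`: the number of smaller characters, and the positions in the stream that
belong to the boundaries next to `c` on the levels `j + 1` and `j`. -/
def entry (g : ℕ) : ℕ :=
  let c := g / 5 / levels n
  let j := g / 5 % levels n
  match g % 5 with
  | 0 => below y n c
  | 1 => offset y n σ (j * σ + nextB y n σ (j + 1) c)
  | 2 => offset y n σ (j * σ + nextB y n σ j c)
  | 3 => offset y n σ (j * σ + prevB y n σ (j + 1) c)
  | _ => offset y n σ (j * σ + prevB y n σ j c)

/-- The length of the table. -/
def tableLen : ℕ := (σ + 1) * levels n * 5 * width n

/-- The table: its entries as numbers of fixed width. -/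
def table : List Bool :=
  (List.range (tableLen n σ)).map fun p => (entry y n σ (p / width n)).testBit (p % width n)

/-- The bit string that is stored. For `n ≤ 1` the space bound does not leave room for a table. -/
def encode : List Bool := if n < 2 then [] else table y n σ ++ stream y n σ

variable {n σ}

theorem lt_two_pow_expo_levels : n < 2 ^ expo (levels n) := by
  refine (Nat.lt_pow_succ_log_self (b := 2) (by norm_num) n).trans_le
    (Nat.pow_le_pow_right (by norm_num) ?_)
  have h1 := Nat.lt_pow_succ_log_self (b := 2) (by norm_num) (Nat.log 2 n)
  have h2 := expo_add_one (levels n)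
  rw [levels, pow_succ] at h2
  rw [Nat.succ_eq_add_one] at h1 ⊢
  rw [levels]
  omega

theorem levels_le (hn : 2 ≤ n) : levels n ≤ Nat.size n := by
  have h1 := size_eq_log (show 0 < n by omega)
  have h2 : 0 < Nat.log 2 n := Nat.log_pos (by norm_num) hn
  have h3 := Nat.log_lt_self 2 h2.ne'
  rw [levels]
  omega

theorem levels_pos : 0 < levels n := Nat.succ_pos _

theorem block_add {j c : ℕ} (hc : c < σ) : block y n σ (j * σ + c) = piece y n σ (j + 1) c := by
  have h0 : 0 < σ := by omega
  rw [block, mul_comm, Nat.mul_add_div h0, Nat.mul_add_mod, Nat.div_eq_of_lt hc,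
    Nat.mod_eq_of_lt hc, Nat.add_zero]

theorem offset_mono {i i' : ℕ} (h : i ≤ i') : offset y n σ i ≤ offset y n σ i' :=
  Finset.sum_le_sum_of_subset (Finset.range_subset_range.2 h)

theorem blockToks_append {u v w : ℕ} (huv : u ≤ v) (hvw : v ≤ w) :
    blockToks y n σ u w = blockToks y n σ u v ++ blockToks y n σ v w := by
  have h : List.range' u (w - u) = List.range' u (v - u) ++ List.range' v (w - v) := by
    have h1 := List.range'_append_1 (s := u) (m := v - u) (n := w - v)
    rw [show u + (v - u) = v by omega, show v - u + (w - v) = w - u by omega] at h1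
    exact h1.symm
  rw [blockToks, h, List.map_append, List.flatMap_append]
  rfl

theorem length_toksCode_blockToks (u v : ℕ) :
    (toksCode (blockToks y n σ u v)).length = offset y n σ v - offset y n σ u := by
  have key : ∀ u m, ((List.range' u m).map fun i => wt (block y n σ i)).sum
      = offset y n σ (u + m) - offset y n σ u := by
    intro u m
    have h : offset y n σ (u + m)
        = offset y n σ u + ((List.range' u m).map fun i => wt (block y n σ i)).sum := by
      induction m with
      | zero => simp
      | succ m ih =>
        rw [List.range'_1_concat, List.map_append, List.sum_append,
          ← Nat.add_assoc (offset y n σ u), ← ih,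
          ← Nat.add_assoc, offset, Finset.sum_range_succ]
        simp [offset]
    omega
  rw [blockToks, length_toksCode_flatMap_toks, List.map_map]
  rcases le_total u v with h | h
  · have h1 := key u (v - u)
    rw [show u + (v - u) = v by omega] at h1
    exact h1
  · rw [Nat.sub_eq_zero_of_le h, Nat.sub_eq_zero_of_le (offset_mono y h)]
    rfl

theorem stream_getD {u v t : ℕ} (hv : v ≤ levels n * σ)
    (ht : t < (toksCode (blockToks y n σ u v)).length) :
    (stream y n σ).getD (offset y n σ u + t) false
      = (toksCode (blockToks y n σ u v)).getD t false := by
  have huv : u ≤ v := by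
    by_contra h
    rw [length_toksCode_blockToks, Nat.sub_eq_zero_of_le (offset_mono y (by omega))] at ht
    omega
  have h0 : (toksCode (blockToks y n σ 0 u)).length = offset y n σ u := by
    rw [length_toksCode_blockToks]
    simp [offset]
  rw [stream, blockToks_append y (Nat.zero_le u) (huv.trans hv), blockToks_append y huv hv,
    toksCode_append, toksCode_append, List.getD_append_right _ _ _ _ (by omega), h0,
    Nat.add_sub_cancel_left, List.getD_append _ _ _ _ ht]

theorem offset_eq (J : ℕ) : offset y n σ (J * σ)
    = ∑ j ∈ Finset.range J, ∑ c ∈ Finset.range σ, wt (piece y n σ (j + 1) c) := by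
  induction J with
  | zero => simp [offset]
  | succ J ih =>
    rw [Finset.sum_range_succ, ← ih, offset, Nat.succ_mul, Finset.sum_range_add]
    refine congrArg _ (Finset.sum_congr rfl fun c hc => ?_)
    rw [block_add y (Finset.mem_range.1 hc)]

theorem offset_le (hn : 2 ≤ n) {i : ℕ} (hi : i ≤ levels n * σ) :
    offset y n σ i < 2 ^ width n := by
  refine (offset_mono y hi).trans_lt ?_
  rw [offset_eq]
  have h1 : ∀ j ∈ Finset.range (levels n), ∑ c ∈ Finset.range σ, wt (piece y n σ (j + 1) c) ≤
      n * (2 * Nat.size n) := by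
    intro j _
    refine (Finset.sum_le_sum fun c _ =>
      wt_le_card_mul (n := n) fun p hp => lt_of_mem_piece y hp).trans ?_
    rw [← Finset.sum_mul]
    refine Nat.mul_le_mul_right _ ?_
    rw [Finset.range_eq_Ico]
    exact (sum_card_piece_le y (isBoundary_of_le y (j + 1) le_rfl)).trans
      ((Nat.sub_le _ _).trans (below_le y σ))
  refine (Finset.sum_le_sum h1).trans_lt ?_
  rw [Finset.sum_const, Finset.card_range, smul_eq_mul]
  have h2 := levels_le hn
  have h3 := Nat.lt_size_self n
  have h4 := (Nat.lt_two_pow_self (n := Nat.size n)).le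
  calc levels n * (n * (2 * Nat.size n))
      ≤ 2 ^ Nat.size n * (2 ^ Nat.size n * (2 * 2 ^ Nat.size n)) :=
        Nat.mul_le_mul (h2.trans h4) (Nat.mul_le_mul h3.le (Nat.mul_le_mul_left 2 h4))
    _ = 2 ^ (3 * Nat.size n + 1) := by ring
    _ < 2 ^ width n := Nat.pow_lt_pow_right (by norm_num) (by rw [width]; omega)

theorem entry_le (hn : 2 ≤ n) {g : ℕ} (hg : g / 5 < (σ + 1) * levels n) :
    entry y n σ g < 2 ^ width n := by
  have hc : g / 5 / levels n ≤ σ := by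
    rw [mul_comm] at hg
    exact Nat.lt_succ_iff.1 (Nat.div_lt_of_lt_mul hg)
  have hj : g / 5 % levels n < levels n := Nat.mod_lt _ levels_pos
  have key : ∀ c ≤ σ, g / 5 % levels n * σ + c ≤ levels n * σ := by
    intro c hc
    have := Nat.mul_le_mul_right σ (show g / 5 % levels n + 1 ≤ levels n from hj)
    rw [Nat.succ_mul] at this
    omega
  unfold entry
  simp only
  split
  · refine (below_le y _).trans_lt ((Nat.lt_size_self n).trans_le
      (Nat.pow_le_pow_right (by norm_num) ?_))
    rw [width]
    omega
  · exact offset_le y hn (key _ (nextB_le_of_le y hc))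
  · exact offset_le y hn (key _ (nextB_le_of_le y hc))
  · exact offset_le y hn (key _ ((prevB_le y _ _).trans hc))
  · exact offset_le y hn (key _ ((prevB_le y _ _).trans hc))

theorem length_table : (table y n σ).length = tableLen n σ := by simp [table]

theorem diskOf_encode_table (hn : 2 ≤ n) {p : ℕ} (hp : p < tableLen n σ) :
    diskOf (encode y n σ) p = (entry y n σ (p / width n)).testBit (p % width n) := by
  rw [diskOf, encode, if_neg (by omega), List.getD_append _ _ _ _ (by rwa [length_table]), table,
    List.getD_eq_getElem _ _ (by simpa using hp)]
  simp

theorem diskOf_encode_stream (hn : 2 ≤ n) (p : ℕ) :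
    diskOf (encode y n σ) (tableLen n σ + p) = (stream y n σ).getD p false := by
  rw [diskOf, encode, if_neg (by omega),
    List.getD_append_right _ _ _ _ (by rw [length_table]; omega),
    length_table, Nat.add_sub_cancel_left]

end

namespace Prog

variable {B : ℕ}

/-- Read a record of the table. -/
noncomputable def readRecord (w r : ℕ) : Prog B (Fin 5 → Fin (2 ^ w + 1)) :=
  (readIndexAt (5 * w * r)).map fun v f => clamp (2 ^ w)
    (Nat.ofBits fun t : Fin w => if h : f * w + t < 64 * B then v ⟨f * w + t, h⟩ else false)

theorem exec_readRecord (y : ℕ → ℕ) {n σ : ℕ} (hn : 2 ≤ n) (hB0 : 0 < B)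
    (hB : 5 * width n ≤ 64 * B) (W : Disk) {r : ℕ} (hr : r < (σ + 1) * levels n) :
    Exec (B := B) (diskOf (encode y n σ)) (readRecord (width n) r) W
      (fun f => clamp (2 ^ width n) (entry y n σ (5 * r + f))) W 65 := by
  have h := (exec_readIndexAt (B := B) hB0 (diskOf (encode y n σ)) W (5 * width n * r)).map
    fun v (f : Fin 5) => clamp (2 ^ width n) (Nat.ofBits fun t : Fin (width n) =>
      if h : f * width n + t < 64 * B then v ⟨f * width n + t, h⟩ else false)
  refine Eq.mp (congrArg (fun g => Exec (B := B) (diskOf (encode y n σ)) (readRecord (width n) r)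
    W g W 65) ?_) h
  funext f
  have hw : 0 < width n := by rw [width]; omega
  have h1 : ∀ t : Fin (width n), (f : ℕ) * width n + t < 5 * width n := by
    intro t
    have h2 := Nat.mul_le_mul_right (width n) (show (f : ℕ) + 1 ≤ 5 from f.2)
    rw [Nat.succ_mul] at h2
    have := t.2
    omega
  have h2 : ∀ t : Fin (width n),
      (if h : (f : ℕ) * width n + t < 64 * B then
        window B (diskOf (encode y n σ)) (5 * width n * r) ⟨f * width n + t, h⟩ else false)
      = (entry y n σ (5 * r + f)).testBit t := by
    intro t
    rw [dif_pos (by have := h1 t; omega), window]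
    simp only
    have h3 : 5 * width n * r + ((f : ℕ) * width n + t) = width n * (5 * r + f) + t := by ring
    rw [h3, diskOf_encode_table y hn, Nat.mul_add_div hw, Nat.mul_add_mod,
      Nat.div_eq_of_lt t.2, Nat.mod_eq_of_lt t.2, Nat.add_zero]
    rw [← h3, tableLen, mul_assoc _ 5, mul_comm _ (5 * width n)]
    have h4 := Nat.mul_le_mul_left (5 * width n) (show r + 1 ≤ (σ + 1) * levels n from hr)
    rw [Nat.mul_succ] at h4
    have := h1 t
    omega
  simp only [h2]
  rw [Nat.ofBits_testBit, Nat.mod_eq_of_lt]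
  exact entry_le y hn (by omega)

theorem fits_readRecord (w r : ℕ) : Fits₁ (65 * (B + 1)) (readRecord (B := B) w r) :=
  Fits.map (fits_readIndexAt _) _

/-- The part of the stream that holds a group of blocks for the range `l ≤ c < e`. -/
noncomputable def segmentBounds (n l e j : ℕ) (right : Bool) :
    Prog B (Fin (2 ^ width n + 1) × Fin (2 ^ width n + 1)) :=
  (readRecord (width n) (l * levels n + j)).bind fun a =>
    (readRecord (width n) (e * levels n + j)).map fun b =>
      if right then (max (b 4) (a 2), b 3) else (a 1, min (a 2) (b 3))

theorem exec_segmentBounds (y : ℕ → ℕ) {n σ : ℕ} (hn : 2 ≤ n) (hB0 : 0 < B)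
    (hB : 5 * width n ≤ 64 * B) (W : Disk) {l e j : ℕ} (hl : l ≤ σ) (he : e ≤ σ)
    (hj : j < levels n) (right : Bool) :
    Exec (B := B) (diskOf (encode y n σ)) (segmentBounds n l e j right) W
      (clamp (2 ^ width n) (offset y n σ (j * σ + (segment y n σ l e j right).1)),
        clamp (2 ^ width n) (offset y n σ (j * σ + (segment y n σ l e j right).2))) W 130 := by
  have hrec : ∀ c ≤ σ, c * levels n + j < (σ + 1) * levels n := by
    intro c hc
    have := Nat.mul_le_mul_right (levels n) (show c + 1 ≤ σ + 1 by omega)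
    rw [Nat.succ_mul] at this
    omega
  have hent : ∀ c f, f < 5 → (5 * (c * levels n + j) + f) / 5 / levels n = c ∧
      (5 * (c * levels n + j) + f) / 5 % levels n = j ∧ (5 * (c * levels n + j) + f) % 5 = f := by
    intro c f hf
    have h1 : (5 * (c * levels n + j) + f) / 5 = levels n * c + j := by
      rw [mul_comm c]
      omega
    rw [h1, Nat.mul_add_div levels_pos, Nat.mul_add_mod, Nat.div_eq_of_lt hj, Nat.mod_eq_of_lt hj]
    omega
  have h1 : ∀ c, entry y n σ (5 * (c * levels n + j) + (1 : Fin 5))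
      = offset y n σ (j * σ + nextB y n σ (j + 1) c) := by
    intro c
    obtain ⟨a1, a2, a3⟩ := hent c 1 (by norm_num)
    simp only [entry, Fin.val_one, a1, a2, a3]
  have h2 : ∀ c, entry y n σ (5 * (c * levels n + j) + (2 : Fin 5))
      = offset y n σ (j * σ + nextB y n σ j c) := by
    intro c
    obtain ⟨a1, a2, a3⟩ := hent c 2 (by norm_num)
    simp only [entry, Fin.val_two, a1, a2, a3]
  have h3 : ∀ c, entry y n σ (5 * (c * levels n + j) + (3 : Fin 5))
      = offset y n σ (j * σ + prevB y n σ (j + 1) c) := by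
    intro c
    obtain ⟨a1, a2, a3⟩ := hent c 3 (by norm_num)
    simp only [entry, show ((3 : Fin 5) : ℕ) = 3 from rfl, a1, a2, a3]
  have h4 : ∀ c, entry y n σ (5 * (c * levels n + j) + (4 : Fin 5))
      = offset y n σ (j * σ + prevB y n σ j c) := by
    intro c
    obtain ⟨a1, a2, a3⟩ := hent c 4 (by norm_num)
    simp only [entry, show ((4 : Fin 5) : ℕ) = 4 from rfl, a1, a2, a3]
  have hex := (exec_readRecord (B := B) y hn hB0 hB W (hrec l hl)).bind
    (f := fun a => (readRecord (width n) (e * levels n + j)).map fun b =>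
      if right then (max (b 4) (a 2), b 3) else (a 1, min (a 2) (b 3)))
    ((exec_readRecord (B := B) y hn hB0 hB W (hrec e he)).map _)
  have hm : Monotone fun c => clamp (2 ^ width n) (offset y n σ (j * σ + c)) := by
    intro c d hcd
    rw [Fin.le_def]
    exact min_le_min_right _ (offset_mono y (Nat.add_le_add_left hcd _))
  refine Eq.mp (congrArg (fun g => Exec (B := B) (diskOf (encode y n σ))
    (segmentBounds n l e j right) W g W 130) ?_) hex
  simp only [h1, h2, h3, h4]
  cases right
  · simp only [segment, Bool.false_eq_true, if_false]
    rw [← hm.map_min]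
  · simp only [segment, if_true]
    rw [← hm.map_max]

theorem fits_segmentBounds (n l e j : ℕ) (right : Bool) :
    Fits₁ ((width n + 1) * 5 + 65 * (B + 1) + 1) (segmentBounds (B := B) n l e j right) := by
  have hcard : Fintype.card (Fin 5 → Fin (2 ^ width n + 1)) ≤ 2 ^ ((width n + 1) * 5) := by
    rw [Fintype.card_fun, Fintype.card_fin 5, pow_mul]
    refine Nat.pow_le_pow_left (card_fin_succ_le ?_) _
    exact Nat.pow_lt_pow_right (by norm_num) (Nat.lt_succ_self _)
  have h2 : Fits ((width n + 1) * 5 + 65 * (B + 1)) fun a : Fin 5 → Fin (2 ^ width n + 1) =>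
      (readRecord (B := B) (width n) (e * levels n + j)).map fun b =>
        if right then (max (b 4) (a 2), b 3) else (a 1, min (a 2) (b 3)) :=
    Fits.of_forall hcard fun a => Fits.map (fits_readRecord _ _) _
  exact (Fits.bind (fits_readRecord _ _) h2).mono (by omega)

end Prog

end SecondaryIndex

namespace SecondaryIndex

/-! ### Writing the output -/

namespace Prog

variable {n B base A : ℕ}

/-- Append the gamma codes of the gaps in the next cell of a run to the output. The state consists
of the number of cells that have been processed, the length of the output and the end of the last
position. -/
noncomputable def outputStep (n B base A : ℕ) (run : Fin (A + 1) × Fin (A + 1))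
    (s : Fin (A + 1) × Fin (base + 1) × Fin (n + 1)) :
    Prog B (Fin (A + 1) × Fin (base + 1) × Fin (n + 1)) :=
  if s.1 < run.2 then
    (readCell n base (run.1 + s.1)).bind fun c =>
      (writeWorkAt s.2.1 (gammas (gapsFrom s.2.2 c.1.1.sort))).map fun _ =>
        (clamp A (s.1 + 1), clamp base (s.2.1 + (gammas (gapsFrom s.2.2 c.1.1.sort)).length),
          clamp n (endFrom s.2.2 c.1.1.sort))
  else ret s

/-- Write the flag `b` and then the gamma codes of the gaps in a run; return the number of bits. -/
noncomputable def output (n B base A : ℕ) (b : Bool) (run : Fin (A + 1) × Fin (A + 1)) :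
    Prog B ℕ :=
  (writeWorkAt 0 [b]).bind fun _ =>
    (iter (outputStep n B base A run) A (clamp A 0, clamp base 1, clamp n 0)).map fun s => s.2.1

theorem overwrite_map_range (W : Disk) (u v : List Bool) (hu : (List.range u.length).map W = u) :
    (List.range (u.length + v.length)).map (overwrite W u.length v) = u ++ v := by
  refine List.ext_getElem (by simp) fun i h1 h2 => ?_
  simp only [List.getElem_map, List.getElem_range, overwrite]
  split_ifs with h
  · rw [List.getElem_append_right h, List.getElem?_eq_getElem (by
      rw [List.length_append] at h2
      omega)]
    rfl
  · rw [List.getElem_append_left (by omega)]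
    have h3 : ((List.range u.length).map W)[i]'(by simp; omega) = u[i]'(by omega) := by
      simp only [hu]
    rw [← h3]
    simp

theorem exec_outputStep (hB0 : 0 < B) (D W : Disk) (run : Fin (A + 1) × Fin (A + 1))
    (s : Fin (A + 1) × Fin (base + 1) × Fin (n + 1)) (hs : s.1 < run.2) :
    Exec D (outputStep n B base A run s) W
      (clamp A (s.1 + 1), clamp base (s.2.1 +
          (gammas (gapsFrom s.2.2 (cell n B base W (run.1 + s.1)).1.1.sort)).length),
        clamp n (endFrom s.2.2 (cell n B base W (run.1 + s.1)).1.1.sort))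
      (overwrite W s.2.1 (gammas (gapsFrom s.2.2 (cell n B base W (run.1 + s.1)).1.1.sort)))
      (65 + 130) := by
  have hr := exec_readCell n hB0 D W base (run.1 + s.1)
  rw [outputStep, if_pos hs]
  generalize cell n B base W (run.1 + s.1) = c at hr ⊢
  refine hr.bind ((exec_writeWorkAt hB0 D W s.2.1 ?_).map _)
  have h1 := length_gammas_gapsFrom_le s.2.2 c.1.1
  have h2 : wt c.1.1 ≤ 40 * B := c.1.2.2
  omega

theorem exec_output (hB0 : 0 < B) (D W : Disk) (b : Bool) (run : Fin (A + 1) × Fin (A + 1))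
    (hrun : IsRun (cell n B base W) run.1 run.2)
    (hbase : 1 + wt (cellsUnion (cell n B base W) run.1 run.2) ≤ base) :
    ∃ (len : ℕ) (W' : Disk) (t : ℕ), Exec D (output n B base A b run) W len W' t ∧
      (List.range len).map W' =
        b :: gammas (gapsFrom 0 (cellsUnion (cell n B base W) run.1 run.2).sort) ∧
      t ≤ 130 + 195 * run.2 := by
  set V := cell n B base W with hV
  let out : ℕ → List Bool := fun i => b :: gammas (gapsFrom 0 (cellsUnion V run.1 i).sort)
  have hout : ∀ i ≤ (run.2 : ℕ), (out i).length ≤ base := by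
    intro i hi
    have h1 := length_gammas_gapsFrom_le 0 (cellsUnion V run.1 i)
    have h2 : wt (cellsUnion V run.1 i) ≤ wt (cellsUnion V run.1 run.2) := by
      refine wt_mono fun p hp => ?_
      rw [mem_cellsUnion] at hp ⊢
      obtain ⟨j, hj, hp⟩ := hp
      exact ⟨j, by omega, hp⟩
    simp only [out, List.length_cons]
    omega
  have hunion : ∀ i < (run.2 : ℕ), (cellsUnion V run.1 (i + 1)).sort
      = (cellsUnion V run.1 i).sort ++ (V (run.1 + i)).1.1.sort := by
    intro i hi
    rw [cellsUnion_succ]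
    refine sort_union_of_lt fun p hp p' hp' => ?_
    obtain ⟨j, hj, hp⟩ := mem_cellsUnion.1 hp
    exact hrun j i hj hi p hp p' hp'
  let I : ℕ → Fin (A + 1) × Fin (base + 1) × Fin (n + 1) → Disk → ℕ → Prop := fun k s W' c =>
    (s.1 : ℕ) + k = run.2 ∧ (s.2.1 : ℕ) = (out s.1).length ∧
    (s.2.2 : ℕ) = endFrom 0 (cellsUnion V run.1 s.1).sort ∧
    (List.range (out s.1).length).map W' = out s.1 ∧ (∀ b ≥ base, W' b = W b) ∧ c = 195 * s.1
  have e0 : ((clamp A 0 : Fin (A + 1)) : ℕ) = 0 := clamp_val (Nat.zero_le _)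
  have e1 : ((clamp base 1 : Fin (base + 1)) : ℕ) = 1 := clamp_val (by omega)
  have e2 : ((clamp n 0 : Fin (n + 1)) : ℕ) = 0 := clamp_val (Nat.zero_le _)
  have hc0 : cellsUnion V run.1 0 = ∅ := by simp [cellsUnion]
  have ho0 : out 0 = [b] := by simp [out, hc0, gammas, gapsFrom]
  have h0 := exec_writeWorkAt hB0 D W 0 (s := [b]) (by simp; omega)
  have hW0 : (List.range 1).map (overwrite W 0 [b]) = [b] :=
    overwrite_map_range W [] [b] rfl
  obtain ⟨⟨i, pos, last⟩, W', t, h1, h2, h3, h4, h5, h6, h7⟩ := Exec.iter (D := D)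
    (f := outputStep n B base A run) I
    (fun k s W₁ c ⟨g1, g2, g3, g4, g5, g6⟩ => by
      obtain ⟨i, pos, last⟩ := s
      simp only at g1 g2 g3 g4 g6
      have hi : (i : ℕ) < run.2 := by omega
      have hcell : cell n B base W₁ (run.1 + i) = V (run.1 + i) := cell_congr g5
      set S := (V (run.1 + i)).1.1 with hS
      have hnext : out (i + 1) = out i ++ gammas (gapsFrom last S.sort) := by
        simp only [out]
        rw [hunion i hi, gapsFrom_append, gammas_append, g3]
        rfl
      have hlen : (out (i + 1)).length = (out i).length + (gammas (gapsFrom last S.sort)).length := by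
        rw [hnext, List.length_append]
      have hle := hout (i + 1) hi
      have hend : endFrom last S.sort = endFrom 0 (cellsUnion V run.1 (i + 1)).sort := by
        rw [hunion i hi, endFrom_append, g3]
      have hendn : endFrom last S.sort ≤ n := by
        rw [hend, endFrom_sort]
        refine Finset.sup_le fun p hp => ?_
        obtain ⟨j, _, hp⟩ := mem_cellsUnion.1 hp
        exact lt_of_mem_cell hp
      have e3 : ((clamp A (i + 1) : Fin (A + 1)) : ℕ) = i + 1 := clamp_val (by
        have := run.2.2
        omega)
      have e4 : ((clamp base (pos + (gammas (gapsFrom last S.sort)).length) : Fin (base + 1)) : ℕ)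
          = pos + (gammas (gapsFrom last S.sort)).length := clamp_val (by omega)
      have e5 : ((clamp n (endFrom last S.sort) : Fin (n + 1)) : ℕ) = endFrom last S.sort :=
        clamp_val hendn
      refine ⟨(clamp A (i + 1), clamp base (pos + (gammas (gapsFrom last S.sort)).length),
        clamp n (endFrom last S.sort)), overwrite W₁ pos (gammas (gapsFrom last S.sort)), 65 + 130,
        k, ?_, le_rfl, ?_, ?_, ?_, ?_, ?_, ?_⟩
      · have hex := exec_outputStep (n := n) (base := base) hB0 D W₁ run (i, pos, last) hi
        simp only [hcell, ← hS] at hex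
        exact hex
      · simp only [e3]
        omega
      · simp only [e3]
        rw [e4, hlen, g2]
      · simp only [e3]
        rw [e5, hend]
      · simp only [e3]
        rw [hlen, g2, hnext]
        exact overwrite_map_range W₁ _ _ g4
      · intro b hb
        rw [← g5 b hb, overwrite]
        split_ifs with h
        · rw [List.getElem?_eq_none (by omega)]
          rfl
        · rfl
      · simp only [e3]
        omega)
    (fun s W₁ c ⟨g1, _⟩ => by
      rw [outputStep, if_neg]
      rw [Fin.lt_def]
      omega)
    A (k := run.2) (a := (clamp A 0, clamp base 1, clamp n 0)) (W := overwrite W 0 [b]) (c := 0)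
    ⟨by simp [e0], by simp [e0, e1, ho0], by simp [e0, e2, hc0, endFrom], by
      simp only [e0, ho0]
      exact hW0, fun b' hb => by
      rw [overwrite, if_pos (Nat.zero_le _), List.getElem?_eq_none (by simp; omega)]
      rfl, by simp [e0]⟩ (Nat.lt_succ_iff.1 run.2.2)
  simp only at h2 h3 h4 h5 h7
  rw [show (i : ℕ) = run.2 by omega] at h3 h5 h7
  have hex : Exec D (output n B base A b run) W pos W' (130 + t) := by
    unfold output
    exact h0.bind (Exec.map (fun s : Fin (A + 1) × Fin (base + 1) × Fin (n + 1) => (s.2.1 : ℕ)) h1)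
  refine ⟨pos, W', 130 + t, hex, ?_, by omega⟩
  rw [h3]
  exact h5

theorem fits_output {a v : ℕ} (hA : A < 2 ^ a) (hn : n ≤ A) (hv : base < 2 ^ v) (b : Bool)
    (run : Fin (A + 1) × Fin (A + 1)) :
    Fits₁ (a + ((a + (v + a)) + (65 * (B + 1) + ((40 * B + 2) + 65 * (B + 2)) + 1)) + 65 * (B + 2)
      + 1) (output n B base A b run) := by
  have hcard : Fintype.card (Fin (A + 1) × Fin (base + 1) × Fin (n + 1)) ≤ 2 ^ (a + (v + a)) := by
    rw [Fintype.card_prod, Fintype.card_prod, pow_add, pow_add]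
    exact Nat.mul_le_mul (card_fin_succ_le hA)
      (Nat.mul_le_mul (card_fin_succ_le hv) (card_fin_succ_le (by omega)))
  have hstep : Fits ((a + (v + a)) + (65 * (B + 1) + ((40 * B + 2) + 65 * (B + 2)) + 1))
      (outputStep n B base A run) := by
    refine Fits.of_forall hcard fun s => ?_
    unfold outputStep
    by_cases h : s.1 < run.2
    · simp only [if_pos h]
      have h2 : Fits ((40 * B + 2) + 65 * (B + 2)) fun c : Cell n B =>
          (writeWorkAt (B := B) s.2.1 (gammas (gapsFrom s.2.2 c.1.1.sort))).map fun _ =>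
            (clamp A (s.1 + 1), clamp base (s.2.1 + (gammas (gapsFrom s.2.2 c.1.1.sort)).length),
              clamp n (endFrom s.2.2 c.1.1.sort)) :=
        Fits.of_forall (card_cell_le n B) fun c => Fits.map (fits_writeWorkAt _ _) _
      exact (Fits.bind (fits_readCell n base _) h2).mono (by omega)
    · simp only [if_neg h]
      exact (Fits₁.ret s).mono (Nat.zero_le _)
  have h := Fits.iter hcard hstep hA
  rw [max_eq_left (by omega)] at h
  have h2 : Fits (a + ((a + (v + a)) + (65 * (B + 1) + ((40 * B + 2) + 65 * (B + 2)) + 1)))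
      fun _ : Unit =>
        (iter (outputStep n B base A run) A (clamp A 0, clamp base 1, clamp n 0)).map
          fun s => (s.2.1 : ℕ) := Fits.map (h.fits₁ _) _
  exact (Fits.bind (fits_writeWorkAt 0 [b]) h2).mono (by omega)

end Prog

end SecondaryIndex

namespace SecondaryIndex

/-! ### The query algorithm -/

/-- The ranges of characters that make up the query range `l ≤ c ≤ r` or, if `comp` is set, its
complement. -/
def ranges (σ l r : ℕ) (comp second : Bool) : ℕ × ℕ :=
  if comp then if second then (r + 1, σ) else (0, l)
  else if second then (0, 0) else (l, r + 1)

theorem ranges_le {σ l r : ℕ} (hr : r < σ) (hl : l < σ) (comp second : Bool) :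
    (ranges σ l r comp second).1 ≤ σ ∧ (ranges σ l r comp second).2 ≤ σ := by
  cases comp <;> cases second <;> simp [ranges] <;> omega

theorem sum_range_four_mul (f : ℕ → Bool → Bool → ℕ) (J : ℕ) :
    ∑ i ∈ Finset.range (4 * J), f (i / 4) (decide (i / 2 % 2 = 1)) (decide (i % 2 = 1))
      = ∑ b, ∑ j ∈ Finset.range J, ∑ b', f j b b' := by
  rw [Finset.sum_comm]
  induction J with
  | zero => simp
  | succ J ih =>
    rw [Finset.sum_range_succ, ← ih, Nat.mul_succ]
    simp only [Finset.sum_range_succ, Fintype.sum_bool]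
    rw [show 4 * J / 4 = J by omega, show (4 * J + 1) / 4 = J by omega,
      show (4 * J + 2) / 4 = J by omega, show (4 * J + 3) / 4 = J by omega,
      show 4 * J / 2 % 2 = 0 by omega, show (4 * J + 1) / 2 % 2 = 0 by omega,
      show (4 * J + 2) / 2 % 2 = 1 by omega, show (4 * J + 3) / 2 % 2 = 1 by omega,
      show 4 * J % 2 = 0 by omega, show (4 * J + 1) % 2 = 1 by omega,
      show (4 * J + 2) % 2 = 0 by omega, show (4 * J + 3) % 2 = 1 by omega]
    simp only [zero_ne_one, decide_false, decide_true]
    ring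

theorem exists_lt_four_mul {J : ℕ} (P : ℕ → Bool → Bool → Prop) :
    (∃ i < 4 * J, P (i / 4) (decide (i / 2 % 2 = 1)) (decide (i % 2 = 1))) ↔
      ∃ b, ∃ j < J, ∃ b', P j b b' := by
  constructor
  · rintro ⟨i, hi, h⟩
    exact ⟨_, i / 4, by omega, _, h⟩
  · rintro ⟨b, j, hj, b', h⟩
    refine ⟨4 * j + 2 * b.toNat + b'.toNat, ?_, ?_⟩
    · cases b <;> cases b' <;> simp <;> omega
    · have h1 : (4 * j + 2 * b.toNat + b'.toNat) / 4 = j := by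
        cases b <;> cases b' <;> simp <;> omega
      have h2 : decide ((4 * j + 2 * b.toNat + b'.toNat) / 2 % 2 = 1) = b := by
        cases b <;> cases b' <;> simp <;> omega
      have h3 : decide ((4 * j + 2 * b.toNat + b'.toNat) % 2 = 1) = b' := by
        cases b <;> cases b' <;> simp <;> omega
      rw [h1, h2, h3]
      exact h

theorem sum_map_range' (f : ℕ → ℕ) (u v : ℕ) :
    ((List.range' u (v - u)).map f).sum = ∑ i ∈ Finset.Ico u v, f i := by
  rw [Finset.sum]
  change _ = (Multiset.map f (List.range' u (v - u) : Multiset ℕ)).sum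
  rw [Multiset.map_coe, Multiset.sum_coe]

section

variable (y : ℕ → ℕ) {n σ : ℕ}

theorem sum_block (f : Finset ℕ → ℕ) {j u v : ℕ} (hv : v ≤ σ) :
    ((List.range' (j * σ + u) (j * σ + v - (j * σ + u))).map fun i => f (block y n σ i)).sum
      = ∑ c ∈ Finset.Ico u v, f (piece y n σ (j + 1) c) := by
  rw [sum_map_range', Nat.add_comm _ u, Nat.add_comm _ v, ← Finset.sum_Ico_add']
  refine Finset.sum_congr rfl fun c hc => ?_
  rw [Nat.add_comm, block_add y ((Finset.mem_Ico.1 hc).2.trans_le hv)]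

variable (n σ)

/-- The tokens of one of the groups of blocks. -/
def segmentToks (l e j : ℕ) (right : Bool) : List Tok :=
  blockToks y n σ (j * σ + (segment y n σ l e j right).1) (j * σ + (segment y n σ l e j right).2)

/-- The positions in one of the groups of blocks. -/
def segmentSet (l e j : ℕ) (right : Bool) : Finset ℕ :=
  (Finset.Ico (segment y n σ l e j right).1 (segment y n σ l e j right).2).biUnion
    fun c => piece y n σ (j + 1) c

variable {n σ}

theorem segmentToks_bounds (l e j : ℕ) (right : Bool) :
    ∀ t ∈ segmentToks y n σ l e j right, 0 < t.2 ∧ t.2 ≤ n := by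
  intro t ht
  obtain ⟨S, hS, ht⟩ := List.mem_flatMap.1 ht
  obtain ⟨i, -, rfl⟩ := List.mem_map.1 hS
  exact ⟨toks_pos _ t ht, toks_le (fun p hp => lt_of_mem_piece y hp) t ht⟩

theorem length_toksCode_segmentToks {l e j : ℕ} (he : e ≤ σ) (right : Bool) :
    (toksCode (segmentToks y n σ l e j right)).length = segmentWt y n σ l e j right := by
  rw [segmentToks, blockToks, length_toksCode_flatMap_toks, List.map_map]
  exact sum_block y wt (segment_snd_le y he right)

theorem length_segmentToks_le {l e j : ℕ} (he : e ≤ σ) (right : Bool) :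
    (segmentToks y n σ l e j right).length ≤ segmentCard y n σ l e j right := by
  have h : (segmentToks y n σ l e j right).length
      = ∑ c ∈ Finset.Ico (segment y n σ l e j right).1 (segment y n σ l e j right).2,
          (piece y n σ (j + 1) c).card := by
    rw [segmentToks, blockToks, List.length_flatMap, List.map_map]
    simp only [Function.comp_def, length_toks]
    exact sum_block y Finset.card (segment_snd_le y he right)
  rw [h]
  exact sum_card_piece_le y (isBoundary_segment y l e j right).2

theorem flags_segmentToks_le {l e j : ℕ} (he : e ≤ σ) (right : Bool) :
    flags (segmentToks y n σ l e j right) ≤ σ := by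
  refine (flags_flatMap_toks_le _).trans ?_
  rw [List.length_map, List.length_range']
  have := segment_snd_le y (n := n) (l := l) (j := j) he right
  omega

theorem dec_segmentToks {l e j : ℕ} (he : e ≤ σ) (right : Bool) (c : ℕ) :
    (dec c (segmentToks y n σ l e j right)).toFinset = segmentSet y n σ l e j right := by
  have hv := segment_snd_le y (n := n) (l := l) (j := j) he right
  ext p
  rw [List.mem_toFinset, segmentToks, blockToks, mem_dec_flatMap_toks, segmentSet,
    Finset.mem_biUnion]
  constructor
  · rintro ⟨S, hS, hp⟩
    obtain ⟨i, hi, rfl⟩ := List.mem_map.1 hS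
    rw [List.mem_range'_1] at hi
    obtain ⟨c, rfl⟩ := Nat.exists_eq_add_of_le (show j * σ ≤ i by omega)
    rw [block_add y (by omega)] at hp
    exact ⟨c, Finset.mem_Ico.2 ⟨by omega, by omega⟩, hp⟩
  · rintro ⟨c, hc, hp⟩
    rw [Finset.mem_Ico] at hc
    rw [← block_add y (hc.2.trans_le hv)] at hp
    exact ⟨_, List.mem_map_of_mem (List.mem_range'_1.2 ⟨by omega, by omega⟩), hp⟩

/-- The union of all groups of blocks for the ranges of a query. -/
theorem biUnion_segmentSet {l r : ℕ} (hl : l < σ) (hr : r < σ) (comp : Bool)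
    (hfull : comp = false → 0 < l ∨ r + 1 < σ) :
    ((Finset.range (4 * levels n)).biUnion fun i => segmentSet y n σ
        (ranges σ l r comp (decide (i / 2 % 2 = 1))).1
        (ranges σ l r comp (decide (i / 2 % 2 = 1))).2 (i / 4) (decide (i % 2 = 1)))
      = interval y n (ranges σ l r comp false).1 (ranges σ l r comp false).2 ∪
        interval y n (ranges σ l r comp true).1 (ranges σ l r comp true).2 := by
  have hne : ∀ b, 0 < (ranges σ l r comp b).1 ∨ (ranges σ l r comp b).2 < σ := by
    intro b
    cases comp <;> cases b <;> simp [ranges] <;> first | omega | (have := hfull rfl; omega)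
  ext p
  simp only [Finset.mem_biUnion, Finset.mem_range, segmentSet, Finset.mem_Ico, Finset.mem_union,
    mem_interval]
  have h := exists_lt_four_mul (J := levels n) fun j b b' => ∃ c,
    ((segment y n σ (ranges σ l r comp b).1 (ranges σ l r comp b).2 j b').1 ≤ c ∧
      c < (segment y n σ (ranges σ l r comp b).1 (ranges σ l r comp b).2 j b').2) ∧
      p ∈ piece y n σ (j + 1) c
  rw [h]
  simp only [and_assoc]
  have key := fun b => mem_segments_iff_of_lt y (n := n) (hne b) (ranges_le hr hl comp b).2
    lt_two_pow_expo_levels p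
  simp only [key]
  rw [Bool.exists_bool]

end

namespace Prog

variable {n B base A F σ : ℕ}

/-- Find out whether the answer to the query has more than `n / 2` elements. -/
noncomputable def isLarge (n l r : ℕ) : Prog B Bool :=
  (readRecord (width n) (l * levels n)).bind fun a =>
    (readRecord (width n) ((r + 1) * levels n)).map fun b =>
      decide (n < 2 * ((b 0 : ℕ) - (a 0 : ℕ)))

/-- The groups of blocks for a query, in one sequence. -/
noncomputable def queryBounds (n σ l r : ℕ) (comp : Bool) (i : ℕ) :
    Prog B (Fin (2 ^ width n + 1) × Fin (2 ^ width n + 1)) :=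
  segmentBounds n (ranges σ l r comp (decide (i / 2 % 2 = 1))).1
    (ranges σ l r comp (decide (i / 2 % 2 = 1))).2 (i / 4) (decide (i % 2 = 1))

/-- The query algorithm: convert the blocks to cells, sort them, and write the output. -/
noncomputable def query (n σ B base A F d l r : ℕ) : Prog B ℕ :=
  (isLarge n l r).bind fun comp =>
    (readSegments n B base A (2 ^ width n) (tableLen n σ) (4 * levels n)
      (queryBounds n σ l r comp)).bind fun N =>
        (sort n B base A F N d (clamp A 0, N)).bind fun s => output n B base A comp s.1

theorem exec_isLarge (y : ℕ → ℕ) (hn : 2 ≤ n) (hB0 : 0 < B) (hB : 5 * width n ≤ 64 * B) (W : Disk)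
    {l r : ℕ} (hl : l < σ) (hr : r < σ) :
    Exec (B := B) (diskOf (encode y n σ)) (isLarge n l r) W
      (decide (n < 2 * (below y n (r + 1) - below y n l))) W 130 := by
  have hrec : ∀ c ≤ σ, c * levels n < (σ + 1) * levels n := fun c hc =>
    Nat.mul_lt_mul_of_pos_right (by omega) levels_pos
  have hent : ∀ c ≤ σ, ((clamp (2 ^ width n) (entry y n σ (5 * (c * levels n) + ((0 : Fin 5) : ℕ)))
      : Fin (2 ^ width n + 1)) : ℕ) = below y n c := by
    intro c hc
    have h1 : 5 * (c * levels n) / 5 / levels n = c := by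
      rw [Nat.mul_div_cancel_left _ (by norm_num), Nat.mul_div_cancel _ levels_pos]
    have h2 : entry y n σ (5 * (c * levels n) + ((0 : Fin 5) : ℕ)) = below y n c := by
      simp only [entry, Fin.val_zero, Nat.add_zero, Nat.mul_mod_right, h1]
    rw [clamp_val, h2]
    refine (entry_le y hn ?_).le
    rw [Fin.val_zero, Nat.add_zero, Nat.mul_div_cancel_left _ (by norm_num)]
    exact hrec c hc
  have h := (exec_readRecord (B := B) y hn hB0 hB W (hrec l hl.le)).bind
    (f := fun a => (readRecord (width n) ((r + 1) * levels n)).map fun b =>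
      decide (n < 2 * ((b 0 : ℕ) - (a 0 : ℕ))))
    ((exec_readRecord (B := B) y hn hB0 hB W (hrec (r + 1) hr)).map _)
  simp only [hent l hl.le, hent (r + 1) hr] at h
  exact h

theorem exec_query (y : ℕ → ℕ) (hn : 2 ≤ n) (hB0 : 0 < B) (hB : 2 * Nat.size n ≤ 4 * B)
    (hB' : 5 * width n ≤ 64 * B) {d : ℕ} (hA : (3 * d + 5) * (n + 1) ≤ A)
    (hF : 8 * levels n * σ + 2 ≤ F ^ d) (hbase : 1 + n * (2 * Nat.size n) ≤ base)
    {l r : ℕ} (hl : l < σ) (hr : r < σ) (W : Disk) {comp : Bool}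
    (hcomp : comp = decide (n < 2 * (below y n (r + 1) - below y n l)))
    (hfull : comp = false → 0 < l ∨ r + 1 < σ) :
    ∃ (len : ℕ) (W' : Disk) (t N : ℕ),
      Exec (diskOf (encode y n σ)) (query n σ B base A F d l r) W len W' t ∧
      (List.range len).map W' = comp :: gammas (gapsFrom 0
        (interval y n (ranges σ l r comp false).1 (ranges σ l r comp false).2 ∪
          interval y n (ranges σ l r comp true).1 (ranges σ l r comp true).2).sort) ∧
      N ≤ ∑ b, (below y n (ranges σ l r comp b).2 - below y n (ranges σ l r comp b).1) ∧
      16 * B * N ≤ (∑ b, ∑ j ∈ Finset.range (levels n), ∑ right,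
        segmentWt y n σ (ranges σ l r comp b).1 (ranges σ l r comp b).2 j right)
          + 64 * B * levels n ∧
      t ≤ 260 + 520 * levels n + (910 + 780 * d) * N := by
  have hR := fun b => ranges_le (σ := σ) hr hl comp b
  have hsum : ∑ i ∈ Finset.range (4 * levels n), (segmentToks y n σ
      (ranges σ l r comp (decide (i / 2 % 2 = 1))).1
      (ranges σ l r comp (decide (i / 2 % 2 = 1))).2 (i / 4) (decide (i % 2 = 1))).length ≤
      ∑ b, (below y n (ranges σ l r comp b).2 - below y n (ranges σ l r comp b).1) := by
    rw [sum_range_four_mul fun j b b' =>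
      (segmentToks y n σ (ranges σ l r comp b).1 (ranges σ l r comp b).2 j b').length]
    refine Finset.sum_le_sum fun b _ => le_trans ?_ (sum_segmentCard_le y (σ := σ) _ _ (levels n))
    exact Finset.sum_le_sum fun j _ => Finset.sum_le_sum fun b' _ =>
      length_segmentToks_le y (hR b).2 b'
  have hle : ∑ b, (below y n (ranges σ l r comp b).2 - below y n (ranges σ l r comp b).1) ≤ n := by
    have h1 := below_le y (n := n) (r + 1)
    have h2 := below_le y (n := n) σ
    cases hc : comp
    · simp only [Fintype.sum_bool, ranges, Bool.false_eq_true, if_false, if_true]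
      omega
    · rw [hc, eq_comm, decide_eq_true_eq] at hcomp
      have h3 : below y n l ≤ below y n (r + 1) := by omega
      simp only [Fintype.sum_bool, ranges, Bool.false_eq_true, if_false, if_true]
      omega
  have hj : ∀ i < 4 * levels n, i / 4 < levels n := fun i hi => by omega
  have hoff : ∀ j c, j < levels n → c ≤ σ → offset y n σ (j * σ + c) ≤ 2 ^ width n := by
    intro j c hj hc
    refine (offset_le y hn ?_).le
    have := Nat.mul_le_mul_right σ (show j + 1 ≤ levels n from hj)
    rw [Nat.succ_mul] at this
    omega
  obtain ⟨N, W₁, t₁, h1, h2, h3, h4, h5, h6, h7, h8⟩ := exec_readSegments (n := n) (B := B)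
    (base := base) (A := A) (X := 2 ^ width n) (by omega) hB (diskOf (encode y n σ)) W
    (tb := tableLen n σ) (K := 4 * levels n) (bounds := queryBounds n σ l r comp)
    (L := fun i => segmentToks y n σ (ranges σ l r comp (decide (i / 2 % 2 = 1))).1
      (ranges σ l r comp (decide (i / 2 % 2 = 1))).2 (i / 4) (decide (i % 2 = 1)))
    (U := fun i => segmentSet y n σ (ranges σ l r comp (decide (i / 2 % 2 = 1))).1
      (ranges σ l r comp (decide (i / 2 % 2 = 1))).2 (i / 4) (decide (i % 2 = 1)))
    (fun i hi W => exec_segmentBounds y hn hB0 hB' W (hR _).1 (hR _).2 (hj i hi) _)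
    (fun i _ => segmentToks_bounds y _ _ _ _)
    (fun i hi => by
      rw [clamp_val (hoff _ _ (hj i hi) (segment_fst_le y (hR _).1 (hR _).2 _)),
        clamp_val (hoff _ _ (hj i hi) (segment_snd_le y (hR _).2 _)), segmentToks,
        length_toksCode_blockToks])
    (fun i hi t ht => by
      rw [clamp_val (hoff _ _ (hj i hi) (segment_fst_le y (hR _).1 (hR _).2 _)), Nat.add_assoc,
        diskOf_encode_stream y hn]
      refine stream_getD y ?_ ht
      have h1 := Nat.mul_le_mul_right σ (show i / 4 + 1 ≤ levels n from hj i hi)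
      have h2 := segment_snd_le y (n := n) (l := (ranges σ l r comp (decide (i / 2 % 2 = 1))).1)
        (j := i / 4) (hR (decide (i / 2 % 2 = 1))).2 (decide (i % 2 = 1))
      rw [Nat.succ_mul] at h1
      omega)
    (fun i _ c => dec_segmentToks y (hR _).2 _ c)
    (fun i _ p hp => by
      obtain ⟨c, _, hp⟩ := Finset.mem_biUnion.1 hp
      exact lt_of_mem_piece y hp)
    (hsum.trans (hle.trans (by nlinarith)))
  rw [biUnion_segmentSet y hl hr comp hfull] at h4
  have h6 := h6.trans hsum
  rw [sum_range_four_mul fun j b b' => (toksCode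
    (segmentToks y n σ (ranges σ l r comp b).1 (ranges σ l r comp b).2 j b')).length] at h7
  simp only [length_toksCode_segmentToks y (hR _).2] at h7
  have hNn : (N : ℕ) ≤ n := h6.trans hle
  have hdN : 3 * d * (N : ℕ) ≤ 3 * d * n := Nat.mul_le_mul_left _ hNn
  have hA' : 3 * d * n + 5 * n + 5 ≤ A := by nlinarith
  have e0 : ((clamp A 0 : Fin (A + 1)) : ℕ) = 0 := clamp_val (Nat.zero_le _)
  have hflags : ∑ i ∈ Finset.range (4 * levels n), flags
      (segmentToks y n σ (ranges σ l r comp (decide (i / 2 % 2 = 1))).1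
      (ranges σ l r comp (decide (i / 2 % 2 = 1))).2 (i / 4) (decide (i % 2 = 1)))
      ≤ 4 * levels n * σ := by
    refine (Finset.sum_le_card_nsmul _ _ σ fun i _ => flags_segmentToks_le y (hR _).2 _).trans ?_
    rw [Finset.card_range, smul_eq_mul]
  obtain ⟨run, p', q', W₂, t₂, k1, k2, k3, k4, k5, k6, k7, k8, k9, k10, k11, k12, k13, k14⟩ :=
    exec_sort (n := n) (B := B) (base := base) (A := A) (F := F) (diskOf (encode y n σ)) (by omega)
      (by omega) hB (N := N) d W₁ (clamp A 0) N (by omega) le_rfl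
      (by rw [e0, Nat.sub_zero]; omega) h2
      (by
        rw [e0]
        exact h3.imp Eq.symm id)
  have hp' : (p' : ℕ) = N := by
    refine k5.resolve_right fun h => ?_
    have a1 := starts_add (cell n B base W₁) (Nat.zero_le (p' : ℕ)) k3
    rw [e0] at h
    have a2 : 8 * levels n * σ = 2 * (4 * levels n * σ) := by ring
    omega
  rw [e0, hp', Nat.sub_zero] at k12 k13 k14
  rw [h4] at k12
  have hsub : interval y n (ranges σ l r comp false).1 (ranges σ l r comp false).2 ∪
      interval y n (ranges σ l r comp true).1 (ranges σ l r comp true).2 ⊆ Finset.range n :=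
    Finset.union_subset (Finset.filter_subset _ _) (Finset.filter_subset _ _)
  have hwt := wt_le_card_mul (n := n) fun p hp => Finset.mem_range.1 (hsub hp)
  have hcard := Finset.card_le_card hsub
  rw [Finset.card_range] at hcard
  obtain ⟨len, W₃, t₃, m1, m2, m3⟩ := exec_output (n := n) (base := base) hB0
    (diskOf (encode y n σ)) W₂ comp run k11 (by
      rw [k12]
      have := Nat.mul_le_mul_right (2 * Nat.size n) hcard
      omega)
  rw [k12] at m2
  have hex := exec_isLarge (B := B) y hn hB0 hB' W hl hr
  rw [← hcomp] at hex
  refine ⟨len, W₃, 130 + (t₁ + (t₂ + t₃)), N, ?_, m2, h6, ?_, ?_⟩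
  · unfold query
    exact hex.bind (h1.bind (k1.bind m1))
  · have : 16 * B * (4 * levels n) = 64 * B * levels n := by ring
    omega
  · have : (910 + 780 * d) * (N : ℕ) = 780 * N + (130 + 780 * d) * N := by ring
    omega

/-- The query algorithm needs `O(F)` blocks of memory, for constant `d`, and a place for the
query. -/
theorem fits_query {a w v : ℕ} (hB0 : 0 < B) (hA : A < 2 ^ a) (hn : n ≤ A)
    (hJ : 4 * levels n < 2 ^ a) (hv : base < 2 ^ v) (hσ : σ < 2 ^ w) (ha : a ≤ 4 * B)
    (hvB : v ≤ 4 * B) (hw : width n + 1 ≤ 9 * B) (d : ℕ) :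
    Fits (w + w + 2000 * ((d + 1) * (F + 1) * B))
      fun p : Fin σ × Fin σ => query n σ B base A F d p.1 p.2 := by
  have hcard : Fintype.card (Fin σ × Fin σ) ≤ 2 ^ (w + w) := by
    rw [Fintype.card_prod, Fintype.card_fin, pow_add]
    exact Nat.mul_le_mul hσ.le hσ.le
  refine Fits.of_forall hcard fun p => ?_
  have hX : 2 ^ width n < 2 ^ (width n + 1) := Nat.pow_lt_pow_right (by norm_num) (Nat.lt_succ_self _)
  have hrec : Fintype.card (Fin 5 → Fin (2 ^ width n + 1)) ≤ 2 ^ ((width n + 1) * 5) := by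
    rw [Fintype.card_fun, Fintype.card_fin 5, pow_mul]
    exact Nat.pow_le_pow_left (card_fin_succ_le hX) _
  have hres : Fintype.card ((Fin (A + 1) × Fin (A + 1)) × (Fin (A + 1) × Fin (A + 1))) ≤
      2 ^ ((a + a) + (a + a)) := by
    rw [Fintype.card_prod, Fintype.card_prod, pow_add, pow_add]
    have := card_fin_succ_le hA
    exact Nat.mul_le_mul (Nat.mul_le_mul this this) (Nat.mul_le_mul this this)
  have f0 : Fits₁ ((width n + 1) * 5 + 65 * (B + 1) + 1) (isLarge (B := B) n p.1 p.2) := by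
    have h2 : Fits ((width n + 1) * 5 + 65 * (B + 1)) fun a : Fin 5 → Fin (2 ^ width n + 1) =>
        (readRecord (B := B) (width n) ((p.2 + 1) * levels n)).map fun b =>
          decide (n < 2 * ((b 0 : ℕ) - (a 0 : ℕ))) :=
      Fits.of_forall hrec fun a => Fits.map (fits_readRecord _ _) _
    exact (Fits.bind (fits_readRecord _ _) h2).mono (by omega)
  have f1 := fun comp => fits_readSegments (n := n) (B := B) (base := base) (tb := tableLen n σ) hA
    hn hX hJ (bounds := queryBounds n σ p.1 p.2 comp) fun i _ => fits_segmentBounds n _ _ _ _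
  have f2 := fun N => fits_sort (n := n) (B := B) (base := base) (F := F) hA hn N d
  have f3 := fun comp run => fits_output (n := n) (B := B) (base := base) hA hn hv comp run
  generalize hS0 : (width n + 1) * 5 + 65 * (B + 1) + 1 = S0 at f0 f1
  generalize hS1 : a + ((a + (a + (1 + a))) + (S0 + (((width n + 1) + (width n + 1)) +
    (a + (((width n + 1) + (width n + 1)) + (a + (1 + a)) + (64 * B + 65 * (B + 2) + 1)))) + 1))
    = S1 at f1
  generalize hS2 : d * (F + (F + (2 * a * F + 2 * a)) + 2) +
    (a + (a + (a + (a + 1 + 65 * (B + 1) + 1)) + ((F + (2 * a * F + 2 * a)) +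
      (a + (a + (a * 3 * F + ((F + 2) * (40 * B) + 1 + a) + (65 * (B + 2)) + 2)))))) = S2 at f2
  generalize hS3 : a + ((a + (v + a)) + (65 * (B + 1) + ((40 * B + 2) + 65 * (B + 2)) + 1))
    + 65 * (B + 2) + 1 = S3 at f3
  have g3 : ∀ comp, Fits ((a + a) + (a + a) + S3)
      fun s : (Fin (A + 1) × Fin (A + 1)) × (Fin (A + 1) × Fin (A + 1)) =>
        output n B base A comp s.1 := fun comp => Fits.of_forall hres fun s => f3 comp s.1
  have g2 : ∀ comp, Fits (a + (max S2 ((a + a) + (a + a) + S3) + 1)) fun N : Fin (A + 1) =>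
      (sort n B base A F N d (clamp A 0, N)).bind fun s => output n B base A comp s.1 :=
    fun comp => Fits.of_forall (card_fin_succ_le hA) fun N =>
      Fits.bind ((f2 N).fits₁ (clamp A 0, N)) (g3 comp)
  have g1 : Fits (1 + (max S1 (a + (max S2 ((a + a) + (a + a) + S3) + 1)) + 1)) fun comp =>
      (readSegments n B base A (2 ^ width n) (tableLen n σ) (4 * levels n)
        (queryBounds n σ p.1 p.2 comp)).bind fun N =>
          (sort n B base A F N d (clamp A 0, N)).bind fun s => output n B base A comp s.1 :=
    Fits.of_forall (by simp) fun comp => Fits.bind (f1 comp) (g2 comp)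
  refine (Fits.bind f0 g1).mono (le_trans (b := S0 + S1 + S2 + S3 + 5 * a + 10) (by omega) ?_)
  have e1 : F ≤ F * B := Nat.le_mul_of_pos_right _ hB0
  have e2 : a * F ≤ 4 * (F * B) := by nlinarith
  have e3 : d * F ≤ d * (F * B) := Nat.mul_le_mul_left _ e1
  have e4 : d * (a * F) ≤ d * (4 * (F * B)) := Nat.mul_le_mul_left _ e2
  have e5 : d * a ≤ d * (4 * B) := Nat.mul_le_mul_left _ ha
  have e6 : d ≤ d * B := Nat.le_mul_of_pos_right _ hB0
  nlinarith

end Prog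

end SecondaryIndex

namespace SecondaryIndex

/-! ### The space bound -/

theorem lg_nonneg {t : ℝ} (ht : 1 ≤ t) : 0 ≤ lg t := Real.logb_nonneg (by norm_num) ht

theorem lg_mono {s t : ℝ} (hs : 0 < s) (h : s ≤ t) : lg s ≤ lg t :=
  Real.logb_le_logb_of_le (by norm_num) hs h

theorem lg_two : lg 2 = 1 := by simp [lg]

theorem lg_two_pow (m : ℕ) : lg (2 ^ m) = m := by
  rw [lg, Real.logb_pow, Real.logb_self_eq_one (by norm_num), mul_one]

theorem natLog_le_lg (m : ℕ) : (Nat.log 2 m : ℝ) ≤ lg m := by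
  have := Real.natLog_le_logb m 2
  exact_mod_cast this

theorem size_le_lg {n : ℕ} (hn : 0 < n) : (Nat.size n : ℝ) ≤ lg n + 1 := by
  rw [size_eq_log hn]
  push_cast
  linarith [natLog_le_lg n]

section

variable {n σ : ℕ}

/-- A string as a sequence of natural numbers; the values from `n` on do not matter. -/
def chars (x : Fin n → Fin σ) (p : ℕ) : ℕ := if h : p < n then (x ⟨p, h⟩ : ℕ) else 0

theorem chars_val (x : Fin n → Fin σ) (i : Fin n) : chars x i = x i := by
  rw [chars, dif_pos i.2]

theorem mult_chars (x : Fin n → Fin σ) (i : Fin n) : mult (chars x) n i = occ x (x i) := by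
  rw [mult, ← card_interval, occ, ← Finset.card_map Fin.valEmbedding]
  congr 1
  ext p
  simp only [mem_interval, chars_val, Finset.mem_map, Finset.mem_filter, Finset.mem_univ, true_and,
    Fin.valEmbedding_apply]
  constructor
  · rintro ⟨h1, h2, h3⟩
    refine ⟨⟨p, h1⟩, Fin.ext ?_, rfl⟩
    have := chars_val x ⟨p, h1⟩
    simp only at this
    omega
  · rintro ⟨j, hj, rfl⟩
    rw [chars_val, hj]
    exact ⟨j.2, le_rfl, Nat.lt_succ_self _⟩

theorem mul_entropy0 (hn : 0 < n) (x : Fin n → Fin σ) :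
    n * entropy0 x = ∑ i, lg ((n : ℝ) / occ x (x i)) := by
  have h1 : ∑ i, lg ((n : ℝ) / occ x (x i)) = ∑ a, (occ x a : ℝ) * lg ((n : ℝ) / occ x a) := by
    rw [← Finset.sum_fiberwise Finset.univ x]
    refine Finset.sum_congr rfl fun a _ => ?_
    rw [Finset.sum_congr rfl fun i hi => by rw [(Finset.mem_filter.1 hi).2], Finset.sum_const,
      nsmul_eq_mul]
    rfl
  rw [h1, entropy0, Finset.mul_sum]
  refine Finset.sum_congr rfl fun a _ => ?_
  have : (n : ℝ) ≠ 0 := by positivity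
  field_simp

theorem occ_pos (x : Fin n → Fin σ) (i : Fin n) : 0 < occ x (x i) :=
  Finset.card_pos.2 ⟨i, by simp⟩

theorem occ_le (x : Fin n → Fin σ) (a : Fin σ) : occ x a ≤ n := by
  have := Finset.card_le_univ (Finset.univ.filter fun i => x i = a)
  rwa [Fintype.card_fin] at this

theorem entropy0_nonneg (x : Fin n → Fin σ) : 0 ≤ n * entropy0 x := by
  rcases Nat.eq_zero_or_pos n with rfl | hn
  · simp
  · rw [mul_entropy0 hn]
    refine Finset.sum_nonneg fun i _ => lg_nonneg ?_
    have h1 : (occ x (x i) : ℝ) ≤ n := by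
      exact_mod_cast occ_le x (x i)
    have h2 : (0 : ℝ) < occ x (x i) := by exact_mod_cast occ_pos x i
    rwa [le_div_iff₀ h2, one_mul]

theorem length_stream_le (hn : 0 < n) (x : Fin n → Fin σ) :
    ((stream (chars x) n σ).length : ℝ) ≤ 16 * (n * entropy0 x) + 22 * n := by
  have h1 : (stream (chars x) n σ).length ≤
      16 * ∑ p ∈ Finset.range n, (Nat.log 2 (n / mult (chars x) n p) + 1) + 6 * n := by
    rw [stream, length_toksCode_blockToks, offset_eq]
    exact (Nat.sub_le _ _).trans (sum_wt_le _ _)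
  have h2 : ((∑ p ∈ Finset.range n, (Nat.log 2 (n / mult (chars x) n p) + 1) : ℕ) : ℝ) ≤
      n * entropy0 x + n := by
    rw [mul_entropy0 hn, Finset.sum_range, Nat.cast_sum]
    have h3 : ∑ _i : Fin n, (1 : ℝ) = n := by simp
    refine le_trans (b := ∑ i, (lg ((n : ℝ) / occ x (x i)) + 1)) ?_
      (by rw [Finset.sum_add_distrib, h3])
    refine Finset.sum_le_sum fun i _ => ?_
    rw [mult_chars]
    push_cast
    have hp := occ_pos x i
    have h4 : 0 < n / occ x (x i) := Nat.div_pos (occ_le x _) hp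
    have h5 := natLog_le_lg (n / occ x (x i))
    have h6 : lg ((n / occ x (x i) : ℕ) : ℝ) ≤ lg ((n : ℝ) / occ x (x i)) :=
      lg_mono (by exact_mod_cast h4) Nat.cast_div_le
    linarith
  have h3 : ((stream (chars x) n σ).length : ℝ) ≤ ((16 * ∑ p ∈ Finset.range n,
      (Nat.log 2 (n / mult (chars x) n p) + 1) + 6 * n : ℕ) : ℝ) := by exact_mod_cast h1
  rw [Nat.cast_add, Nat.cast_mul, Nat.cast_mul] at h3
  push_cast at h2 h3
  linarith

theorem levels_le_lg (hn : 4 ≤ n) : (levels n : ℝ) ≤ lg (lg n) + 2 := by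
  have h1 := natLog_le_lg (Nat.log 2 n)
  have h2 : 0 < Nat.log 2 n := Nat.log_pos (by norm_num) (by omega)
  have h3 : lg ((Nat.log 2 n : ℕ) : ℝ) ≤ lg (lg n) :=
    lg_mono (by exact_mod_cast h2) (natLog_le_lg n)
  rw [levels]
  push_cast
  linarith

theorem length_encode_le (x : Fin n → Fin σ) :
    ((encode (chars x) n σ).length : ℝ) ≤ 240 * (n * entropy0 x + n + σ * lg n ^ 2) := by
  have hent := entropy0_nonneg x
  rw [encode]
  split_ifs with hn
  · rw [List.length_nil, Nat.cast_zero]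
    positivity
  · rw [List.length_append, length_table, Nat.cast_add]
    have h1 := length_stream_le (by omega) x
    have hl : 1 ≤ lg n := by
      rw [← lg_two]
      exact lg_mono (by norm_num) (by exact_mod_cast (show 2 ≤ n by omega))
    have hs := size_le_lg (n := n) (by omega)
    have hJ : (levels n : ℝ) ≤ Nat.size n := by exact_mod_cast levels_le (show 2 ≤ n by omega)
    have hσ : (1 : ℝ) ≤ σ := by
      have := (x ⟨0, by omega⟩).pos
      exact_mod_cast this
    have h2 : (tableLen n σ : ℝ) ≤ (2 * σ) * (2 * lg n) * 5 * (8 * lg n) := by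
      rw [tableLen, width]
      push_cast
      have a1 : (σ : ℝ) + 1 ≤ 2 * σ := by linarith
      have a2 : (levels n : ℝ) ≤ 2 * lg n := by linarith
      have a3 : (3 : ℝ) * Nat.size n + 2 ≤ 8 * lg n := by linarith
      gcongr
    have h3 : (0 : ℝ) ≤ n := Nat.cast_nonneg n
    nlinarith

/-! ### The size of the output -/

theorem pow_div_le_choose {n k : ℕ} (hk : 0 < k) (hkn : k ≤ n) :
    ((n : ℝ) / k) ^ k ≤ n.choose k := by
  induction k generalizing n with
  | zero => omega
  | succ k ih =>
    obtain ⟨m, rfl⟩ : ∃ m, n = m + 1 := ⟨n - 1, by omega⟩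
    rcases Nat.eq_zero_or_pos k with rfl | hk0
    · simp
    · have h1 := ih hk0 (show k ≤ m by omega)
      have h2 : ((m + 1).choose (k + 1) : ℝ) = ((m + 1 : ℕ) : ℝ) / ((k + 1 : ℕ) : ℝ) * m.choose k := by
        have h3 := Nat.add_one_mul_choose_eq m k
        have h4 : ((m + 1 : ℕ) : ℝ) * m.choose k = (m + 1).choose (k + 1) * ((k + 1 : ℕ) : ℝ) := by
          exact_mod_cast h3
        have h5 : ((k + 1 : ℕ) : ℝ) ≠ 0 := by positivity
        field_simp
        linarith
      have h3 : ((m + 1 : ℕ) : ℝ) / ((k + 1 : ℕ) : ℝ) ≤ (m : ℝ) / k := by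
        rw [div_le_div_iff₀ (by positivity) (by positivity)]
        have : (k : ℝ) ≤ m := by exact_mod_cast (show k ≤ m by omega)
        push_cast
        nlinarith
      rw [h2, pow_succ, mul_comm]
      refine mul_le_mul_of_nonneg_left (le_trans ?_ h1) (by positivity)
      exact pow_le_pow_left₀ (by positivity) h3 k

theorem mul_lg_le_lg_choose {k : ℕ} (hk : 0 < k) (hkn : k ≤ n) :
    k * lg ((n : ℝ) / k) ≤ lg (n.choose k) := by
  have h1 : (0 : ℝ) < (n : ℝ) / k := by
    have : 0 < n := by omega
    positivity
  rw [lg, ← Real.logb_pow]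
  exact lg_mono (by positivity) (pow_div_le_choose hk hkn)

theorem one_le_lg_div {k : ℕ} (hk : 0 < k) (hkn : 2 * k ≤ n) : 1 ≤ lg ((n : ℝ) / k) := by
  rw [← lg_two]
  refine lg_mono (by norm_num) ?_
  rw [le_div_iff₀ (by positivity)]
  exact_mod_cast hkn

theorem wt_le_mul_lg {S : Finset ℕ} (hS : ∀ p ∈ S, p < n) (hk : 0 < S.card)
    (hkn : 2 * S.card ≤ n) : (wt S : ℝ) ≤ 6 * (S.card * lg ((n : ℝ) / S.card)) := by
  set k := S.card with hkdef
  set s := Nat.log 2 (n / k) + 1 with hs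
  have h1 := wt_le hS s
  have h2 : n / 2 ^ s ≤ k := by
    have h3 : n / k < 2 ^ s := Nat.lt_pow_succ_log_self (by norm_num) _
    rw [Nat.div_lt_iff_lt_mul hk] at h3
    have h4 : n / 2 ^ s < k + 1 := by
      rw [Nat.div_lt_iff_lt_mul (by positivity)]
      nlinarith
    omega
  have h3 : wt S ≤ 2 * (k * s + k) := by
    rw [← hkdef] at h1
    omega
  have h4 : (s : ℝ) ≤ lg ((n : ℝ) / k) + 1 := by
    have h5 := natLog_le_lg (n / k)
    have h6 : 0 < n / k := Nat.div_pos (by omega) hk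
    have h7 : lg ((n / k : ℕ) : ℝ) ≤ lg ((n : ℝ) / k) :=
      lg_mono (by exact_mod_cast h6) Nat.cast_div_le
    rw [hs]
    push_cast
    linarith
  have h5 := one_le_lg_div hk hkn
  have h6 : (wt S : ℝ) ≤ 2 * (k * s + k) := by exact_mod_cast h3
  have h7 : (k : ℝ) * s ≤ k * (lg ((n : ℝ) / k) + 1) := mul_le_mul_of_nonneg_left h4 (by positivity)
  have h8 : (k : ℝ) * 1 ≤ k * lg ((n : ℝ) / k) := mul_le_mul_of_nonneg_left h5 (by positivity)
  linarith

/-- The set whose bitmap is encoded in the compressed representation of `S`. -/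
def smaller (S : Finset (Fin n)) : Finset (Fin n) := if 2 * S.card ≤ n then S else Sᶜ

theorem compress_eq (S : Finset (Fin n)) :
    compress S = decide (n < 2 * S.card) ::
      gammas (gapsFrom 0 ((smaller S).map Fin.valEmbedding).sort) := by
  rw [compress, smaller]
  split_ifs with h
  · rw [runLength_bitmap, decide_eq_false (by omega)]
  · rw [runLength_bitmap, decide_eq_true (by omega)]

theorem card_smaller (S : Finset (Fin n)) :
    (smaller S).card = min S.card (n - S.card) := by
  rw [smaller]
  split_ifs with h
  · omega
  · rw [Finset.card_compl, Fintype.card_fin]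
    omega

theorem length_compress_le (S : Finset (Fin n)) :
    ((compress S).length : ℝ) ≤ 240 * (lg (n.choose S.card) + 1) := by
  have hle : S.card ≤ n := by simpa using S.card_le_univ
  have h1 : (compress S).length ≤ 1 + wt ((smaller S).map Fin.valEmbedding) := by
    rw [compress_eq, List.length_cons]
    have := length_gammas_gapsFrom_le 0 ((smaller S).map Fin.valEmbedding)
    omega
  have h2 : ((compress S).length : ℝ) ≤ 1 + wt ((smaller S).map Fin.valEmbedding) := by
    exact_mod_cast h1
  have hcard := card_smaller S
  have hch : n.choose (smaller S).card = n.choose S.card := by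
    rw [hcard]
    rcases min_choice S.card (n - S.card) with h | h
    · rw [h]
    · rw [h, Nat.choose_symm hle]
  have hS : ∀ p ∈ (smaller S).map Fin.valEmbedding, p < n := by
    intro p hp
    obtain ⟨i, _, rfl⟩ := Finset.mem_map.1 hp
    exact i.2
  rw [← hch]
  rcases Nat.eq_zero_or_pos (smaller S).card with h0 | h0
  · rw [Finset.card_eq_zero.1 h0] at h2 ⊢
    simp only [Finset.map_empty, wt_empty, Finset.card_empty, Nat.choose_zero_right,
      Nat.cast_one, Nat.cast_zero] at h2 ⊢
    rw [show lg 1 = 0 by simp [lg]]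
    linarith
  · have h3 := wt_le_mul_lg hS (by rwa [Finset.card_map]) (by rw [Finset.card_map]; omega)
    rw [Finset.card_map] at h3
    have h4 := mul_lg_le_lg_choose h0 (show (smaller S).card ≤ n by omega)
    have h5 : (0 : ℝ) ≤ (smaller S).card * lg ((n : ℝ) / (smaller S).card) := by
      have := one_le_lg_div h0 (show 2 * (smaller S).card ≤ n by omega)
      positivity
    linarith

end

end SecondaryIndex

namespace SecondaryIndex

/-! ### The cost of a query -/

section

variable {n σ : ℕ}

theorem map_rangeAnswer (x : Fin n → Fin σ) (l r : Fin σ) :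
    (rangeAnswer x l r).map Fin.valEmbedding = interval (chars x) n l (r + 1) := by
  ext p
  simp only [rangeAnswer, Finset.mem_map, Finset.mem_filter, Finset.mem_univ, true_and,
    Fin.valEmbedding_apply, mem_interval, Fin.le_def]
  constructor
  · rintro ⟨i, h, rfl⟩
    rw [chars_val]
    exact ⟨i.2, h.1, by omega⟩
  · rintro ⟨h1, h2, h3⟩
    have := chars_val x ⟨p, h1⟩
    simp only at this
    exact ⟨⟨p, h1⟩, ⟨by omega, by omega⟩, rfl⟩

theorem card_rangeAnswer (x : Fin n → Fin σ) (l r : Fin σ) :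
    (rangeAnswer x l r).card = below (chars x) n (r + 1) - below (chars x) n l := by
  rw [← card_interval, ← map_rangeAnswer, Finset.card_map]

theorem chars_lt (x : Fin n → Fin σ) {p : ℕ} (hp : p < n) : chars x p < σ := by
  have := chars_val x ⟨p, hp⟩
  simp only at this
  omega

theorem below_top (x : Fin n → Fin σ) : below (chars x) n σ = n := by
  rw [below, Finset.filter_true_of_mem fun p hp => chars_lt x (Finset.mem_range.1 hp),
    Finset.card_range]

theorem below_bot (y : ℕ → ℕ) : below y n 0 = 0 := by simp [below]

theorem map_smaller (x : Fin n → Fin σ) (l r : Fin σ) {comp : Bool}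
    (hcomp : comp = decide (n < 2 * (rangeAnswer x l r).card)) :
    (smaller (rangeAnswer x l r)).map Fin.valEmbedding =
      interval (chars x) n (ranges σ l r comp false).1 (ranges σ l r comp false).2 ∪
        interval (chars x) n (ranges σ l r comp true).1 (ranges σ l r comp true).2 := by
  cases comp
  · have h : ¬ n < 2 * (rangeAnswer x l r).card := by simpa using hcomp
    have h0 : interval (chars x) n 0 0 = ∅ := by simp [interval]
    simp only [smaller, if_pos (not_lt.1 h), ranges, Bool.false_eq_true, if_false, if_true,
      map_rangeAnswer, h0, Finset.union_empty]
  · have h : n < 2 * (rangeAnswer x l r).card := by simpa using hcomp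
    simp only [smaller, if_neg (not_le.2 h), ranges, Bool.false_eq_true, if_false, if_true]
    ext p
    simp only [rangeAnswer, Finset.mem_map, Finset.mem_compl, Finset.mem_filter, Finset.mem_univ,
      true_and, Fin.valEmbedding_apply, Finset.mem_union, mem_interval, Fin.le_def]
    constructor
    · rintro ⟨i, h, rfl⟩
      rw [chars_val]
      have := (x i).2
      omega
    · intro h
      have hp : p < n := h.elim And.left And.left
      have := chars_val x ⟨p, hp⟩
      simp only at this
      exact ⟨⟨p, hp⟩, by omega, rfl⟩

theorem sum_ranges_le (x : Fin n → Fin σ) (l r : Fin σ) {comp : Bool}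
    (hcomp : comp = decide (n < 2 * (rangeAnswer x l r).card)) :
    ∑ b, (below (chars x) n (ranges σ l r comp b).2 - below (chars x) n (ranges σ l r comp b).1) ≤
      (smaller (rangeAnswer x l r)).card := by
  have hz := card_rangeAnswer x l r
  rw [card_smaller]
  cases comp
  · have h : ¬ n < 2 * (rangeAnswer x l r).card := by simpa using hcomp
    simp only [Fintype.sum_bool, ranges, Bool.false_eq_true, if_false, if_true]
    omega
  · have h : n < 2 * (rangeAnswer x l r).card := by simpa using hcomp
    have h1 := below_le (chars x) (n := n) (r + 1)
    simp only [Fintype.sum_bool, ranges, Bool.false_eq_true, if_false, if_true, below_top, below_bot]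
    omega

/-- The level `i` from which on few positions are left; `2 ^ i` is about `lg (n / k)`. -/
theorem exists_level {k : ℕ} (hk : 0 < k) (hkn : 2 * k ≤ n) :
    ∃ i, 1 ≤ i ∧ n ≤ k * 2 ^ expo i ∧ (2 ^ i : ℝ) ≤ 4 * lg ((n : ℝ) / k) := by
  have hex : ∃ i, n ≤ k * 2 ^ expo i := by
    refine ⟨n, ?_⟩
    have h1 := Nat.lt_two_pow_self (n := n)
    have h2 : 2 ^ n ≤ 2 ^ expo n := Nat.pow_le_pow_right (by norm_num) (le_expo n)
    nlinarith
  have hspec := Nat.find_spec hex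
  set i := Nat.find hex with hi
  have hi0 : 1 ≤ i := by
    by_contra h
    rw [show i = 0 by omega, expo_zero] at hspec
    omega
  obtain ⟨m, hm⟩ : ∃ m, i = m + 1 := ⟨i - 1, by omega⟩
  have hmin : ¬ n ≤ k * 2 ^ expo m := Nat.find_min hex (by omega)
  refine ⟨i, hi0, hspec, ?_⟩
  have h1 : (expo m : ℝ) ≤ lg ((n : ℝ) / k) := by
    rw [← lg_two_pow]
    refine lg_mono (by positivity) ?_
    rw [le_div_iff₀ (by exact_mod_cast hk), mul_comm]
    exact_mod_cast (not_le.1 hmin).le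
  have h2 : (2 ^ m : ℝ) = expo m + 1 := by exact_mod_cast (expo_add_one m).symm
  have h3 := one_le_lg_div hk hkn
  rw [hm, pow_succ, h2]
  linarith

theorem exists_queryAlg_encode {B M F d : ℕ} (hn : 4 ≤ n) (hBn : lg n ≤ B) (hd : 3 * d + 5 ≤ n)
    (hF : 8 * levels n * σ + 2 ≤ F ^ d)
    (hM : Nat.size σ + Nat.size σ + 2000 * ((d + 1) * (F + 1) * B) ≤ M) :
    ∃ A : QueryAlg B M σ, ∀ (x : Fin n → Fin σ) (l r : Fin σ) (W : Disk), ∃ t : ℕ,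
      A.Runs (diskOf (encode (chars x) n σ)) (A.init l r) W t (compress (rangeAnswer x l r)) ∧
      (t : ℝ) ≤ 260 + 520 * levels n + (910 + 780 * d) *
        (72 * ((smaller (rangeAnswer x l r)).card *
          lg ((n : ℝ) / (smaller (rangeAnswer x l r)).card) / B) + 4 * levels n) := by
  have hs : Nat.size n ≤ B + 1 := by
    have := size_le_lg (n := n) (by omega)
    have : (Nat.size n : ℝ) ≤ ((B + 1 : ℕ) : ℝ) := by
      push_cast
      linarith
    exact_mod_cast this
  have hs3 : 3 ≤ Nat.size n := Nat.lt_size.2 hn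
  have hlt := Nat.lt_size_self n
  have hB0 : 0 < B := by omega
  have hB1 : 2 * Nat.size n ≤ 4 * B := by omega
  have hB2 : 5 * width n ≤ 64 * B := by
    rw [width]
    omega
  have hpow : 2 ^ (2 * Nat.size n) = 2 ^ Nat.size n * 2 ^ Nat.size n := by rw [two_mul, pow_add]
  have h2s : 2 * Nat.size n ≤ 2 ^ Nat.size n := by
    obtain ⟨m, hm⟩ : ∃ m, Nat.size n = m + 1 := ⟨Nat.size n - 1, by omega⟩
    have := Nat.lt_two_pow_self (n := m)
    rw [hm, pow_succ]
    omega
  obtain ⟨A, hA⟩ := Prog.exists_queryAlg (M := M)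
    (f := fun l r : Fin σ => Prog.query n σ B (1 + n * (2 * Nat.size n)) ((3 * d + 5) * (n + 1)) F d
      l r)
    ((Prog.fits_query (a := 2 * Nat.size n) (w := Nat.size σ) (v := 2 * Nat.size n) (F := F) hB0
      (by
        rw [hpow]
        calc (3 * d + 5) * (n + 1) ≤ n * 2 ^ Nat.size n := Nat.mul_le_mul hd hlt
          _ < 2 ^ Nat.size n * 2 ^ Nat.size n := Nat.mul_lt_mul_of_pos_right hlt (by positivity))
      (by nlinarith)
      (by
        have h1 := levels_le (n := n) (by omega)
        rw [hpow]
        nlinarith)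
      (by
        rw [hpow]
        have h1 : n * (2 * Nat.size n) + 1 * 2 ^ Nat.size n ≤ n * 2 ^ Nat.size n + 1 * 2 ^ Nat.size n :=
          Nat.add_le_add_right (Nat.mul_le_mul_left n h2s) _
        rw [← Nat.add_mul] at h1
        have h2 := Nat.mul_le_mul_right (2 ^ Nat.size n) (show n + 1 ≤ 2 ^ Nat.size n from hlt)
        omega)
      (Nat.lt_size_self σ) hB1 hB1 (by rw [width]; omega) d).mono hM)
  refine ⟨A, fun x l r W => ?_⟩
  obtain ⟨comp, hcomp⟩ : ∃ comp, comp = decide (n < 2 * (rangeAnswer x l r).card) := ⟨_, rfl⟩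
  have hcomp' := hcomp
  rw [card_rangeAnswer] at hcomp'
  obtain ⟨len, W', t, N, h1, h2, h3, h4, h5⟩ := Prog.exec_query (F := F)
    (base := 1 + n * (2 * Nat.size n)) (chars x) (by omega) hB0 hB1 hB2 (d := d) le_rfl hF le_rfl l.2
    r.2 W hcomp' (by
      rintro rfl
      by_contra h
      rw [not_or] at h
      have h6 : below (chars x) n (r + 1) = n := by
        rw [show (r : ℕ) + 1 = σ by omega, below_top]
      have h7 : below (chars x) n l = 0 := by
        rw [show (l : ℕ) = 0 by omega, below_bot]
      rw [h6, h7, eq_comm, decide_eq_false_iff_not] at hcomp'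
      omega)
  have hrun := hA _ _ _ _ _ _ _ h1
  rw [h2, ← map_smaller x l r hcomp, hcomp, ← compress_eq] at hrun
  refine ⟨t, hrun, ?_⟩
  have hk := sum_ranges_le x l r hcomp
  set k := (smaller (rangeAnswer x l r)).card with hkdef
  have hkn : 2 * k ≤ n := by
    rw [hkdef, card_smaller]
    omega
  have hBpos : (0 : ℝ) < B := by exact_mod_cast hB0
  have hN : (N : ℝ) ≤ 72 * (k * lg ((n : ℝ) / k) / B) + 4 * levels n := by
    rcases Nat.eq_zero_or_pos k with h0 | h0
    · rw [show N = 0 by omega, h0]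
      simp
    · obtain ⟨i, hi0, hi1, hi2⟩ := exists_level h0 hkn
      have hb : ∀ b, below (chars x) n (ranges σ l r comp b).2
          - below (chars x) n (ranges σ l r comp b).1 ≤ k := fun b =>
        (Finset.single_le_sum (f := fun b => below (chars x) n (ranges σ l r comp b).2
          - below (chars x) n (ranges σ l r comp b).1) (fun _ _ => Nat.zero_le _)
          (Finset.mem_univ b)).trans hk
      have hS := fun b => sum_segmentWt_le (chars x) (n := n)
        (ranges_le (σ := σ) r.2 l.2 comp b).2 (hb b) hi0 hi1 (levels n)
      have h6 : 16 * B * N ≤ 288 * (k * 2 ^ i) + 64 * B * levels n := by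
        rw [Fintype.sum_bool] at h4
        have a1 := hS true
        have a2 := hS false
        omega
      have h7 : (16 * B * N : ℝ) ≤ 288 * (k * 2 ^ i) + 64 * B * levels n := by exact_mod_cast h6
      have h8 : (k : ℝ) * 2 ^ i ≤ k * (4 * lg ((n : ℝ) / k)) :=
        mul_le_mul_of_nonneg_left hi2 (Nat.cast_nonneg k)
      have h9 : (N : ℝ) ≤ (72 * (k * lg ((n : ℝ) / k)) + 4 * levels n * B) / B := by
        rw [le_div_iff₀ hBpos]
        nlinarith
      refine h9.trans_eq ?_
      field_simp
  have h6 : (t : ℝ) ≤ 260 + 520 * levels n + (910 + 780 * d) * N := by exact_mod_cast h5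
  refine h6.trans ?_
  gcongr

end

/-! ### The choice of the parameters -/

theorem tendsto_lg : Filter.Tendsto (fun n : ℕ => lg n) Filter.atTop Filter.atTop :=
  (Real.tendsto_logb_atTop (by norm_num)).comp tendsto_natCast_atTop_atTop

theorem eventually_lg_le : ∀ᶠ u : ℝ in Filter.atTop, 8 * lg u + 18 ≤ u := by
  have h1 := Real.isLittleO_log_id_atTop.bound (show (0 : ℝ) < 1 / 32 by norm_num)
  filter_upwards [h1, Filter.eventually_ge_atTop 36] with u h1 h2
  rw [id, Real.norm_of_nonneg (Real.log_nonneg (by linarith)), Real.norm_of_nonneg (by linarith)]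
    at h1
  have h3 : lg u ≤ 2 * Real.log u := by
    rw [lg, Real.logb, div_le_iff₀ (Real.log_pos (by norm_num))]
    have := Real.log_two_gt_d9
    have := Real.log_nonneg (show 1 ≤ u by linarith)
    nlinarith
  linarith

theorem lg_le_rpow {s δ : ℝ} (hs : 1 ≤ s) (hδ : 0 < δ) : lg s ≤ 2 / δ * s ^ δ := by
  have h1 := Real.log_le_rpow_div (show 0 ≤ s by linarith) hδ
  have h2 : lg s ≤ 2 * Real.log s := by
    rw [lg, Real.logb, div_le_iff₀ (Real.log_pos (by norm_num))]
    have := Real.log_two_gt_d9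
    have := Real.log_nonneg hs
    nlinarith
  calc lg s ≤ 2 * (s ^ δ / δ) := by linarith
    _ = 2 / δ * s ^ δ := by ring

/-- The runs are merged in `d = ⌈2 / δ⌉` passes, with `(σ lg n) ^ (δ / 2)` runs at a time. -/
theorem exists_fanout {δ : ℝ} (hδ : 0 < δ) {d : ℕ} (hd : 2 / δ ≤ d) :
    ∃ n₀ : ℕ, ∀ n σ B M : ℕ, n₀ ≤ n → 1 ≤ σ → lg n ≤ B → (B : ℝ) * ((σ : ℝ) * lg n) ^ δ ≤ M →
      ∃ F : ℕ, 8 * levels n * σ + 2 ≤ F ^ d ∧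
        Nat.size σ + Nat.size σ + 2000 * ((d + 1) * (F + 1) * B) ≤ M := by
  have e1 := tendsto_lg.eventually eventually_lg_le
  have e2 := ((tendsto_rpow_atTop (half_pos hδ)).comp tendsto_lg).eventually_ge_atTop
    (12000 * ((d : ℝ) + 1))
  have e3 := tendsto_lg.eventually_ge_atTop (2 * (4 / δ + 2))
  obtain ⟨n₀, h₀⟩ := Filter.eventually_atTop.1
    (e1.and (e2.and (e3.and (Filter.eventually_ge_atTop 4))))
  refine ⟨n₀, fun n σ B M hn hσ hB hM => ?_⟩
  obtain ⟨e1, e2, e3, e4⟩ := h₀ n hn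
  simp only [Function.comp_apply] at e2
  have hl : 2 ≤ lg n := by
    have : lg ((2 : ℝ) ^ 2) ≤ lg n := lg_mono (by norm_num) (by norm_num; exact_mod_cast e4)
    rw [lg_two_pow] at this
    exact_mod_cast this
  have hσ1 : (1 : ℝ) ≤ σ := by exact_mod_cast hσ
  set Q : ℝ := σ * lg n with hQ
  have hQl : lg n ≤ Q := by nlinarith
  have hQσ : (σ : ℝ) ≤ Q := by nlinarith
  have hQ1 : 1 ≤ Q := by linarith
  have hQ0 : 0 ≤ Q := by linarith
  set R : ℝ := Q ^ (δ / 2) with hR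
  have hR1 : 1 ≤ R := Real.one_le_rpow hQ1 (half_pos hδ).le
  have hRR : Q ^ δ = R * R := by rw [hR, ← Real.rpow_add (by linarith), add_halves]
  have hRbig : 12000 * ((d : ℝ) + 1) ≤ R :=
    e2.trans (Real.rpow_le_rpow (by linarith) hQl (half_pos hδ).le)
  refine ⟨⌈R⌉₊, ?_, ?_⟩
  · have h1 : Q ≤ (⌈R⌉₊ : ℝ) ^ d := by
      have h2 : R ^ d = Q ^ (δ / 2 * d) := by rw [hR, ← Real.rpow_natCast, ← Real.rpow_mul hQ0]
      have h3 : Q ^ (1 : ℝ) ≤ Q ^ (δ / 2 * d) := by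
        refine Real.rpow_le_rpow_of_exponent_le hQ1 ?_
        rw [div_le_iff₀ hδ] at hd
        linarith
      rw [Real.rpow_one, ← h2] at h3
      exact h3.trans (pow_le_pow_left₀ (by linarith) (Nat.le_ceil R) d)
    have h2 := levels_le_lg e4
    have h3 : ((8 * levels n * σ + 2 : ℕ) : ℝ) ≤ ((⌈R⌉₊ ^ d : ℕ) : ℝ) := by
      push_cast
      refine le_trans ?_ h1
      have h4 : (8 * (levels n : ℝ) + 2) * σ ≤ lg n * σ :=
        mul_le_mul_of_nonneg_right (by linarith) (by linarith)
      nlinarith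
    exact_mod_cast h3
  · have hF : (⌈R⌉₊ : ℝ) + 1 ≤ 3 * R := by
      have := (Nat.ceil_lt_add_one (show 0 ≤ R by linarith)).le
      linarith
    have hB0 : (0 : ℝ) ≤ B := Nat.cast_nonneg B
    have h1 : (2000 * (((d : ℝ) + 1) * (⌈R⌉₊ + 1) * B)) ≤ B * (R * R) / 2 := by
      have h2 : ((d : ℝ) + 1) * (⌈R⌉₊ + 1) ≤ (d + 1) * (3 * R) :=
        mul_le_mul_of_nonneg_left hF (by positivity)
      have h3 : ((d : ℝ) + 1) * (⌈R⌉₊ + 1) * B ≤ (d + 1) * (3 * R) * B :=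
        mul_le_mul_of_nonneg_right h2 hB0
      have h4 : 12000 * ((d : ℝ) + 1) * (R * B) ≤ R * (R * B) :=
        mul_le_mul_of_nonneg_right hRbig (by positivity)
      nlinarith
    have h2 : (2 * Nat.size σ : ℝ) ≤ B * (R * R) / 2 := by
      have h3 := size_le_lg hσ
      have h4 := lg_le_rpow hσ1 hδ
      have h5 : (1 : ℝ) ≤ (σ : ℝ) ^ δ := Real.one_le_rpow hσ1 hδ.le
      have h6 : (σ : ℝ) ^ δ ≤ R * R := by
        rw [← hRR]
        exact Real.rpow_le_rpow (by linarith) hQσ hδ.le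
      have h7 : (2 * Nat.size σ : ℝ) ≤ (4 / δ + 2) * (σ : ℝ) ^ δ := by
        have h8 : 4 / δ * (σ : ℝ) ^ δ = 2 * (2 / δ * (σ : ℝ) ^ δ) := by ring
        nlinarith
      have h8 : (4 / δ + 2) * (σ : ℝ) ^ δ ≤ B / 2 * (R * R) :=
        mul_le_mul (by linarith) h6 (by linarith) (by linarith)
      linarith
    have h3 : ((Nat.size σ + Nat.size σ + 2000 * ((d + 1) * (⌈R⌉₊ + 1) * B) : ℕ) : ℝ) ≤ M := by
      rw [hRR] at hM
      push_cast
      linarith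
    exact_mod_cast h3

end SecondaryIndex

open SecondaryIndex
/-- `enc n σ B x` is the bit string stored for `x`. The space bound and the size of the compressed
answers have an absolute constant `C₀`; the I/O bound has a constant that depends on the exponent
`δ` in `M ≥ B (σ lg n) ^ δ` and on the constants hidden in `b = Θ(B / lg n)`. In the I/O bound, `k`
is the size of the answer or of its complement, whichever is smaller. The working disk may hold
anything (`W`) when a query starts. -/
theorem theorem2 :
    ∃ (C₀ : ℝ) (enc : (n σ B : ℕ) → (Fin n → Fin σ) → List Bool),
      (∀ (n σ B : ℕ) (x : Fin n → Fin σ), lg n ≤ B →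
        ((enc n σ B x).length : ℝ) ≤ C₀ * (n * entropy0 x + n + σ * lg n ^ 2)) ∧
      ∀ δ c₁ c₂ : ℝ, 0 < δ → 0 < c₁ → 0 < c₂ →
        ∃ (C : ℝ) (n₀ : ℕ), ∀ (n σ B M : ℕ) (b : ℝ),
          n₀ ≤ n → lg n ≤ B → 2 ≤ b → c₁ * (B / lg n) ≤ b → b ≤ c₂ * (B / lg n) →
          (B : ℝ) * ((σ : ℝ) * lg n) ^ δ ≤ M →
          ∃ A : QueryAlg B M σ, ∀ (x : Fin n → Fin σ) (l r : Fin σ) (z k : ℕ),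
            z = (rangeAnswer x l r).card → k = min z (n - z) →
            ((compress (rangeAnswer x l r)).length : ℝ) ≤ C₀ * (lg (n.choose z) + 1) ∧
            ∀ W : Disk, ∃ t : ℕ,
              A.Runs (diskOf (enc n σ B x)) (A.init l r) W t (compress (rangeAnswer x l r)) ∧
              (t : ℝ) ≤ C * (k * lg ((n : ℝ) / k) / B + Real.logb b n + lg (lg n)) := by
  refine ⟨240, fun n σ _ x => encode (chars x) n σ, fun n σ B x _ => length_encode_le x,
    fun δ c₁ c₂ hδ _ _ => ?_⟩
  obtain ⟨d, hd⟩ := exists_nat_ge (2 / δ)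
  obtain ⟨n₀, h₀⟩ := exists_fanout hδ hd
  refine ⟨1820 + (910 + 780 * d) * 84, max n₀ (max 4 (3 * d + 5)),
    fun n σ B M b hn hB hb _ _ hM => ?_⟩
  have hn4 : 4 ≤ n := (le_max_left _ _).trans ((le_max_right _ _).trans hn)
  rcases Nat.eq_zero_or_pos σ with rfl | hσ
  · exact ⟨⟨fun _ _ _ => false, fun _ => .halt 0⟩, fun x l => l.elim0⟩
  obtain ⟨F, hF, hFM⟩ := h₀ n σ B M ((le_max_left _ _).trans hn) hσ hB hM
  obtain ⟨A, hA⟩ := exists_queryAlg_encode hn4 hB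
    ((le_max_right _ _).trans ((le_max_right _ _).trans hn)) hF hFM
  refine ⟨A, fun x l r z k hz hk => ⟨?_, fun W => ?_⟩⟩
  · rw [hz]
    exact length_compress_le _
  obtain ⟨t, h1, h2⟩ := hA x l r W
  refine ⟨t, h1, h2.trans ?_⟩
  rw [card_smaller, ← hz, ← hk]
  have h3 : 0 ≤ Real.logb b n :=
    Real.logb_nonneg (by linarith) (by exact_mod_cast (show 1 ≤ n by omega))
  have h4 : 1 ≤ lg (lg n) := by
    have h5 : 2 ≤ lg n := by
      have : lg ((2 : ℝ) ^ 2) ≤ lg n := lg_mono (by norm_num) (by norm_num; exact_mod_cast hn4)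
      rw [lg_two_pow] at this
      exact_mod_cast this
    rw [← lg_two]
    exact lg_mono (by norm_num) h5
  have h5 := levels_le_lg hn4
  have h6 : 0 ≤ k * lg ((n : ℝ) / k) / B := by
    rcases Nat.eq_zero_or_pos k with h0 | h0
    · simp [h0]
    · have := one_le_lg_div (n := n) h0 (by omega)
      positivity
  set X := k * lg ((n : ℝ) / k) / B
  have h7 : 72 * X + 4 * (levels n : ℝ) ≤ 84 * (X + Real.logb b n + lg (lg n)) := by linarith
  have h8 : (910 + 780 * (d : ℝ)) * (72 * X + 4 * levels n) ≤
      (910 + 780 * d) * (84 * (X + Real.logb b n + lg (lg n))) :=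
    mul_le_mul_of_nonneg_left h7 (by positivity)
  nlinarith
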